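/- Let $d\ge 1$ and let $\varphi\in C^\infty(\mathbb R;\mathbb R)$ be a nonzero bump function supported in $(\tfrac14,4)$. For $t\in\mathbb R$ and an integer $j\ge1$ let $e^{it\sqrt{-\Delta}}P_j$ be the Fourier multiplier operator with symbol $\varphi(2^{-j}|\xi|)e^{it|\xi|}$, i.e. $$e^{it\sqrt{-\Delta}}P_jf=K_{j,t}*f,\qquad K_{j,t}(x)=(2\pi)^{-d}\int_{\mathbb R^d}\varphi(2^{-j}|\xi|)\,e^{i\langle x,\xi\rangle+it|\xi|}\,d\xi ,$$ which is defined for all $f\in L^p(\mathbb R^d)$, $1\le p\le\infty$, and equals $(2\pi)^{-d}\int\varphi(2^{-j}|\xi|)\widehat f(\xi)e^{i\langle x,\xi\rangle+it|\xi|}d\xi$, with $\widehat f(\xi)=\int f(y)e^{-i\langle y,\xi\rangle}dy$, when $f$ is a Schwartz function. For a bounded nonempty set $E\subset\mathbb R$ and $\alpha\in\mathbb R$ let $$\nu_E^\sharp(\alpha)=\limsup_{\delta\to0+}\frac{\log\big(\sup_{\delta\le|I|\le1}|I|^{-\alpha}N(E\cap I,\delta)\big)}{\log(1/\delta)}$$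 be the Legendre–Assouad function of $E$, where the supremum is over all intervals $I$ whose length $|I|$ lies in $[\delta,1]$ and $N(A,\delta)$ is the minimal number of closed intervals of length $\delta$ needed to cover $A$. A $2^{-j}$-discretization of $E$ is a subset of $E$ that is maximal (with respect to inclusion) among the subsets of $E$ any two distinct points of which are at distance at least $2^{-j}$. Let $E\subset[1,2]$ be nonempty, $2\le p<\infty$ and $s_p=(d-1)\big(\tfrac12-\tfrac1p\big)$. Then the following hold. (i) For every $\varepsilon>0$ there is a constant $C_{\varepsilon,p}>0$ such that for all $j\ge1$, all $2^{-j}$-discretizations $E_j$ of $E$ and all radial $f\in L^p(\mathbb R^d)$, $$\Big(\sum_{t\in E_j}\|e^{it\sqrt{-\Delta}}P_jf\|_p^p\Big)^{1/p}\le C_{\varepsilon,p}\,2^{j(\frac1p\nu_E^\sharp(ps_p)+\varepsilon)}\,\|f\|_p .$$ (ii) The exponent is sharp up to the $\varepsilon$-loss: for every $s<\tfrac1p\nu_E^\sharp(ps_p)$, every choice of $2^{-j}$-discretizations $E_j$ of $E$ $(j\ge1)$ and every constant $C$, there are $j\ge1$ and a radial $f\in L^p(\mathbb R^d)$ with $$\Big(\sum_{t\in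 E_j}\|e^{it\sqrt{-\Delta}}P_jf\|_p^p\Big)^{1/p}> C\,2^{js}\,\|f\|_p .$$ -/

import Mathlib

open MeasureTheory Filter Topology
open scoped ENNReal ContDiff

namespace FractalSmoothing

noncomputable section

/-- The covering number `N(S, δ)`: the minimal number of closed intervals of length `δ`
(closed balls of radius `δ / 2` in `ℝ`) needed to cover `S`. -/
def covNum (S : Set ℝ) (δ : ℝ) : ℕ :=
  (Metric.externalCoveringNumber (δ / 2).toNNReal S).toNat

/-- `sup_{δ ≤ |I| ≤ 1} |I|^{-α} N(E ∩ I, δ)`. Closed intervals suffice, because the closure of a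
bounded interval has the same length and `N` is monotone in the set. -/
def supCov (E : Set ℝ) (α δ : ℝ) : ℝ :=
  sSup {y : ℝ | ∃ a b : ℝ, δ ≤ b - a ∧ b - a ≤ 1 ∧
    y = (b - a) ^ (-α) * (covNum (E ∩ Set.Icc a b) δ : ℝ)}

/-- The Legendre–Assouad function `ν_E^♯(α)` of a (bounded, nonempty) set `E ⊆ ℝ`. -/
def legendreAssouad (E : Set ℝ) (α : ℝ) : ℝ :=
  limsup (fun δ : ℝ => Real.log (supCov E α δ) / Real.log (1 / δ)) (𝓝[>] 0)

/-- `S` is a `δ`-discretization of `E`: a maximal `δ`-separated subset of `E`. -/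
def IsDiscretization (E : Set ℝ) (δ : ℝ) (S : Set ℝ) : Prop :=
  Maximal (fun T : Set ℝ => T ⊆ E ∧ T.Pairwise fun s t => δ ≤ |s - t|) S

/-- A function on `ℝ^d` is radial if it depends only on `‖x‖`. -/
def IsRadial {d : ℕ} (f : EuclideanSpace ℝ (Fin d) → ℂ) : Prop :=
  ∀ x y, ‖x‖ = ‖y‖ → f x = f y

/-- A nontrivial smooth bump function with (compact) support inside `(1/4, 4)`. -/
structure IsBump (φ : ℝ → ℝ) : Prop where
  smooth : ContDiff ℝ ∞ φ
  support : tsupport φ ⊆ Set.Ioo (1 / 4) 4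
  ne_zero : φ ≠ 0

/-- The Fourier transform `∫ f(y) e^{-i⟨y, ξ⟩} dy`. -/
def fourierHat {d : ℕ} (f : EuclideanSpace ℝ (Fin d) → ℂ) (ξ : EuclideanSpace ℝ (Fin d)) : ℂ :=
  ∫ y, f y * Complex.exp (-(Complex.I * (inner ℝ y ξ : ℝ)))

/-- The convolution kernel of `e^{it√-Δ} P_j`, where `P_j = φ(2^{-j}|D|)`, that is
`(2π)^{-d} ∫ φ(2^{-j}|ξ|) e^{i⟨x, ξ⟩ + it|ξ|} dξ`. -/
def waveKernel (d : ℕ) (φ : ℝ → ℝ) (j : ℕ) (t : ℝ) (x : EuclideanSpace ℝ (Fin d)) : ℂ :=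
  ((2 * Real.pi : ℝ) ^ d : ℂ)⁻¹ * ∫ ξ : EuclideanSpace ℝ (Fin d),
    (φ (((2 : ℝ) ^ j)⁻¹ * ‖ξ‖) : ℂ) *
      Complex.exp (Complex.I * (inner ℝ x ξ : ℝ) + Complex.I * (t * ‖ξ‖ : ℝ))

/-- The frequency localized half-wave propagator `e^{it√-Δ} P_j f`. The symbol
`φ(2^{-j}|ξ|) e^{it|ξ|}` is smooth with compact support, so the operator is convolution with a
Schwartz function, which is defined on all of `L^p`; `halfWave_eq` gives the formula with the
Fourier transform of `f` when `f` is integrable, in particular when `f` is Schwartz. -/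
def halfWave {d : ℕ} (φ : ℝ → ℝ) (j : ℕ) (t : ℝ) (f : EuclideanSpace ℝ (Fin d) → ℂ)
    (x : EuclideanSpace ℝ (Fin d)) : ℂ :=
  ∫ y, waveKernel d φ j t (x - y) * f y

theorem integrable_symbol {φ : ℝ → ℝ} (hφ : IsBump φ) (d j : ℕ) :
    Integrable (fun ξ : EuclideanSpace ℝ (Fin d) => (φ (((2 : ℝ) ^ j)⁻¹ * ‖ξ‖) : ℂ)) := by
  have hc : Continuous φ := hφ.smooth.continuous
  have h2 : (0 : ℝ) < 2 ^ j := by positivity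
  refine Continuous.integrable_of_hasCompactSupport (by fun_prop) ?_
  refine HasCompactSupport.intro (isCompact_closedBall 0 (4 * 2 ^ j)) fun ξ hξ => ?_
  have h0 : φ (((2 : ℝ) ^ j)⁻¹ * ‖ξ‖) = 0 := by
    by_contra h
    have h1 := hφ.support (subset_tsupport φ h)
    apply hξ
    rw [mem_closedBall_zero_iff]
    have h3 := h1.2
    rw [inv_mul_lt_iff₀ h2] at h3
    linarith
  simp [h0]

/-- On integrable `f` the operator is
`(2π)^{-d} ∫ φ(2^{-j}|ξ|) \hat f(ξ) e^{i⟨x, ξ⟩ + it|ξ|} dξ`. -/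
theorem halfWave_eq {d : ℕ} {φ : ℝ → ℝ} (hφ : IsBump φ) (j : ℕ) (t : ℝ)
    {f : EuclideanSpace ℝ (Fin d) → ℂ} (hf : Integrable f) (x : EuclideanSpace ℝ (Fin d)) :
    halfWave φ j t f x = ((2 * Real.pi : ℝ) ^ d : ℂ)⁻¹ * ∫ ξ : EuclideanSpace ℝ (Fin d),
      (φ (((2 : ℝ) ^ j)⁻¹ * ‖ξ‖) : ℂ) * fourierHat f ξ *
        Complex.exp (Complex.I * (inner ℝ x ξ : ℝ) + Complex.I * (t * ‖ξ‖ : ℝ)) := by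
  have hint : Integrable (fun z : EuclideanSpace ℝ (Fin d) × EuclideanSpace ℝ (Fin d) =>
      Complex.exp (Complex.I * (inner ℝ (x - z.1) z.2 : ℝ) + Complex.I * (t * ‖z.2‖ : ℝ)) *
        (f z.1 * (φ (((2 : ℝ) ^ j)⁻¹ * ‖z.2‖) : ℂ))) (volume.prod volume) := by
    refine Integrable.bdd_mul (c := 1) (hf.mul_prod (integrable_symbol hφ d j)) ?_ ?_
    · exact Continuous.aestronglyMeasurable (by fun_prop)
    · refine Eventually.of_forall fun z => ?_
      rw [← mul_add, ← Complex.ofReal_add, Complex.norm_exp_I_mul_ofReal]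
  unfold halfWave waveKernel
  simp_rw [mul_assoc, integral_const_mul]
  congr 1
  simp_rw [← integral_mul_const]
  have hsw := integral_integral_swap
    (f := fun y ξ : EuclideanSpace ℝ (Fin d) =>
      Complex.exp (Complex.I * (inner ℝ (x - y) ξ : ℝ) + Complex.I * (t * ‖ξ‖ : ℝ)) *
        (f y * (φ (((2 : ℝ) ^ j)⁻¹ * ‖ξ‖) : ℂ))) hint
  calc _ = ∫ y : EuclideanSpace ℝ (Fin d), ∫ ξ : EuclideanSpace ℝ (Fin d),
      Complex.exp (Complex.I * (inner ℝ (x - y) ξ : ℝ) + Complex.I * (t * ‖ξ‖ : ℝ)) *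
        (f y * (φ (((2 : ℝ) ^ j)⁻¹ * ‖ξ‖) : ℂ)) := by
        refine integral_congr_ae (Eventually.of_forall fun y => ?_)
        refine integral_congr_ae (Eventually.of_forall fun ξ => ?_)
        simp only
        ring
    _ = _ := hsw
    _ = _ := by
        refine integral_congr_ae (Eventually.of_forall fun ξ => ?_)
        simp only [fourierHat]
        rw [← integral_mul_const, ← integral_const_mul]
        refine integral_congr_ae (Eventually.of_forall fun y => ?_)
        have he : Complex.exp (Complex.I * (inner ℝ (x - y) ξ : ℝ) + Complex.I * (t * ‖ξ‖ : ℝ)) =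
            Complex.exp (-(Complex.I * (inner ℝ y ξ : ℝ))) *
            Complex.exp (Complex.I * (inner ℝ x ξ : ℝ) + Complex.I * (t * ‖ξ‖ : ℝ)) := by
          rw [← Complex.exp_add, inner_sub_left]
          congr 1
          push_cast
          ring
        simp only
        rw [he]
        ring

/-- `(∑_{t ∈ S} ‖e^{it√-Δ} P_j f‖_p^p)^{1/p}`, as an extended nonnegative real. -/
def waveSum {d : ℕ} (φ : ℝ → ℝ) (p : ℝ) (j : ℕ) (S : Set ℝ)
    (f : EuclideanSpace ℝ (Fin d) → ℂ) : ℝ≥0∞ :=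
  (∑' t : S, eLpNorm (halfWave φ j (t : ℝ) f) (ENNReal.ofReal p) volume ^ p) ^ (1 / p)

/-- The fixed-time exponent `s_p = (d - 1)(1/2 - 1/p)`. -/
def sExp (d : ℕ) (p : ℝ) : ℝ := ((d : ℝ) - 1) * (1 / 2 - 1 / p)

end

end FractalSmoothing

/-! Write d = n + 1, α = p s_p = n(p/2 - 1) and δ = 2^{-j}.

Upper bound. A radial f is integrated only against spherical means of the wave kernel. After
rescaling these are the integrals ∫ χ(ρ) e^{itρ} A(rρ) A(sρ) dρ, where A is the Fourier transform of
the surface measure, and A(R) is R^{-n/2} times a combination of e^{iR} and e^{-iR} with slowly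
varying amplitudes (`exists_symb_decomposition`). Hence the means have size about 2^j (δ + r)^{-n/2}
s^{-n/2} and live within δ of the fronts t = ±r ± s (`exists_sphere_mean_bound`). Jensen's
inequality turns the p-th power into an estimate that is linear in |f|^p, whose only loss is the
weight (δ + |x|)^{-α} caused by focusing at the origin (`exists_near_bound`). Integrating in x puts
|x| near |t ± s|, so that summing over t leaves ∑ (δ + |t - v|)^{-α} with v arbitrary. Splitting |t
- v| dyadically bounds this by about j sup |I|^{-α} N(E ∩ I, δ) (`sum_rpow_le_supCov`), the quantity
measured by ν^♯. Far away inputs are negligible because the kernel decays rapidly beyond the light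
cone (`exists_far_bound`).

Sharpness. Choose I nearly extremal in ν^♯ and a time u at distance comparable to |I| to its right,
and let f = K_{j,-u}, a wave that focuses at the origin at time u. At a time t near I the solution
is K_{j,t-u} with φ² in place of φ. Its L² norm does not depend on time, and half of its energy sits
in a shell of radius u - t ~ |I| and thickness ~ δ, so Hölder's inequality makes its L^p norm large
by the factor |I|^{-α/p} (`exists_le_lintegral_waveKernel_rpow`). Since |u| ≥ 1, f itself has no
such gain (`exists_lintegral_waveKernel_rpow_le`). Summing over t produces |I|^{-α} N(E ∩ I, δ). -/

namespace FractalSmoothing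

noncomputable section

/-! ### Surface measure on the sphere and polar coordinates. -/

/-- Euclidean space of dimension `n + 1`. -/
abbrev EV (n : ℕ) : Type := EuclideanSpace ℝ (Fin (n + 1))

/-- The unit sphere of `ℝ^{n+1}`. -/
abbrev Sph (n : ℕ) : Type := Metric.sphere (0 : EV n) 1

/-- The surface measure on the unit sphere of `ℝ^{n+1}`. -/
abbrev surf (n : ℕ) : Measure (Sph n) :=
  (volume : Measure (EV n)).toSphere

/-- A linear isometry acting on the unit sphere. -/
def sphereMap {n : ℕ} (U : EV n ≃ₗᵢ[ℝ] EV n)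
    (θ : Sph n) :
    Sph n :=
  ⟨U θ, by simp⟩

-- The surface measure of s is a multiple of the volume of the cone over s, and a linear isometry
-- carries cones to cones of the same volume.
open Pointwise in
theorem measurePreserving_sphereMap {n : ℕ}
    (U : EV n ≃ₗᵢ[ℝ] EV n) :
    MeasurePreserving (sphereMap U) (surf n) (surf n) := by
  have hm : Measurable (sphereMap U) :=
    (U.continuous.measurable.comp measurable_subtype_coe).subtype_mk
  refine ⟨hm, Measure.ext fun s hs => ?_⟩
  rw [Measure.map_apply hm hs, Measure.toSphere_apply' _ (hm hs), Measure.toSphere_apply' _ hs]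
  congr 1
  rw [← U.measurePreserving.measure_preimage_equiv (f := U.toMeasurableEquiv)
    (Set.Ioo (0 : ℝ) 1 • (Subtype.val '' s))]
  congr 1
  ext x
  simp only [Set.mem_smul, Set.mem_image, Set.mem_preimage]
  constructor
  · rintro ⟨a, ha, _, ⟨θ, hθ, rfl⟩, rfl⟩
    exact ⟨a, ha, _, ⟨sphereMap U θ, hθ, rfl⟩, by simp [sphereMap]⟩
  · rintro ⟨a, ha, _, ⟨θ, hθ, rfl⟩, h⟩
    refine ⟨a, ha, _, ⟨sphereMap U.symm θ, ?_, rfl⟩, ?_⟩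
    · have : sphereMap U (sphereMap U.symm θ) = θ := by ext; simp [sphereMap]
      rwa [this]
    · apply U.injective
      simpa [sphereMap] using h

theorem integral_sphere_comp_isometry {n : ℕ} {F : Type*} [NormedAddCommGroup F] [NormedSpace ℝ F]
    (U : EV n ≃ₗᵢ[ℝ] EV n)
    {g : EV n → F} (hg : Continuous g) :
    ∫ θ, g (U θ) ∂surf n = ∫ θ, g θ ∂surf n := by
  have h := measurePreserving_sphereMap U
  have h2 := integral_map (μ := surf n) h.measurable.aemeasurable
    (f := fun θ : Sph n => g θ)
    (hg.comp continuous_subtype_val).aestronglyMeasurable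
  rw [h.map_eq] at h2
  exact h2.symm

/-- Integration in polar coordinates. -/
theorem integral_polar {n : ℕ} {F : EV n → ℂ} (hF : Integrable F) :
    ∫ x, F x = ∫ ρ in Set.Ioi (0 : ℝ), (ρ : ℂ) ^ n *
      ∫ θ : Sph n, F (ρ • (θ : EV n)) ∂surf n := by
  set μ : Measure (EV n) := volume
  have hmp := μ.measurePreserving_homeomorphUnitSphereProd
  have hemb := (homeomorphUnitSphereProd (EV n)).measurableEmbedding
  set G : Sph n × Set.Ioi (0 : ℝ) → ℂ :=
    fun z => F (z.2.1 • z.1.1) with hG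
  have hcomp : ∀ x : ({0}ᶜ : Set (EV n)),
      G (homeomorphUnitSphereProd _ x) = F x := by
    intro x
    have h0 : ‖(x : EV n)‖ ≠ 0 := norm_ne_zero_iff.2 x.2
    simp [hG, smul_smul, h0]
  have hintg : Integrable G (μ.toSphere.prod (Measure.volumeIoiPow (Module.finrank ℝ (EV n) - 1))) := by
    rw [← hmp.integrable_comp_emb hemb]
    have : G ∘ (homeomorphUnitSphereProd _) = fun x : ({0}ᶜ : Set (EV n)) => F x :=
      funext hcomp
    rw [this, ← Function.comp_def F, ← integrableOn_iff_comap_subtypeVal (by measurability)]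
    exact hF.integrableOn
  calc ∫ x, F x = ∫ x : ({0}ᶜ : Set (EV n)), F x ∂(μ.comap (↑)) := by
        rw [integral_subtype_comap (measurableSet_singleton _).compl F, restrict_compl_singleton]
    _ = ∫ z, G z ∂(μ.toSphere.prod (Measure.volumeIoiPow (Module.finrank ℝ (EV n) - 1))) := by
        rw [← hmp.integral_comp hemb]
        exact integral_congr_ae (Eventually.of_forall fun x => (hcomp x).symm)
    _ = ∫ ρ, ∫ θ, G (θ, ρ) ∂surf n ∂(Measure.volumeIoiPow (Module.finrank ℝ (EV n) - 1)) := integral_prod_symm _ hintg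
    _ = _ := by
      simp only [Measure.volumeIoiPow, ENNReal.ofReal, finrank_euclideanSpace, Fintype.card_fin,
        Nat.add_sub_cancel]
      rw [integral_withDensity_eq_integral_smul
        ((measurable_subtype_coe.pow_const _).real_toNNReal),
        integral_subtype_comap measurableSet_Ioi fun a : ℝ => Real.toNNReal (a ^ n) •
          ∫ θ : Sph n, F (a • (θ : EV n)) ∂surf n]
      refine setIntegral_congr_fun measurableSet_Ioi fun x hx => ?_
      simp only [NNReal.smul_def, Real.coe_toNNReal _ (pow_nonneg (le_of_lt hx) n), Complex.real_smul]
      push_cast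
      rfl

theorem lintegral_polar {n : ℕ} {F : EV n → ℝ≥0∞} (hF : AEMeasurable F) :
    ∫⁻ x, F x = ∫⁻ ρ in Set.Ioi (0 : ℝ), ENNReal.ofReal (ρ ^ n) *
      ∫⁻ θ : Sph n, F (ρ • (θ : EV n)) ∂surf n := by
  set μ : Measure (EV n) := volume
  have hmp := μ.measurePreserving_homeomorphUnitSphereProd
  have hemb := (homeomorphUnitSphereProd (EV n)).measurableEmbedding
  set G : Sph n × Set.Ioi (0 : ℝ) → ℝ≥0∞ :=
    fun z => F (z.2.1 • z.1.1) with hG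
  have hcomp : ∀ x : ({0}ᶜ : Set (EV n)),
      G (homeomorphUnitSphereProd _ x) = F x := by
    intro x
    have h0 : ‖(x : EV n)‖ ≠ 0 := norm_ne_zero_iff.2 x.2
    simp [hG, smul_smul, h0]
  have hms : MeasurableSet ({0}ᶜ : Set (EV n)) :=
    (measurableSet_singleton _).compl
  have hintg : AEMeasurable G (μ.toSphere.prod (Measure.volumeIoiPow (Module.finrank ℝ (EV n) - 1))) := by
    rw [← hmp.map_eq, hemb.aemeasurable_map_iff]
    have : G ∘ (homeomorphUnitSphereProd _) = fun x : ({0}ᶜ : Set (EV n)) => F x :=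
      funext hcomp
    rw [this, ← Function.comp_def F, ← (MeasurableEmbedding.subtype_coe hms).aemeasurable_map_iff,
      (MeasurableEmbedding.subtype_coe hms).map_comap]
    exact hF.restrict
  calc ∫⁻ x, F x = ∫⁻ x : ({0}ᶜ : Set (EV n)), F x ∂(μ.comap (↑)) := by
        rw [lintegral_subtype_comap hms F, restrict_compl_singleton]
    _ = ∫⁻ z, G z ∂(μ.toSphere.prod (Measure.volumeIoiPow (Module.finrank ℝ (EV n) - 1))) := by
        rw [← hmp.lintegral_comp_emb hemb]
        exact lintegral_congr fun x => (hcomp x).symm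
    _ = ∫⁻ ρ, ∫⁻ θ, G (θ, ρ) ∂surf n ∂(Measure.volumeIoiPow (Module.finrank ℝ (EV n) - 1)) := lintegral_prod_symm _ hintg
    _ = _ := by
      simp only [Measure.volumeIoiPow, finrank_euclideanSpace, Fintype.card_fin,
        Nat.add_sub_cancel]
      rw [lintegral_withDensity_eq_lintegral_mul_non_measurable _
        ((measurable_subtype_coe.pow_const _).ennreal_ofReal) (Eventually.of_forall fun _ => ENNReal.ofReal_lt_top)]
      exact lintegral_subtype_comap measurableSet_Ioi fun a : ℝ => ENNReal.ofReal (a ^ n) *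
          ∫⁻ θ : Sph n, F (a • (θ : EV n)) ∂surf n

/-! ### The Fourier transform of the surface measure and Bessel's equation. -/

theorem integrable_sphere_of_continuous {n : ℕ} {F : Type*} [NormedAddCommGroup F]
    {g : Sph n → F} (hg : Continuous g) : Integrable g (surf n) := by
  have h := hg.continuousOn.integrableOn_compact (μ := surf n) isCompact_univ
  rwa [integrableOn_univ] at h

/-- Writing the derivative of a cosine as a cosine with phase advanced by π/2 keeps this class of
integrals closed under differentiation, so that one formula covers all the derivatives `sphA n k`.
-/
theorem hasDerivAt_integral_cos {n : ℕ} {a b c : Sph n → ℝ} (ha : Continuous a)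
    (hb : Continuous b) (hc : Continuous c) (R : ℝ) :
    HasDerivAt (fun R : ℝ => ∫ θ, c θ * Real.cos (R * a θ + b θ) ∂surf n)
      (∫ θ, c θ * a θ * Real.cos (R * a θ + (b θ + Real.pi / 2)) ∂surf n) R := by
  refine (hasDerivAt_integral_of_dominated_loc_of_deriv_le (s := Set.univ)
    (F := fun (R : ℝ) θ => c θ * Real.cos (R * a θ + b θ))
    (F' := fun (R : ℝ) θ => c θ * a θ * Real.cos (R * a θ + (b θ + Real.pi / 2)))
    (bound := fun θ => |c θ * a θ|) Filter.univ_mem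
    (Eventually.of_forall fun R => (integrable_sphere_of_continuous (by fun_prop)).1)
    (integrable_sphere_of_continuous (by fun_prop))
    (integrable_sphere_of_continuous (by fun_prop)).1
    (Eventually.of_forall fun θ R _ => ?_) (integrable_sphere_of_continuous (by fun_prop))
    (Eventually.of_forall fun θ R _ => ?_)).2
  · rw [norm_mul, Real.norm_eq_abs, Real.norm_eq_abs]
    exact mul_le_of_le_one_right (abs_nonneg _) (Real.abs_cos_le_one _)
  · have h1 : HasDerivAt (fun R : ℝ => R * a θ + b θ) (a θ) R := by
      simpa using ((hasDerivAt_id R).mul_const (a θ)).add_const (b θ)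
    have h2 := (h1.cos).const_mul (c θ)
    refine h2.congr_deriv ?_
    rw [← add_assoc, Real.cos_add_pi_div_two]
    ring

/-- The derivatives of the Fourier transform of the surface measure, as a function of the
radius. -/
def sphA (n k : ℕ) (R : ℝ) : ℝ :=
  ∫ θ : Sph n, (θ.1 0) ^ k * Real.cos (R * θ.1 0 + k * (Real.pi / 2)) ∂surf n

theorem hasDerivAt_sphA (n k : ℕ) (R : ℝ) : HasDerivAt (sphA n k) (sphA n (k + 1) R) R := by
  have h := hasDerivAt_integral_cos (n := n) (a := fun θ => θ.1 0)
    (b := fun _ => k * (Real.pi / 2)) (c := fun θ => (θ.1 0) ^ k)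
    (by fun_prop) (by fun_prop) (by fun_prop) R
  refine h.congr_deriv ?_
  unfold sphA
  congr 1
  ext θ
  push_cast
  ring_nf

theorem continuous_sphA (n k : ℕ) : Continuous (sphA n k) :=
  continuous_iff_continuousAt.2 fun R => (hasDerivAt_sphA n k R).continuousAt

theorem abs_sphere_coord_le {n : ℕ} (θ : Sph n) (i : Fin (n + 1)) : |θ.1 i| ≤ 1 := by
  have h := PiLp.norm_apply_le θ.1 i
  rwa [norm_eq_of_mem_sphere, Real.norm_eq_abs] at h

theorem abs_sphA_le (n k : ℕ) (R : ℝ) : |sphA n k R| ≤ (surf n).real Set.univ := by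
  have h := norm_integral_le_of_norm_le_const (μ := surf n) (C := 1)
    (f := fun θ : Sph n => (θ.1 0) ^ k * Real.cos (R * θ.1 0 + k * (Real.pi / 2)))
    (Eventually.of_forall fun θ => by
      rw [norm_mul, norm_pow, Real.norm_eq_abs, Real.norm_eq_abs]
      exact mul_le_one₀ (pow_le_one₀ (abs_nonneg _) (abs_sphere_coord_le θ 0)) (abs_nonneg _)
        (Real.abs_cos_le_one _))
  simpa [sphA] using h

theorem surf_univ_pos (n : ℕ) : 0 < (surf n).real Set.univ := by
  rw [measureReal_def, ENNReal.toReal_pos_iff]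
  refine ⟨?_, measure_lt_top _ _⟩
  rw [pos_iff_ne_zero, Ne, Measure.measure_univ_eq_zero]
  exact Measure.toSphere_ne_zero _

theorem sphA_zero_zero (n : ℕ) : sphA n 0 0 = (surf n).real Set.univ := by
  simp [sphA]

/-- By rotation invariance ξ may be replaced by ‖ξ‖ times the first basis vector; a reflection
carries one to the other. -/
theorem integral_sphere_cos {n : ℕ} (ξ : EV n) :
    ∫ θ : Sph n, Real.cos (inner ℝ θ.1 ξ) ∂surf n = sphA n 0 ‖ξ‖ := by
  set v : EV n := EuclideanSpace.single 0 ‖ξ‖ with hv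
  have hn : ‖v‖ = ‖ξ‖ := by simp [hv]
  set U := Submodule.reflection (ℝ ∙ (v - ξ))ᗮ
  have hU : U v = ξ := Submodule.reflection_sub hn
  have h := integral_sphere_comp_isometry U (g := fun x => Real.cos (inner ℝ x ξ))
    (by fun_prop)
  rw [← h, sphA]
  congr 1
  ext θ
  have h2 : inner ℝ (U θ.1) ξ = inner ℝ θ.1 v := by rw [← U.inner_map_map θ.1 v, hU]
  rw [h2]
  simp [hv, EuclideanSpace.inner_single_right, mul_comm]

/-- The Fourier transform of the surface measure. -/
theorem integral_sphere_exp {n : ℕ} (ξ : EV n) :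
    ∫ θ : Sph n, Complex.exp (Complex.I * (inner ℝ θ.1 ξ : ℝ)) ∂surf n = (sphA n 0 ‖ξ‖ : ℂ) := by
  -- The antipodal map preserves the measure and changes the sign of the sine.
  have hsin : ∫ θ : Sph n, Real.sin (inner ℝ θ.1 ξ) ∂surf n = 0 := by
    have h := integral_sphere_comp_isometry (LinearIsometryEquiv.neg ℝ)
      (g := fun x : EV n => Real.sin (inner ℝ x ξ)) (by fun_prop)
    simp only [LinearIsometryEquiv.coe_neg, inner_neg_left, Real.sin_neg, integral_neg] at h
    linarith
  have h : ∀ θ : Sph n, Complex.exp (Complex.I * (inner ℝ θ.1 ξ : ℝ)) =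
      ((Real.cos (inner ℝ θ.1 ξ) : ℝ) : ℂ) + ((Real.sin (inner ℝ θ.1 ξ) : ℝ) : ℂ) * Complex.I := by
    intro θ
    rw [mul_comm, Complex.exp_mul_I]
    simp
  simp_rw [h]
  rw [integral_add (integrable_sphere_of_continuous (by fun_prop))
    (integrable_sphere_of_continuous (by fun_prop)), integral_mul_const]
  simp only [integral_complex_ofReal]
  rw [hsin, integral_sphere_cos]
  simp

/-- Perturb the frequency R e₀ to R e₀ + h e_i. The integral is then A(√(R² + h²)), whose second
derivative in h at 0 is A'(R)/R; differentiating under the integral sign instead gives the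
right-hand side. -/
theorem sphA_one_eq {n : ℕ} {i : Fin (n + 1)} (hi : i ≠ 0) {R : ℝ} (hR : 0 < R) :
    sphA n 1 R / R = -∫ θ : Sph n, (θ.1 i) ^ 2 * Real.cos (R * θ.1 0) ∂surf n := by
  set G : ℝ → ℝ := fun h => ∫ θ : Sph n, 1 * Real.cos (h * θ.1 i + R * θ.1 0) ∂surf n with hG
  have hGA : ∀ h, G h = sphA n 0 (Real.sqrt (R ^ 2 + h ^ 2)) := by
    intro h
    have h2 := integral_sphere_cos (EuclideanSpace.single 0 R + EuclideanSpace.single i h : EV n)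
    have h3 : ‖(EuclideanSpace.single 0 R + EuclideanSpace.single i h : EV n)‖ =
        Real.sqrt (R ^ 2 + h ^ 2) := by
      rw [← Real.sqrt_sq (norm_nonneg _), norm_add_sq_real]
      simp [EuclideanSpace.inner_single_left, hi.symm]
    rw [← h3, ← h2]
    simp only [hG]
    congr 1
    ext θ
    simp only [inner_add_right, EuclideanSpace.inner_single_right]
    simp [add_comm]
  have hd : ∀ h, HasDerivAt G (∫ θ : Sph n, 1 * θ.1 i *
      Real.cos (h * θ.1 i + (R * θ.1 0 + Real.pi / 2)) ∂surf n) h := fun h =>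
    hasDerivAt_integral_cos (a := fun θ : Sph n => θ.1 i) (b := fun θ => R * θ.1 0)
      (c := fun _ => 1) (by fun_prop) (by fun_prop) (by fun_prop) h
  have hd2 := hasDerivAt_integral_cos (n := n) (a := fun θ : Sph n => θ.1 i)
    (b := fun θ => R * θ.1 0 + Real.pi / 2)
    (c := fun θ => 1 * θ.1 i) (by fun_prop) (by fun_prop) (by fun_prop) 0
  have hpos : ∀ h : ℝ, 0 < R ^ 2 + h ^ 2 := fun h => by positivity
  have hs : ∀ h : ℝ, HasDerivAt (fun h : ℝ => Real.sqrt (R ^ 2 + h ^ 2))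
      (h / Real.sqrt (R ^ 2 + h ^ 2)) h := by
    intro h
    have h1 : HasDerivAt (fun h : ℝ => R ^ 2 + h ^ 2) (2 * h) h := by
      simpa using (hasDerivAt_pow 2 h).const_add (R ^ 2)
    refine (h1.sqrt (hpos h).ne').congr_deriv ?_
    field_simp
  have he : (fun h : ℝ => ∫ θ : Sph n, 1 * θ.1 i *
      Real.cos (h * θ.1 i + (R * θ.1 0 + Real.pi / 2)) ∂surf n) =
      fun h => sphA n 1 (Real.sqrt (R ^ 2 + h ^ 2)) * (h / Real.sqrt (R ^ 2 + h ^ 2)) := by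
    ext h
    refine (hd h).unique ?_
    have h4 : G = fun h => sphA n 0 (Real.sqrt (R ^ 2 + h ^ 2)) := funext hGA
    rw [h4]
    exact (hasDerivAt_sphA n 0 _).comp h (hs h)
  rw [he] at hd2
  have hsq : Real.sqrt (R ^ 2 + 0 ^ 2) = R := by simp [Real.sqrt_sq hR.le]
  -- At h = 0 the factor h / √(R² + h²) vanishes, so only its own derivative R / R² survives in the
  -- product rule.
  have hd3 := ((hasDerivAt_sphA n 1 (Real.sqrt (R ^ 2 + 0 ^ 2))).comp 0 (hs 0)).mul
    ((hasDerivAt_id (0 : ℝ)).div (hs 0) (by rw [hsq]; exact hR.ne'))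
  have hu := hd3.unique hd2
  simp only [Function.comp, hsq, id, zero_div, mul_zero, zero_mul, one_mul, zero_add, sub_zero] at hu
  rw [← integral_neg]
  have : sphA n 1 R / R = sphA n 1 R * (R / R ^ 2) := by field_simp
  rw [this, hu]
  congr 1
  ext θ
  rw [add_assoc, show Real.pi / 2 + Real.pi / 2 = Real.pi by ring, Real.cos_add_pi]
  ring

/-- Bessel's equation for the Fourier transform of the surface measure. -/
theorem sphA_ode (n : ℕ) {R : ℝ} (hR : 0 < R) :
    sphA n 2 R + n / R * sphA n 1 R + sphA n 0 R = 0 := by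
  have h0 : sphA n 2 R = -∫ θ : Sph n, (θ.1 0) ^ 2 * Real.cos (R * θ.1 0) ∂surf n := by
    rw [← integral_neg, sphA]
    congr 1
    ext θ
    have : R * θ.1 0 + ((2 : ℕ) : ℝ) * (Real.pi / 2) = R * θ.1 0 + Real.pi := by push_cast; ring
    rw [this, Real.cos_add_pi]
    ring
  -- Since ∑ θ_i² = 1 on the sphere, this is the equation -ΔA = A. The n directions other than e₀
  -- each contribute -A'(R)/R.
  have hsum : ∑ i : Fin (n + 1), ∫ θ : Sph n, (θ.1 i) ^ 2 * Real.cos (R * θ.1 0) ∂surf n =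
      sphA n 0 R := by
    rw [← integral_finsetSum _ fun i _ => integrable_sphere_of_continuous (by fun_prop)]
    unfold sphA
    congr 1
    ext θ
    rw [← Finset.sum_mul]
    have h1 : ∑ i, (θ.1 i) ^ 2 = 1 := by
      have := EuclideanSpace.norm_sq_eq θ.1
      rw [norm_eq_of_mem_sphere] at this
      simpa using this.symm
    rw [h1]
    simp
  rw [Fin.sum_univ_succ] at hsum
  have h2 : ∀ i : Fin n, ∫ θ : Sph n, (θ.1 i.succ) ^ 2 * Real.cos (R * θ.1 0) ∂surf n =
      -(sphA n 1 R / R) := fun i => by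
    rw [sphA_one_eq (Fin.succ_ne_zero i) hR, neg_neg]
  rw [Finset.sum_congr rfl fun i _ => h2 i] at hsum
  simp only [Finset.sum_const, Finset.card_univ, Fintype.card_fin, nsmul_eq_mul] at hsum
  rw [h0, ← hsum]
  ring

/-! ### Asymptotics of the Bessel-type function A. -/

/-- `R^{n/2} A(R)`, where `A` is the Fourier transform of the surface measure. -/
def besselW (n : ℕ) (R : ℝ) : ℝ := R ^ ((n : ℝ) / 2) * sphA n 0 R

/-- The derivative of `besselW`. -/
def besselW' (n : ℕ) (R : ℝ) : ℝ :=
  (n : ℝ) / 2 * R ^ ((n : ℝ) / 2 - 1) * sphA n 0 R + R ^ ((n : ℝ) / 2) * sphA n 1 R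

/-- The coefficient of the perturbation in the equation for `besselW`. -/
def besselC (n : ℕ) : ℝ := (n : ℝ) / 2 * ((n : ℝ) / 2 - 1)

theorem hasDerivAt_besselW (n : ℕ) {R : ℝ} (hR : 0 < R) :
    HasDerivAt (besselW n) (besselW' n R) R :=
  (Real.hasDerivAt_rpow_const (Or.inl hR.ne')).mul (hasDerivAt_sphA n 0 R)

/-- The factor R^{n/2} is the one that removes the first-order term of Bessel's equation. What
remains is a harmonic oscillator with a perturbation of size R^{-2}. -/
theorem hasDerivAt_besselW' (n : ℕ) {R : ℝ} (hR : 0 < R) :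
    HasDerivAt (besselW' n) (-besselW n R + besselC n / R ^ 2 * besselW n R) R := by
  have h1 : HasDerivAt (fun R : ℝ => R ^ ((n : ℝ) / 2 - 1)) _ R :=
    Real.hasDerivAt_rpow_const (Or.inl hR.ne')
  have h2 : HasDerivAt (fun R : ℝ => R ^ ((n : ℝ) / 2)) _ R :=
    Real.hasDerivAt_rpow_const (Or.inl hR.ne')
  have h3 := ((h1.const_mul ((n : ℝ) / 2)).mul (hasDerivAt_sphA n 0 R)).add
    (h2.mul (hasDerivAt_sphA n 1 R))
  refine h3.congr_deriv ?_
  have hode := sphA_ode n hR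
  have h4 : sphA n 2 R = -(n / R * sphA n 1 R) - sphA n 0 R := by linarith
  simp only [zero_add, Nat.reduceAdd]
  rw [h4, Real.rpow_sub_one hR.ne', Real.rpow_sub_one hR.ne', besselW, besselC]
  field_simp
  ring

/-- The oscillator energy W² + W'² has derivative 2cWW'/R², at most |c|/R² times the energy, so
multiplying it by exp(|c|/R) makes it nonincreasing. The threshold 1/4 is the least value of rρ for
r ≥ 1 and ρ in [1/4, 4]. -/
theorem exists_besselW_bound (n : ℕ) :
    ∃ M : ℝ, 0 < M ∧ ∀ R : ℝ, 1 / 4 ≤ R → |besselW n R| ≤ M ∧ |besselW' n R| ≤ M := by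
  set c := |besselC n| with hc
  have hc0 : 0 ≤ c := abs_nonneg _
  set H : ℝ → ℝ := fun R => Real.exp (c / R) * (besselW n R ^ 2 + besselW' n R ^ 2) with hH
  have hd : ∀ R : ℝ, 0 < R → HasDerivAt H (Real.exp (c / R) * (-(c / R ^ 2)) *
      (besselW n R ^ 2 + besselW' n R ^ 2) + Real.exp (c / R) *
      (2 * (besselC n / R ^ 2) * (besselW n R * besselW' n R))) R := by
    intro R hR
    have h1 : HasDerivAt (fun R : ℝ => c / R) (-(c / R ^ 2)) R := by
      have := (hasDerivAt_inv hR.ne').const_mul c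
      refine (this.congr_deriv (by ring)).congr_of_eventuallyEq ?_
      exact Eventually.of_forall fun x => div_eq_mul_inv c x
    have h2 := (hasDerivAt_besselW n hR).pow 2
    have h3 := (hasDerivAt_besselW' n hR).pow 2
    refine (h1.exp.mul (h2.add h3)).congr_deriv ?_
    simp only [Pi.add_apply, Pi.pow_apply]
    push_cast
    ring
  have hanti : AntitoneOn H (Set.Ici (1 / 4)) := by
    refine antitoneOn_of_deriv_nonpos (convex_Ici _) ?_ ?_ ?_
    · intro R hR
      exact (hd R (lt_of_lt_of_le (by norm_num) hR)).continuousAt.continuousWithinAt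
    · intro R hR
      rw [interior_Ici] at hR
      exact (hd R (lt_trans (by norm_num) hR)).differentiableAt.differentiableWithinAt
    · intro R hR
      rw [interior_Ici] at hR
      have hR0 : 0 < R := lt_trans (by norm_num) hR
      rw [(hd R hR0).deriv]
      have h1 : besselC n * (2 * (besselW n R * besselW' n R)) ≤
          c * (besselW n R ^ 2 + besselW' n R ^ 2) := by
        refine (le_abs_self _).trans ?_
        rw [abs_mul]
        refine mul_le_mul_of_nonneg_left ?_ hc0
        rw [abs_le]
        constructor <;> nlinarith [sq_nonneg (besselW n R + besselW' n R),
          sq_nonneg (besselW n R - besselW' n R)]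
      have h2 : Real.exp (c / R) * (-(c / R ^ 2)) *
          (besselW n R ^ 2 + besselW' n R ^ 2) + Real.exp (c / R) *
          (2 * (besselC n / R ^ 2) * (besselW n R * besselW' n R)) =
          Real.exp (c / R) / R ^ 2 * (besselC n * (2 * (besselW n R * besselW' n R)) -
          c * (besselW n R ^ 2 + besselW' n R ^ 2)) := by
        field_simp
        ring
      rw [h2]
      exact mul_nonpos_of_nonneg_of_nonpos (by positivity) (by linarith)
  refine ⟨Real.sqrt (H (1 / 4)) + 1, by positivity, fun R hR => ?_⟩
  have hR0 : 0 < R := lt_of_lt_of_le (by norm_num) hR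
  have h1 : H R ≤ H (1 / 4) := hanti Set.self_mem_Ici hR hR
  have h2 : besselW n R ^ 2 + besselW' n R ^ 2 ≤ H R := by
    refine le_mul_of_one_le_left (by positivity) (Real.one_le_exp (by positivity))
  constructor
  · refine (Real.abs_le_sqrt ?_).trans (le_add_of_nonneg_right zero_le_one)
    nlinarith [sq_nonneg (besselW' n R)]
  · refine (Real.abs_le_sqrt ?_).trans (le_add_of_nonneg_right zero_le_one)
    nlinarith [sq_nonneg (besselW n R)]

/-! ### Amplitudes with two bounded derivatives. -/

/-- `a` is twice continuously differentiable on `[1/4, 4]`, with derivatives bounded by `M`. -/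
def Symb (M : ℝ) (a : ℝ → ℂ) : Prop :=
  ∃ a₁ a₂ : ℝ → ℂ, (∀ ρ ∈ Set.Icc (1 / 4 : ℝ) 4, HasDerivAt a (a₁ ρ) ρ ∧ HasDerivAt a₁ (a₂ ρ) ρ ∧
    ‖a ρ‖ ≤ M ∧ ‖a₁ ρ‖ ≤ M ∧ ‖a₂ ρ‖ ≤ M) ∧ ContinuousOn a₂ (Set.Icc (1 / 4) 4)

theorem Symb.nonneg {M : ℝ} {a : ℝ → ℂ} (h : Symb M a) : 0 ≤ M := by
  obtain ⟨a₁, a₂, h, -⟩ := h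
  exact (norm_nonneg _).trans (h 1 (by norm_num)).2.2.1

theorem Symb.mono {M M' : ℝ} {a : ℝ → ℂ} (h : Symb M a) (hM : M ≤ M') : Symb M' a := by
  obtain ⟨a₁, a₂, h, hc⟩ := h
  refine ⟨a₁, a₂, fun ρ hρ => ?_, hc⟩
  obtain ⟨h1, h2, h3, h4, h5⟩ := h ρ hρ
  exact ⟨h1, h2, h3.trans hM, h4.trans hM, h5.trans hM⟩

theorem Symb.const_mul {M : ℝ} {a : ℝ → ℂ} (h : Symb M a) (c : ℂ) :
    Symb (‖c‖ * M) (fun ρ => c * a ρ) := by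
  obtain ⟨a₁, a₂, h, hc⟩ := h
  refine ⟨fun ρ => c * a₁ ρ, fun ρ => c * a₂ ρ, fun ρ hρ => ?_, continuousOn_const.mul hc⟩
  obtain ⟨h1, h2, h3, h4, h5⟩ := h ρ hρ
  refine ⟨h1.const_mul c, h2.const_mul c, ?_, ?_, ?_⟩ <;>
  · rw [norm_mul]
    gcongr

/-- The 4 counts the terms of Leibniz's rule for the second derivative. -/
theorem Symb.mul {M N : ℝ} {a b : ℝ → ℂ} (ha : Symb M a) (hb : Symb N b) :
    Symb (4 * M * N) (fun ρ => a ρ * b ρ) := by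
  have hM := ha.nonneg
  have hN := hb.nonneg
  obtain ⟨a₁, a₂, h, hc⟩ := ha
  obtain ⟨b₁, b₂, g, gc⟩ := hb
  refine ⟨fun ρ => a₁ ρ * b ρ + a ρ * b₁ ρ,
    fun ρ => (a₂ ρ * b ρ + a₁ ρ * b₁ ρ) + (a₁ ρ * b₁ ρ + a ρ * b₂ ρ), fun ρ hρ => ?_, ?_⟩
  · obtain ⟨h1, h2, h3, h4, h5⟩ := h ρ hρ
    obtain ⟨g1, g2, g3, g4, g5⟩ := g ρ hρ
    have key : ∀ x y : ℂ, ‖x‖ ≤ M → ‖y‖ ≤ N → ‖x * y‖ ≤ M * N := fun x y hx hy => by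
      rw [norm_mul]
      gcongr
    have hMN := mul_nonneg hM hN
    refine ⟨h1.mul g1, (h2.mul g1).add (h1.mul g2), ?_, ?_, ?_⟩
    · linarith [key _ _ h3 g3]
    · refine (norm_add_le _ _).trans ?_
      linarith [key _ _ h4 g3, key _ _ h3 g4]
    · refine (norm_add_le _ _).trans ?_
      have e1 := norm_add_le (a₂ ρ * b ρ) (a₁ ρ * b₁ ρ)
      have e2 := norm_add_le (a₁ ρ * b₁ ρ) (a ρ * b₂ ρ)
      linarith [key _ _ h5 g3, key _ _ h4 g4, key _ _ h3 g5]
  · have ca : ContinuousOn a (Set.Icc (1 / 4) 4) := fun ρ hρ =>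
      (h ρ hρ).1.continuousAt.continuousWithinAt
    have ca₁ : ContinuousOn a₁ (Set.Icc (1 / 4) 4) := fun ρ hρ =>
      (h ρ hρ).2.1.continuousAt.continuousWithinAt
    have cb : ContinuousOn b (Set.Icc (1 / 4) 4) := fun ρ hρ =>
      (g ρ hρ).1.continuousAt.continuousWithinAt
    have cb₁ : ContinuousOn b₁ (Set.Icc (1 / 4) 4) := fun ρ hρ =>
      (g ρ hρ).2.1.continuousAt.continuousWithinAt
    exact ((hc.mul cb).add (ca₁.mul cb₁)).add ((ca₁.mul cb₁).add (ca.mul gc))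

theorem Symb.zero : Symb 0 (fun _ => 0) :=
  ⟨fun _ => 0, fun _ => 0, fun ρ _ => ⟨hasDerivAt_const _ _, hasDerivAt_const _ _, by simp⟩,
    continuousOn_const⟩

theorem exists_symb_of_contDiffOn {g : ℝ → ℂ} (hg : ContDiffOn ℝ 2 g (Set.Ioi 0)) :
    ∃ M, Symb M g := by
  have ho : IsOpen (Set.Ioi (0 : ℝ)) := isOpen_Ioi
  have hg1 : DifferentiableOn ℝ g (Set.Ioi 0) := hg.differentiableOn (by norm_num)
  have hg2 : ContDiffOn ℝ 1 (deriv g) (Set.Ioi 0) := hg.deriv_of_isOpen ho (by norm_num)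
  have hg3 : ContinuousOn (deriv (deriv g)) (Set.Ioi 0) :=
    hg2.continuousOn_deriv_of_isOpen ho le_rfl
  have hsub : Set.Icc (1 / 4 : ℝ) 4 ⊆ Set.Ioi 0 := fun x hx =>
    lt_of_lt_of_le (by norm_num) hx.1
  obtain ⟨M0, h0⟩ := isCompact_Icc.exists_bound_of_continuousOn (hg.continuousOn.mono hsub)
  obtain ⟨M1, h1⟩ := isCompact_Icc.exists_bound_of_continuousOn (hg2.continuousOn.mono hsub)
  obtain ⟨M2, h2⟩ := isCompact_Icc.exists_bound_of_continuousOn (hg3.mono hsub)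
  refine ⟨max M0 (max M1 M2), deriv g, deriv (deriv g), fun ρ hρ => ⟨?_, ?_, ?_, ?_, ?_⟩,
    hg3.mono hsub⟩
  · exact ((hg1 ρ (hsub hρ)).differentiableAt (ho.mem_nhds (hsub hρ))).hasDerivAt
  · exact (((hg2.differentiableOn (by norm_num)) ρ (hsub hρ)).differentiableAt
      (ho.mem_nhds (hsub hρ))).hasDerivAt
  · exact (h0 ρ hρ).trans (by simp)
  · exact (h1 ρ hρ).trans (by simp)
  · exact (h2 ρ hρ).trans (by simp)

/-- The amplitude of `e^{i s R}` in `besselW`, `s = ± 1`. -/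
def besselB (n : ℕ) (s : ℝ) (R : ℝ) : ℂ :=
  ((besselW' n R : ℂ) + s * Complex.I * besselW n R) * Complex.exp (-(s * Complex.I * R))

theorem hasDerivAt_exp_phase (c : ℂ) (R : ℝ) :
    HasDerivAt (fun R : ℝ => Complex.exp (-(c * R))) (-(c * Complex.exp (-(c * R)))) R := by
  have h1 : HasDerivAt (fun R : ℝ => -(c * (R : ℂ))) (-(c * 1)) R :=
    ((Complex.ofRealCLM.hasDerivAt (x := R)).const_mul c).neg
  refine h1.cexp.congr_deriv ?_
  ring

/-- The factor W' + isW solves the unperturbed oscillator up to the R^{-2} term and rotates like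
e^{isR}. Undoing the rotation leaves only the perturbation, which is why the amplitude varies
slowly. -/
theorem hasDerivAt_besselB (n : ℕ) {s : ℝ} (hs : s ^ 2 = 1) {R : ℝ} (hR : 0 < R) :
    HasDerivAt (besselB n s) (((besselC n / R ^ 2 * besselW n R : ℝ) : ℂ) *
      Complex.exp (-(s * Complex.I * R))) R := by
  have h1 := (hasDerivAt_besselW n hR).ofReal_comp
  have h2 := (hasDerivAt_besselW' n hR).ofReal_comp
  have h3 := hasDerivAt_exp_phase (s * Complex.I) R
  refine ((h2.add (h1.const_mul (s * Complex.I : ℂ))).mul h3).congr_deriv ?_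
  have hs' : (s : ℂ) ^ 2 = 1 := by exact_mod_cast hs
  simp only [Pi.add_apply]
  push_cast
  linear_combination (-(besselW n R : ℂ) * Complex.exp (-(s * Complex.I * R)) * s ^ 2) *
    Complex.I_sq + (besselW n R : ℂ) * Complex.exp (-(s * Complex.I * R)) * hs'

theorem hasDerivAt_besselB' (n : ℕ) (s : ℝ) {R : ℝ} (hR : 0 < R) :
    HasDerivAt (fun R : ℝ => ((besselC n / R ^ 2 * besselW n R : ℝ) : ℂ) *
      Complex.exp (-(s * Complex.I * R)))
      (((besselC n * (-(2 / R ^ 3) * besselW n R + besselW' n R / R ^ 2) : ℝ) -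
        s * Complex.I * (besselC n / R ^ 2 * besselW n R : ℝ)) *
        Complex.exp (-(s * Complex.I * R))) R := by
  have h0 : HasDerivAt (fun R : ℝ => besselC n / R ^ 2) (besselC n * (-(2 / R ^ 3))) R := by
    have := ((hasDerivAt_pow 2 R).inv (pow_ne_zero 2 hR.ne')).const_mul (besselC n)
    refine this.congr_deriv ?_
    field_simp
    norm_num
    ring
  have h1 := (h0.mul (hasDerivAt_besselW n hR)).ofReal_comp
  have h3 := hasDerivAt_exp_phase (s * Complex.I) R
  refine (h1.mul h3).congr_deriv ?_
  simp only [Pi.mul_apply]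
  push_cast
  ring

theorem norm_exp_phase (s R : ℝ) : ‖Complex.exp (-(s * Complex.I * R))‖ = 1 := by
  have : -((s : ℂ) * Complex.I * R) = ((-(s * R) : ℝ) : ℂ) * Complex.I := by push_cast; ring
  rw [this, Complex.norm_exp_ofReal_mul_I]

/-- Each derivative in ρ costs a factor r, but both derivatives of `besselB` are O((rρ)^{-2}), so
two derivatives are affordable uniformly in r ≥ 1 on [1/4, 4]. -/
theorem exists_symb_besselB (n : ℕ) :
    ∃ M : ℝ, ∀ s : ℝ, s ^ 2 = 1 → ∀ r : ℝ, 1 ≤ r → Symb M (fun ρ => besselB n s (r * ρ)) := by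
  obtain ⟨M, hM0, hM⟩ := exists_besselW_bound n
  set c := |besselC n|
  have hc : 0 ≤ c := abs_nonneg _
  refine ⟨2 * M + 4 * (c * (4 * M)) + 16 * (c * (10 * M)), fun s hs r hr => ?_⟩
  have hs1 : |s| = 1 := by
    rw [← sq_eq_sq₀ (abs_nonneg _) zero_le_one]
    simpa using hs
  refine ⟨fun ρ => r * (((besselC n / (r * ρ) ^ 2 * besselW n (r * ρ) : ℝ) : ℂ) *
      Complex.exp (-(s * Complex.I * (r * ρ : ℝ)))),
    fun ρ => r * (r * (((besselC n * (-(2 / (r * ρ) ^ 3) * besselW n (r * ρ) +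
      besselW' n (r * ρ) / (r * ρ) ^ 2) : ℝ) -
        s * Complex.I * (besselC n / (r * ρ) ^ 2 * besselW n (r * ρ) : ℝ)) *
        Complex.exp (-(s * Complex.I * (r * ρ : ℝ))))), fun ρ hρ => ?_, ?_⟩
  · have hρ0 : 0 < ρ := lt_of_lt_of_le (by norm_num) hρ.1
    have hR : 1 / 4 ≤ r * ρ := by nlinarith [hρ.1]
    have hR0 : 0 < r * ρ := lt_of_lt_of_le (by norm_num) hR
    have hr0 : 0 < r := by linarith
    have hl : HasDerivAt (fun ρ : ℝ => r * ρ) r ρ := by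
      simpa using (hasDerivAt_id ρ).const_mul r
    obtain ⟨hw, hw'⟩ := hM _ hR
    have e1 : r / (r * ρ) ≤ 4 := by
      rw [div_le_iff₀ hR0]; nlinarith [hρ.1]
    have e1' : 0 ≤ r / (r * ρ) := by positivity
    have e2 : 1 / (r * ρ) ≤ 4 := by
      rw [div_le_iff₀ hR0]; linarith
    have e2' : 0 ≤ 1 / (r * ρ) := by positivity
    refine ⟨?_, ?_, ?_, ?_, ?_⟩
    · refine ((hasDerivAt_besselB n hs hR0).scomp ρ hl).congr_deriv ?_
      simp
    · refine (((hasDerivAt_besselB' n s hR0).scomp ρ hl).const_mul (r : ℂ)).congr_deriv ?_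
      simp
    · have h1 : ‖besselB n s (r * ρ)‖ ≤ 2 * M := by
        rw [besselB, norm_mul, norm_exp_phase, mul_one]
        refine (norm_add_le _ _).trans ?_
        simp only [norm_mul, Complex.norm_real, Complex.norm_I, Real.norm_eq_abs, hs1]
        linarith
      have : 0 ≤ 4 * (c * (4 * M)) + 16 * (c * (10 * M)) := by positivity
      linarith
    · rw [norm_mul, norm_mul, norm_exp_phase, mul_one, Complex.norm_real, Complex.norm_real,
        Real.norm_eq_abs, Real.norm_eq_abs, abs_of_pos hr0]
      have h1 : r * |besselC n / (r * ρ) ^ 2 * besselW n (r * ρ)| =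
          r / (r * ρ) * (c * (1 / (r * ρ) * |besselW n (r * ρ)|)) := by
        rw [abs_mul, abs_div, abs_of_pos (pow_pos hR0 2)]
        simp only [c]
        field_simp
      rw [h1]
      calc _ ≤ 4 * (c * (4 * M)) := by gcongr
        _ ≤ _ := by
          have : 0 ≤ 2 * M + 16 * (c * (10 * M)) := by positivity
          linarith
    · rw [norm_mul, norm_mul, norm_mul, norm_exp_phase, mul_one, Complex.norm_real,
        Real.norm_eq_abs, abs_of_pos hr0]
      have h1 : ‖(((besselC n * (-(2 / (r * ρ) ^ 3) * besselW n (r * ρ) +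
          besselW' n (r * ρ) / (r * ρ) ^ 2) : ℝ) : ℂ) -
          s * Complex.I * (besselC n / (r * ρ) ^ 2 * besselW n (r * ρ) : ℝ))‖ ≤
          (1 / (r * ρ)) ^ 2 * (c * (10 * M)) := by
        refine (norm_sub_le _ _).trans ?_
        simp only [norm_mul, Complex.norm_real, Complex.norm_I, Real.norm_eq_abs, hs1, mul_one,
          one_mul]
        have g1 : |-(2 / (r * ρ) ^ 3) * besselW n (r * ρ) +
            besselW' n (r * ρ) / (r * ρ) ^ 2| ≤ (1 / (r * ρ)) ^ 2 * (9 * M) := by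
          have : -(2 / (r * ρ) ^ 3) * besselW n (r * ρ) + besselW' n (r * ρ) / (r * ρ) ^ 2 =
            (1 / (r * ρ)) ^ 2 * (besselW' n (r * ρ) - 2 * (1 / (r * ρ)) * besselW n (r * ρ)) := by
            field_simp
            ring
          rw [this, abs_mul, abs_of_nonneg (sq_nonneg (1 / (r * ρ)))]
          refine mul_le_mul_of_nonneg_left ?_ (sq_nonneg _)
          refine (abs_sub _ _).trans ?_
          rw [abs_mul, abs_mul, abs_two, abs_of_nonneg e2']
          have : 2 * (1 / (r * ρ)) * |besselW n (r * ρ)| ≤ 2 * 4 * M := by gcongr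
          linarith
        have g2 : |besselC n / (r * ρ) ^ 2| * |besselW n (r * ρ)| ≤
            c * ((1 / (r * ρ)) ^ 2 * M) := by
          have : |besselC n / (r * ρ) ^ 2| = c * (1 / (r * ρ)) ^ 2 := by
            rw [abs_div, abs_of_pos (pow_pos hR0 2)]
            simp only [c]
            field_simp
          rw [this, mul_assoc]
          gcongr
        calc _ ≤ c * ((1 / (r * ρ)) ^ 2 * (9 * M)) + c * ((1 / (r * ρ)) ^ 2 * M) := by
              gcongr
          _ = _ := by ring
      calc _ ≤ r * (r * ((1 / (r * ρ)) ^ 2 * (c * (10 * M)))) := by gcongr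
        _ = (r / (r * ρ)) ^ 2 * (c * (10 * M)) := by field_simp
        _ ≤ 4 ^ 2 * (c * (10 * M)) := by gcongr
        _ ≤ _ := by
          have : 0 ≤ 2 * M + 4 * (c * (4 * M)) := by positivity
          linarith
  · intro ρ hρ
    have hρ0 : 0 < ρ := lt_of_lt_of_le (by norm_num) hρ.1
    have hR0 : 0 < r * ρ := by positivity
    have hl : ContinuousAt (fun ρ : ℝ => r * ρ) ρ := by fun_prop
    have c1 : ContinuousAt (fun ρ : ℝ => besselW n (r * ρ)) ρ :=
      ContinuousAt.comp (g := besselW n) (hasDerivAt_besselW n hR0).continuousAt hl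
    have c2 : ContinuousAt (fun ρ : ℝ => besselW' n (r * ρ)) ρ :=
      ContinuousAt.comp (g := besselW' n) (hasDerivAt_besselW' n hR0).continuousAt hl
    have hne := hR0.ne'
    apply ContinuousAt.continuousWithinAt
    have c3 : ContinuousAt (fun ρ : ℝ => 2 / (r * ρ) ^ 3) ρ :=
      continuousAt_const.div (by fun_prop) (by positivity)
    have c4 : ContinuousAt (fun ρ : ℝ => besselW' n (r * ρ) / (r * ρ) ^ 2) ρ :=
      c2.div (by fun_prop) (by positivity)
    have c5 : ContinuousAt (fun ρ : ℝ => besselC n / (r * ρ) ^ 2) ρ :=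
      continuousAt_const.div (by fun_prop) (by positivity)
    have c6 : ContinuousAt (fun ρ : ℝ => ((besselC n * (-(2 / (r * ρ) ^ 3) * besselW n (r * ρ) +
      besselW' n (r * ρ) / (r * ρ) ^ 2) : ℝ) : ℂ)) ρ :=
      Complex.continuous_ofReal.continuousAt.comp
        (continuousAt_const.mul ((c3.neg.mul c1).add c4))
    have c7 : ContinuousAt (fun ρ : ℝ => ((besselC n / (r * ρ) ^ 2 * besselW n (r * ρ) : ℝ) : ℂ)) ρ :=
      Complex.continuous_ofReal.continuousAt.comp (c5.mul c1)
    have c8 : ContinuousAt (fun ρ : ℝ => Complex.exp (-(s * Complex.I * (r * ρ : ℝ)))) ρ := by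
      fun_prop
    exact continuousAt_const.mul (continuousAt_const.mul
      ((c6.sub (continuousAt_const.mul c7)).mul c8))

/-- Decomposition of the Fourier transform of the surface measure into two oscillating factors with
slowly varying amplitudes. -/
theorem exists_symb_decomposition (n : ℕ) :
    ∃ M : ℝ, 0 < M ∧ ∀ r : ℝ, 0 ≤ r → ∃ a b : ℝ → ℂ,
      Symb (M * (1 + r) ^ (-((n : ℝ) / 2))) a ∧ Symb (M * (1 + r) ^ (-((n : ℝ) / 2))) b ∧
      ∀ ρ ∈ Set.Icc (1 / 4 : ℝ) 4, (sphA n 0 (r * ρ) : ℂ) =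
        Complex.exp (Complex.I * (r * ρ : ℝ)) * a ρ +
        Complex.exp (Complex.I * (-r * ρ : ℝ)) * b ρ := by
  obtain ⟨M1, hM1⟩ := exists_symb_besselB n
  obtain ⟨M2, hM2⟩ := exists_symb_of_contDiffOn (g := fun ρ : ℝ => ((ρ ^ (-((n : ℝ) / 2)) : ℝ) : ℂ))
    (by
      apply Complex.ofRealCLM.contDiff.comp_contDiffOn
      intro x hx
      exact (Real.contDiffAt_rpow_const_of_ne (ne_of_gt hx)).contDiffWithinAt)
  set m : ℝ := (n : ℝ) / 2 with hm
  have hm0 : 0 ≤ m := by positivity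
  have hN1 : 0 ≤ M1 := (hM1 1 (by norm_num) 1 le_rfl).nonneg
  have hN2 := hM2.nonneg
  set S := (surf n).real Set.univ with hS
  have hS0 : 0 < S := surf_univ_pos n
  -- The first two summands serve r ≤ 1 and r ≥ 1 respectively. The factor 2^m pays for replacing 1,
  -- or r^{-m}, by (1 + r)^{-m}.
  set K := 4 * S * 1 * 2 ^ m + 1 / 2 * (4 * M2 * M1) * 2 ^ m + 1 with hK
  have hK0 : 0 < K := by positivity
  refine ⟨K, hK0, fun r hr => ?_⟩
  -- For r ≤ 1 nothing oscillates: take a = A(rρ) e^{-irρ} and b = 0. For r ≥ 1 use 2iW = (W' + iW)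
  -- - (W' - iW), the two terms being e^{iR} and e^{-iR} times the amplitudes `besselB`.
  rcases le_total r 1 with h1 | h1
  · have hbd : 4 * S * 1 ≤ K * (1 + r) ^ (-m) := by
      have : (2 : ℝ) ^ (-m) ≤ (1 + r) ^ (-m) :=
        Real.rpow_le_rpow_of_nonpos (by linarith) (by linarith) (by linarith)
      have h2 : (4 * S * 1) = (4 * S * 1 * 2 ^ m) * 2 ^ (-m) := by
        rw [mul_assoc _ ((2 : ℝ) ^ m), ← Real.rpow_add two_pos, add_neg_cancel, Real.rpow_zero,
          mul_one, mul_one]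
      rw [h2]
      refine mul_le_mul ?_ this (by positivity) hK0.le
      have : 0 ≤ 1 / 2 * (4 * M2 * M1) * 2 ^ m + 1 := by positivity
      linarith
    have s1 : Symb S (fun ρ => (sphA n 0 (r * ρ) : ℂ)) := by
      refine ⟨fun ρ => r * (sphA n 1 (r * ρ) : ℂ), fun ρ => r * (r * (sphA n 2 (r * ρ) : ℂ)),
        fun ρ hρ => ?_, ?_⟩
      · have hl : HasDerivAt (fun ρ : ℝ => r * ρ) r ρ := by
          simpa using (hasDerivAt_id ρ).const_mul r
        have key : ∀ x : ℝ, |x| ≤ S → |r * x| ≤ S := fun x hx => by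
          rw [abs_mul, abs_of_nonneg hr]
          nlinarith [abs_nonneg x]
        refine ⟨?_, ?_, ?_, ?_, ?_⟩
        · refine (((hasDerivAt_sphA n 0 (r * ρ)).comp ρ hl).ofReal_comp).congr_deriv ?_
          push_cast; ring
        · refine ((((hasDerivAt_sphA n 1 (r * ρ)).comp ρ hl).ofReal_comp).const_mul
            (r : ℂ)).congr_deriv ?_
          push_cast; ring
        · rw [Complex.norm_real]; exact abs_sphA_le n 0 _
        · beta_reduce
          rw [← Complex.ofReal_mul, Complex.norm_real]
          exact key _ (abs_sphA_le n 1 _)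
        · beta_reduce
          rw [← Complex.ofReal_mul, ← Complex.ofReal_mul, Complex.norm_real]
          exact key _ (key _ (abs_sphA_le n 2 _))
      · have := continuous_sphA n 2
        fun_prop
    have s2 : Symb 1 (fun ρ => Complex.exp (-((r : ℂ) * Complex.I * ρ))) := by
      refine ⟨fun ρ => -(((r : ℂ) * Complex.I) * Complex.exp (-((r : ℂ) * Complex.I * ρ))),
        fun ρ => -(((r : ℂ) * Complex.I) * -(((r : ℂ) * Complex.I) *
          Complex.exp (-((r : ℂ) * Complex.I * ρ)))), fun ρ hρ => ⟨?_, ?_, ?_, ?_, ?_⟩, ?_⟩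
      · exact hasDerivAt_exp_phase _ ρ
      · exact ((hasDerivAt_exp_phase _ ρ).const_mul _).neg
      · rw [norm_exp_phase]
      · rw [norm_neg, norm_mul, norm_exp_phase, norm_mul, Complex.norm_I, Complex.norm_real,
          Real.norm_eq_abs, abs_of_nonneg hr]
        linarith
      · simp only [norm_neg, norm_mul, norm_exp_phase, Complex.norm_I, Complex.norm_real,
          Real.norm_eq_abs, abs_of_nonneg hr]
        nlinarith
      · fun_prop
    refine ⟨_, fun _ => 0, (s1.mul s2).mono hbd, Symb.zero.mono (by positivity), fun ρ _ => ?_⟩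
    rw [mul_zero, add_zero, mul_left_comm, ← Complex.exp_add]
    have : Complex.I * (r * ρ : ℝ) + -((r : ℂ) * Complex.I * ρ) = 0 := by push_cast; ring
    rw [this, Complex.exp_zero, mul_one]
  · have hr0 : 0 < r := by linarith
    have hbd : ∀ c : ℂ, ‖c‖ = 1 / 2 →
        ‖c * ((r ^ (-m) : ℝ) : ℂ)‖ * (4 * M2 * M1) ≤ K * (1 + r) ^ (-m) := by
      intro c hc
      rw [norm_mul, hc, Complex.norm_real, Real.norm_eq_abs, abs_of_pos (by positivity)]
      have h3 : r ^ (-m) ≤ 2 ^ m * (1 + r) ^ (-m) := by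
        have : (2 * r) ^ (-m) ≤ (1 + r) ^ (-m) :=
          Real.rpow_le_rpow_of_nonpos (by linarith) (by linarith) (by linarith)
        calc r ^ (-m) = 2 ^ m * (2 * r) ^ (-m) := by
              rw [Real.mul_rpow two_pos.le hr, ← mul_assoc, ← Real.rpow_add two_pos,
                add_neg_cancel, Real.rpow_zero, one_mul]
          _ ≤ _ := by gcongr
      calc 1 / 2 * r ^ (-m) * (4 * M2 * M1) ≤
          1 / 2 * (2 ^ m * (1 + r) ^ (-m)) * (4 * M2 * M1) := by gcongr
        _ = (1 / 2 * (4 * M2 * M1) * 2 ^ m) * (1 + r) ^ (-m) := by ring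
        _ ≤ _ := by
          refine mul_le_mul_of_nonneg_right ?_ (by positivity)
          have : 0 ≤ 4 * S * 1 * 2 ^ m + 1 := by positivity
          linarith
    have sp : ∀ s : ℝ, s ^ 2 = 1 → ∀ c : ℂ, ‖c‖ = 1 / 2 → Symb (K * (1 + r) ^ (-m))
        (fun ρ => c * ((r ^ (-m) : ℝ) : ℂ) *
          (((ρ ^ (-m) : ℝ) : ℂ) * besselB n s (r * ρ))) := fun s hs c hc =>
      ((hM2.mul (hM1 s hs r h1)).const_mul _).mono (hbd c hc)
    refine ⟨_, _, sp 1 (by norm_num) (1 / (2 * Complex.I)) (by simp),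
      sp (-1) (by norm_num) (-(1 / (2 * Complex.I))) (by simp), fun ρ hρ => ?_⟩
    have hρ0 : 0 < ρ := lt_of_lt_of_le (by norm_num) hρ.1
    have hA : (sphA n 0 (r * ρ) : ℂ) = ((r ^ (-m) : ℝ) : ℂ) * ((ρ ^ (-m) : ℝ) : ℂ) *
        (besselW n (r * ρ) : ℂ) := by
      have : sphA n 0 (r * ρ) = r ^ (-m) * ρ ^ (-m) * besselW n (r * ρ) := by
        rw [besselW, ← Real.mul_rpow hr hρ0.le, ← mul_assoc, ← Real.rpow_add (by positivity),
          neg_add_cancel, Real.rpow_zero, one_mul]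
      rw [this]
      push_cast
      ring
    rw [hA, besselB, besselB]
    have e1 : Complex.exp (Complex.I * (r * ρ : ℝ)) *
        Complex.exp (-(((1 : ℝ) : ℂ) * Complex.I * (r * ρ : ℝ))) = 1 := by
      rw [← Complex.exp_add, ← Complex.exp_zero]
      congr 1
      push_cast
      ring
    have e2 : Complex.exp (Complex.I * (-r * ρ : ℝ)) *
        Complex.exp (-(((-1 : ℝ) : ℂ) * Complex.I * (r * ρ : ℝ))) = 1 := by
      rw [← Complex.exp_add, ← Complex.exp_zero]
      congr 1
      push_cast
      ring
    have e3 : 1 / (2 * Complex.I) * (2 * Complex.I) = 1 := by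
      have := Complex.I_ne_zero
      field_simp
    set X := ((r ^ (-m) : ℝ) : ℂ) * ((ρ ^ (-m) : ℝ) : ℂ)
    set P := (besselW n (r * ρ) : ℂ)
    set Q := (besselW' n (r * ρ) : ℂ)
    push_cast at e1 e2 ⊢
    linear_combination (-(1 / (2 * Complex.I)) * X * (Q + Complex.I * P)) * e1 +
      (1 / (2 * Complex.I)) * X * (Q - Complex.I * P) * e2 - X * P * e3

/-! ### Oscillatory integrals and the radial kernel. -/

/-- Smooth functions with support inside `(1/4, 4)`. -/
structure IsTest (χ : ℝ → ℂ) : Prop where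
  smooth : ContDiff ℝ ∞ χ
  support : tsupport χ ⊆ Set.Ioo (1 / 4) 4

theorem IsTest.eq_zero {χ : ℝ → ℂ} (h : IsTest χ) {x : ℝ} (hx : x ∉ Set.Ioo (1 / 4 : ℝ) 4) :
    χ x = 0 :=
  image_eq_zero_of_notMem_tsupport fun hmem => hx (h.support hmem)

theorem IsTest.hasDerivAt {χ : ℝ → ℂ} (h : IsTest χ) (x : ℝ) : HasDerivAt χ (deriv χ x) x :=
  ((h.smooth.differentiable (by simp)) x).hasDerivAt

theorem IsTest.deriv {χ : ℝ → ℂ} (h : IsTest χ) : IsTest (deriv χ) :=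
  ⟨(contDiff_infty_iff_deriv.1 h.smooth).2,
    (closure_minimal support_deriv_subset (isClosed_tsupport χ)).trans h.support⟩

/-- The support stays away from 0, so the other factor may be singular there; this admits
multipliers such as ρ⁻¹. -/
theorem IsTest.mul_contDiffOn {χ g : ℝ → ℂ} (h : IsTest χ) (hg : ContDiffOn ℝ ∞ g (Set.Ioi 0)) :
    IsTest (fun ρ => χ ρ * g ρ) := by
  have hs : tsupport (fun ρ => χ ρ * g ρ) ⊆ tsupport χ := tsupport_mul_subset_left
  refine ⟨contDiff_iff_contDiffAt.2 fun x => ?_, hs.trans h.support⟩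
  by_cases hx : x ∈ tsupport (fun ρ => χ ρ * g ρ)
  swap
  · exact contDiffAt_const.congr_of_eventuallyEq (notMem_tsupport_iff_eventuallyEq.1 hx)
  have hx0 : x ∈ Set.Ioi (0 : ℝ) := lt_trans (by norm_num) (h.support (hs hx)).1
  exact h.smooth.contDiffAt.mul (hg.contDiffAt (isOpen_Ioi.mem_nhds hx0))

theorem IsTest.const_mul {χ : ℝ → ℂ} (h : IsTest χ) (c : ℂ) : IsTest (fun ρ => c * χ ρ) := by
  have := h.mul_contDiffOn (g := fun _ => c) contDiffOn_const
  simpa [mul_comm] using this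

theorem IsTest.sub {χ ψ : ℝ → ℂ} (h : IsTest χ) (h' : IsTest ψ) :
    IsTest (fun ρ => χ ρ - ψ ρ) :=
  ⟨h.smooth.sub h'.smooth, (tsupport_sub χ ψ).trans (Set.union_subset h.support h'.support)⟩

theorem hasDerivAt_exp_I (t ρ : ℝ) :
    HasDerivAt (fun ρ : ℝ => Complex.exp (Complex.I * (t * ρ : ℝ)))
      (Complex.I * t * Complex.exp (Complex.I * (t * ρ : ℝ))) ρ := by
  have h := hasDerivAt_exp_phase (-(Complex.I * t)) ρ
  have e : ∀ ρ : ℝ, -(-(Complex.I * t) * (ρ : ℂ)) = Complex.I * (t * ρ : ℝ) := fun ρ => by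
    push_cast; ring
  simp only [e] at h
  exact h.congr_deriv (by ring)

/-- Oscillatory integral with two integrations by parts. -/
theorem exists_osc_bound {χ : ℝ → ℂ} (hχ : IsTest χ) :
    ∃ C : ℝ, 0 < C ∧ ∀ (M : ℝ) (a : ℝ → ℂ), Symb M a → ∀ t : ℝ,
      ‖∫ ρ in (1 / 4 : ℝ)..4, χ ρ * a ρ * Complex.exp (Complex.I * (t * ρ : ℝ))‖ ≤
        C * M / (1 + |t|) ^ 2 := by
  obtain ⟨M0, hM0⟩ := exists_symb_of_contDiffOn (g := χ)
    (ContDiff.contDiffOn (by exact_mod_cast contDiff_infty.1 hχ.smooth 2))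
  have hM00 := hM0.nonneg
  refine ⟨64 * M0 + 1, by positivity, fun M a ha t => ?_⟩
  have hM := ha.nonneg
  obtain ⟨F₁, F₂, hF, hFc⟩ := hM0.mul ha
  obtain ⟨a₁, a₂, hha, -⟩ := ha
  set F : ℝ → ℂ := fun ρ => χ ρ * a ρ with hFdef
  set e : ℝ → ℂ := fun ρ => Complex.exp (Complex.I * (t * ρ : ℝ)) with he
  have hen : ∀ ρ, ‖e ρ‖ = 1 := fun ρ => Complex.norm_exp_I_mul_ofReal _
  have hIcc : Set.uIcc (1 / 4 : ℝ) 4 = Set.Icc (1 / 4) 4 := Set.uIcc_of_le (by norm_num)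
  have hce : Continuous e := by fun_prop
  -- `F₁` comes from an existential, so its endpoint values are found by uniqueness of derivatives:
  -- both χ and χ' vanish there. This removes the boundary terms of the second integration by parts.
  have hF₁z : ∀ x, x ∈ Set.Icc (1 / 4 : ℝ) 4 → x ∉ Set.Ioo (1 / 4 : ℝ) 4 → F₁ x = 0 := by
    intro x hx hx'
    have h1 := (hF x hx).1
    have h2 := (hχ.hasDerivAt x).mul (hha x hx).1
    have h3 := h1.unique h2
    rw [h3, hχ.deriv.eq_zero hx', hχ.eq_zero hx']
    simp
  have cF₁ : ContinuousOn F₁ (Set.Icc (1 / 4) 4) := fun ρ hρ =>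
    (hF ρ hρ).2.1.continuousAt.continuousWithinAt
  have m1 : (1 / 4 : ℝ) ∈ Set.Icc (1 / 4 : ℝ) 4 := by norm_num
  have m2 : (4 : ℝ) ∈ Set.Icc (1 / 4 : ℝ) 4 := by norm_num
  have ibp : ∀ f f' : ℝ → ℂ, (∀ ρ ∈ Set.Icc (1 / 4 : ℝ) 4, HasDerivAt f (f' ρ) ρ) →
      ContinuousOn f' (Set.Icc (1 / 4) 4) → f (1 / 4) = 0 → f 4 = 0 →
      Complex.I * t * ∫ ρ in (1 / 4 : ℝ)..4, f ρ * e ρ = -∫ ρ in (1 / 4 : ℝ)..4, f' ρ * e ρ := by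
    intro f f' hf hc h0 h4
    have := intervalIntegral.integral_mul_deriv_eq_deriv_mul (u := f) (v := e) (u' := f')
      (v' := fun ρ => Complex.I * t * e ρ) (a := 1 / 4) (b := 4)
      (fun ρ hρ => hf ρ (hIcc ▸ hρ)) (fun ρ _ => hasDerivAt_exp_I t ρ)
      (ContinuousOn.intervalIntegrable (hIcc ▸ hc))
      (Continuous.intervalIntegrable (by fun_prop) _ _)
    rw [h0, h4, zero_mul, zero_mul, sub_zero, zero_sub] at this
    rw [← this, ← intervalIntegral.integral_const_mul]
    congr 1
    ext ρ
    ring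
  have i1 := ibp F F₁ (fun ρ hρ => (hF ρ hρ).1) cF₁
    (by simp only [hFdef]; rw [hχ.eq_zero (x := 1 / 4) (by norm_num), zero_mul])
    (by simp [hFdef, hχ.eq_zero (x := 4) (by norm_num)])
  have i2 := ibp F₁ F₂ (fun ρ hρ => (hF ρ hρ).2.1) hFc (hF₁z _ m1 (by norm_num))
    (hF₁z _ m2 (by norm_num))
  have nb : ∀ f : ℝ → ℂ, (∀ ρ ∈ Set.Icc (1 / 4 : ℝ) 4, ‖f ρ‖ ≤ 4 * M0 * M) →
      ‖∫ ρ in (1 / 4 : ℝ)..4, f ρ * e ρ‖ ≤ 16 * M0 * M := by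
    intro f hf
    have := intervalIntegral.norm_integral_le_of_norm_le_const (a := 1 / 4) (b := 4)
      (f := fun ρ => f ρ * e ρ) (C := 4 * M0 * M) (fun ρ hρ => by
        rw [norm_mul, hen, mul_one]
        rw [Set.uIoc_of_le (by norm_num)] at hρ
        exact hf ρ ⟨hρ.1.le, hρ.2⟩)
    refine this.trans ?_
    rw [abs_of_nonneg (by norm_num)]
    nlinarith [mul_nonneg hM00 hM]
  set J := ∫ ρ in (1 / 4 : ℝ)..4, F ρ * e ρ
  have b0 : ‖J‖ ≤ 16 * M0 * M := nb F fun ρ hρ => (hF ρ hρ).2.2.1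
  have b2 : t ^ 2 * ‖J‖ ≤ 16 * M0 * M := by
    have h1 : (Complex.I * t) * ((Complex.I * t) * J) = ∫ ρ in (1 / 4 : ℝ)..4, F₂ ρ * e ρ := by
      rw [i1, mul_neg, i2, neg_neg]
    have h2 : ‖(Complex.I * t) * ((Complex.I * t) * J)‖ = t ^ 2 * ‖J‖ := by
      simp only [norm_mul, Complex.norm_I, Complex.norm_real, Real.norm_eq_abs, one_mul]
      rw [← mul_assoc, ← sq, sq_abs]
    rw [← h2, h1]
    exact nb F₂ fun ρ hρ => (hF ρ hρ).2.2.2.2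
  rw [le_div_iff₀ (by positivity)]
  have h3 : (1 + |t|) ^ 2 ≤ 2 * (1 + t ^ 2) := by
    rw [← sq_abs t]
    nlinarith [sq_nonneg (1 - |t|)]
  calc ‖J‖ * (1 + |t|) ^ 2 ≤ ‖J‖ * (2 * (1 + t ^ 2)) := by gcongr
    _ = 2 * ‖J‖ + 2 * (t ^ 2 * ‖J‖) := by ring
    _ ≤ 64 * M0 * M := by linarith
    _ ≤ _ := by nlinarith

/-- `∑ (1 + |t ± r ± s|)^{-2}`, over all choices of signs. -/
def frontSum (t r s : ℝ) : ℝ :=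
  1 / (1 + |t + r + s|) ^ 2 + 1 / (1 + |t + r - s|) ^ 2 + 1 / (1 + |t - r + s|) ^ 2 +
    1 / (1 + |t - r - s|) ^ 2

/-- The kernel of the half-wave operator on radial functions, at unit frequency. -/
def radKernel (n : ℕ) (χ : ℝ → ℂ) (t r s : ℝ) : ℂ :=
  ∫ ρ in (1 / 4 : ℝ)..4, χ ρ * Complex.exp (Complex.I * (t * ρ : ℝ)) *
    (sphA n 0 (r * ρ) * sphA n 0 (s * ρ))

theorem Symb.continuousOn {M : ℝ} {a : ℝ → ℂ} (h : Symb M a) :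
    ContinuousOn a (Set.Icc (1 / 4) 4) := by
  obtain ⟨a₁, a₂, h, -⟩ := h
  exact fun ρ hρ => (h ρ hρ).1.continuousAt.continuousWithinAt

/-- Splitting each factor A into its two waves gives four phases (t ± r ± s)ρ with amplitudes of
size (1 + r)^{-n/2} (1 + s)^{-n/2}. Each is handled by `exists_osc_bound`. -/
theorem exists_radKernel_bound (n : ℕ) {χ : ℝ → ℂ} (hχ : IsTest χ) :
    ∃ C : ℝ, 0 < C ∧ ∀ t r s : ℝ, 0 ≤ r → 0 ≤ s → ‖radKernel n χ t r s‖ ≤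
      C * (1 + r) ^ (-((n : ℝ) / 2)) * (1 + s) ^ (-((n : ℝ) / 2)) * frontSum t r s := by
  obtain ⟨M, hM0, hM⟩ := exists_symb_decomposition n
  obtain ⟨C, hC0, hC⟩ := exists_osc_bound hχ
  refine ⟨C * (4 * M * M), by positivity, fun t r s hr hs => ?_⟩
  obtain ⟨a, b, ha, hb, hab⟩ := hM r hr
  obtain ⟨c, e, hc, he, hce⟩ := hM s hs
  set X := (1 + r) ^ (-((n : ℝ) / 2))
  set Y := (1 + s) ^ (-((n : ℝ) / 2))
  have hIcc : Set.uIcc (1 / 4 : ℝ) 4 = Set.Icc (1 / 4) 4 := Set.uIcc_of_le (by norm_num)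
  have hii : ∀ {f : ℝ → ℂ} {K : ℝ}, Symb K f → ∀ t' : ℝ, IntervalIntegrable
      (fun ρ => χ ρ * f ρ * Complex.exp (Complex.I * (t' * ρ : ℝ))) volume (1 / 4) 4 := by
    intro f K hf t'
    apply ContinuousOn.intervalIntegrable
    rw [hIcc]
    exact (hχ.smooth.continuous.continuousOn.mul hf.continuousOn).mul
      (Continuous.continuousOn (by fun_prop))
  have h1 := ha.mul hc
  have h2 := ha.mul he
  have h3 := hb.mul hc
  have h4 := hb.mul he
  have hsplit : radKernel n χ t r s =
      (∫ ρ in (1 / 4 : ℝ)..4, χ ρ * (a ρ * c ρ) * Complex.exp (Complex.I * ((t + r + s) * ρ : ℝ))) +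
      (∫ ρ in (1 / 4 : ℝ)..4, χ ρ * (a ρ * e ρ) * Complex.exp (Complex.I * ((t + r - s) * ρ : ℝ))) +
      (∫ ρ in (1 / 4 : ℝ)..4, χ ρ * (b ρ * c ρ) * Complex.exp (Complex.I * ((t - r + s) * ρ : ℝ))) +
      (∫ ρ in (1 / 4 : ℝ)..4, χ ρ * (b ρ * e ρ) * Complex.exp (Complex.I * ((t - r - s) * ρ : ℝ))) := by
    rw [← intervalIntegral.integral_add (hii h1 _) (hii h2 _),
      ← intervalIntegral.integral_add ((hii h1 _).add (hii h2 _)) (hii h3 _),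
      ← intervalIntegral.integral_add (((hii h1 _).add (hii h2 _)).add (hii h3 _)) (hii h4 _)]
    refine intervalIntegral.integral_congr fun ρ hρ => ?_
    rw [hIcc] at hρ
    rw [hab ρ hρ, hce ρ hρ]
    have e1 : Complex.exp (Complex.I * ((t + r + s) * ρ : ℝ)) = Complex.exp (Complex.I * (t * ρ : ℝ)) *
        Complex.exp (Complex.I * (r * ρ : ℝ)) * Complex.exp (Complex.I * (s * ρ : ℝ)) := by
      rw [← Complex.exp_add, ← Complex.exp_add]; congr 1; push_cast; ring
    have e2 : Complex.exp (Complex.I * ((t + r - s) * ρ : ℝ)) = Complex.exp (Complex.I * (t * ρ : ℝ)) *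
        Complex.exp (Complex.I * (r * ρ : ℝ)) * Complex.exp (Complex.I * (-s * ρ : ℝ)) := by
      rw [← Complex.exp_add, ← Complex.exp_add]; congr 1; push_cast; ring
    have e3 : Complex.exp (Complex.I * ((t - r + s) * ρ : ℝ)) = Complex.exp (Complex.I * (t * ρ : ℝ)) *
        Complex.exp (Complex.I * (-r * ρ : ℝ)) * Complex.exp (Complex.I * (s * ρ : ℝ)) := by
      rw [← Complex.exp_add, ← Complex.exp_add]; congr 1; push_cast; ring
    have e4 : Complex.exp (Complex.I * ((t - r - s) * ρ : ℝ)) = Complex.exp (Complex.I * (t * ρ : ℝ)) *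
        Complex.exp (Complex.I * (-r * ρ : ℝ)) * Complex.exp (Complex.I * (-s * ρ : ℝ)) := by
      rw [← Complex.exp_add, ← Complex.exp_add]; congr 1; push_cast; ring
    rw [e1, e2, e3, e4]
    ring
  rw [hsplit]
  refine (norm_add_le _ _).trans ((add_le_add ((norm_add_le _ _).trans (add_le_add (norm_add_le _ _)
    le_rfl)) le_rfl).trans ?_)
  refine (add_le_add (add_le_add (add_le_add (hC _ _ h1 _) (hC _ _ h2 _)) (hC _ _ h3 _))
    (hC _ _ h4 _)).trans (le_of_eq ?_)
  rw [frontSum]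
  ring

/-! ### Pointwise decay of the unit-frequency wave kernel. -/

/-- `∫ χ(ρ) e^{itρ} A^{(k)}(rρ) dρ`. -/
def ptKernel (n k : ℕ) (χ : ℝ → ℂ) (t r : ℝ) : ℂ :=
  ∫ ρ in (1 / 4 : ℝ)..4, χ ρ * Complex.exp (Complex.I * (t * ρ : ℝ)) * sphA n k (r * ρ)

/-- This is the radial kernel at s = 0, where A(0) is the total mass of the sphere. The four fronts
coincide in pairs, hence the 2. -/
theorem exists_ptKernel_bound (n : ℕ) {χ : ℝ → ℂ} (hχ : IsTest χ) :
    ∃ C : ℝ, 0 < C ∧ ∀ t r : ℝ, 0 ≤ r → ‖ptKernel n 0 χ t r‖ ≤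
      C * (1 + r) ^ (-((n : ℝ) / 2)) * (1 / (1 + |t + r|) ^ 2 + 1 / (1 + |t - r|) ^ 2) := by
  obtain ⟨C, hC0, hC⟩ := exists_radKernel_bound n hχ
  have hS := surf_univ_pos n
  refine ⟨2 * C / (surf n).real Set.univ, by positivity, fun t r hr => ?_⟩
  have h := hC t r 0 hr le_rfl
  have he : radKernel n χ t r 0 = ptKernel n 0 χ t r * ((surf n).real Set.univ : ℂ) := by
    rw [radKernel, ptKernel, ← intervalIntegral.integral_mul_const]
    congr 1
    ext ρ
    rw [zero_mul, sphA_zero_zero]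
    ring
  rw [he, norm_mul, Complex.norm_real, Real.norm_eq_abs, abs_of_pos hS] at h
  rw [div_mul_eq_mul_div, div_mul_eq_mul_div, le_div_iff₀ hS]
  refine h.trans (le_of_eq ?_)
  simp only [frontSum, add_zero, sub_zero, Real.one_rpow]
  ring

theorem intervalIntegrable_pt (n k : ℕ) {χ : ℝ → ℂ} (hχ : IsTest χ) (t r : ℝ) :
    IntervalIntegrable (fun ρ : ℝ => χ ρ * Complex.exp (Complex.I * (t * ρ : ℝ)) *
      sphA n k (r * ρ)) volume (1 / 4) 4 := by
  have := hχ.smooth.continuous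
  have := continuous_sphA n k
  exact Continuous.intervalIntegrable (by fun_prop) _ _

theorem norm_ptKernel_le (n k : ℕ) {χ : ℝ → ℂ} (hχ : IsTest χ) :
    ∃ C : ℝ, 0 < C ∧ ∀ t r : ℝ, ‖ptKernel n k χ t r‖ ≤ C := by
  obtain ⟨M, hM⟩ := isCompact_Icc.exists_bound_of_continuousOn (s := Set.Icc (1 / 4 : ℝ) 4)
    hχ.smooth.continuous.continuousOn
  have hS := surf_univ_pos n
  have hM0 : 0 ≤ M := (norm_nonneg _).trans (hM 1 (by norm_num))
  refine ⟨M * (surf n).real Set.univ * |4 - 1 / 4| + 1, by positivity, fun t r => ?_⟩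
  refine le_trans ?_ (le_add_of_nonneg_right zero_le_one)
  refine intervalIntegral.norm_integral_le_of_norm_le_const fun ρ hρ => ?_
  rw [Set.uIoc_of_le (by norm_num)] at hρ
  rw [norm_mul, norm_mul, Complex.norm_exp_I_mul_ofReal, mul_one, Complex.norm_real]
  have := hM ρ ⟨hρ.1.le, hρ.2⟩
  have := abs_sphA_le n k (r * ρ)
  rw [Real.norm_eq_abs]
  gcongr

theorem hasDerivAt_sphA_scale (n k : ℕ) (r ρ : ℝ) :
    HasDerivAt (fun ρ : ℝ => (sphA n k (r * ρ) : ℂ)) (r * (sphA n (k + 1) (r * ρ) : ℂ)) ρ := by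
  have hl : HasDerivAt (fun ρ : ℝ => r * ρ) r ρ := by
    simpa using (hasDerivAt_id ρ).const_mul r
  refine (((hasDerivAt_sphA n k (r * ρ)).comp ρ hl).ofReal_comp).congr_deriv ?_
  push_cast; ring

/-- Integrate the derivative of χ(ρ) e^{itρ} A^{(k)}(rρ), which vanishes at both endpoints. A factor
t is traded for a derivative of χ or a factor r, so iterating gives decay in t/(1 + r). -/
theorem mul_ptKernel_eq (n k : ℕ) {χ : ℝ → ℂ} (hχ : IsTest χ) (t r : ℝ) :
    Complex.I * t * ptKernel n k χ t r =
      -ptKernel n k (deriv χ) t r - r * ptKernel n (k + 1) χ t r := by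
  set D : ℝ → ℂ := fun ρ => χ ρ * Complex.exp (Complex.I * (t * ρ : ℝ)) * sphA n k (r * ρ) with hD
  have hd : ∀ ρ, HasDerivAt D (deriv χ ρ * Complex.exp (Complex.I * (t * ρ : ℝ)) * sphA n k (r * ρ)
      + Complex.I * t * (χ ρ * Complex.exp (Complex.I * (t * ρ : ℝ)) * sphA n k (r * ρ))
      + r * (χ ρ * Complex.exp (Complex.I * (t * ρ : ℝ)) * sphA n (k + 1) (r * ρ))) ρ := by
    intro ρ
    refine (((hχ.hasDerivAt ρ).mul (hasDerivAt_exp_I t ρ)).mul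
      (hasDerivAt_sphA_scale n k r ρ)).congr_deriv ?_
    simp only [Pi.mul_apply]
    ring
  have j1 := intervalIntegrable_pt n k hχ.deriv t r
  have j2 := (intervalIntegrable_pt n k hχ t r).const_mul (Complex.I * t)
  have j3 := (intervalIntegrable_pt n (k + 1) hχ t r).const_mul (r : ℂ)
  have h := intervalIntegral.integral_eq_sub_of_hasDerivAt (f := D) (a := 1 / 4) (b := 4)
    (fun ρ _ => hd ρ) ((j1.add j2).add j3)
  rw [intervalIntegral.integral_add (j1.add j2) j3, intervalIntegral.integral_add j1 j2,
    intervalIntegral.integral_const_mul, intervalIntegral.integral_const_mul] at h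
  have z1 : D 4 = 0 := by simp [hD, hχ.eq_zero (x := 4) (by norm_num)]
  have z2 : D (1 / 4) = 0 := by
    simp only [hD]
    rw [hχ.eq_zero (x := 1 / 4) (by norm_num)]
    simp
  rw [z1, z2, sub_zero] at h
  simp only [ptKernel]
  linear_combination h

/-- Decay of the kernel when the time is much larger than the radius. -/
theorem exists_ptKernel_time_decay (n N : ℕ) : ∀ (k : ℕ) {χ : ℝ → ℂ}, IsTest χ →
    ∃ C : ℝ, 0 < C ∧ ∀ t r : ℝ, 0 ≤ r → |t| ^ N * ‖ptKernel n k χ t r‖ ≤ C * (1 + r) ^ N := by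
  induction N with
  | zero =>
    intro k χ hχ
    obtain ⟨C, hC0, hC⟩ := norm_ptKernel_le n k hχ
    exact ⟨C, hC0, fun t r _ => by simpa using hC t r⟩
  | succ N ih =>
    intro k χ hχ
    obtain ⟨C1, h10, h1⟩ := ih k hχ.deriv
    obtain ⟨C2, h20, h2⟩ := ih (k + 1) hχ
    refine ⟨C1 + C2, by positivity, fun t r hr => ?_⟩
    have e := congrArg norm (mul_ptKernel_eq n k hχ t r)
    rw [norm_mul, norm_mul, Complex.norm_I, one_mul, Complex.norm_real, Real.norm_eq_abs] at e
    rw [pow_succ, mul_assoc, e]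
    have e2 : ‖-ptKernel n k (deriv χ) t r - r * ptKernel n (k + 1) χ t r‖ ≤
        ‖ptKernel n k (deriv χ) t r‖ + r * ‖ptKernel n (k + 1) χ t r‖ := by
      refine (norm_sub_le _ _).trans ?_
      rw [norm_neg, norm_mul, Complex.norm_real, Real.norm_eq_abs, abs_of_nonneg hr]
    have hp : 0 ≤ (1 + r) ^ N := by positivity
    calc _ ≤ |t| ^ N * (‖ptKernel n k (deriv χ) t r‖ + r * ‖ptKernel n (k + 1) χ t r‖) := by gcongr
      _ = |t| ^ N * ‖ptKernel n k (deriv χ) t r‖ +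
          r * (|t| ^ N * ‖ptKernel n (k + 1) χ t r‖) := by ring
      _ ≤ C1 * (1 + r) ^ N + r * (C2 * (1 + r) ^ N) := by
        have := mul_le_mul_of_nonneg_left (h2 t r hr) hr
        exact add_le_add (h1 t r hr) this
      _ ≤ (C1 + C2) * (1 + r) ^ (N + 1) := by
        rw [pow_succ]
        nlinarith [mul_nonneg h10.le hp, mul_nonneg h20.le hp, mul_nonneg hr (mul_nonneg h10.le hp)]

theorem IsTest.div_id {χ : ℝ → ℂ} (h : IsTest χ) : IsTest (fun ρ => χ ρ * (ρ : ℂ)⁻¹) := by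
  apply h.mul_contDiffOn
  intro x hx
  have : ((x : ℝ) : ℂ) ≠ 0 := by exact_mod_cast (ne_of_gt hx)
  exact (Complex.ofRealCLM.contDiff.contDiffAt.inv this).contDiffWithinAt

/-- Bessel's equation expresses r² A(rρ) through ρ-derivatives of A(rρ), and integration by parts
moves these onto χ e^{itρ}, where they cost at most t². Thus r² is traded for (1 + |t|)². -/
theorem sq_mul_ptKernel_eq (n : ℕ) {χ : ℝ → ℂ} (hχ : IsTest χ) (t : ℝ) {r : ℝ} (hr : 0 ≤ r) :
    (r : ℂ) ^ 2 * ptKernel n 0 χ t r =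
      -ptKernel n 0 (fun ρ => deriv (deriv χ) ρ - n * deriv (fun ρ : ℝ => χ ρ * (ρ : ℂ)⁻¹) ρ) t r
      - Complex.I * t * ptKernel n 0 (fun ρ => 2 * deriv χ ρ - n * (χ ρ * (ρ : ℂ)⁻¹)) t r
      + t ^ 2 * ptKernel n 0 χ t r := by
  set e : ℝ → ℂ := fun ρ => Complex.exp (Complex.I * (t * ρ : ℝ)) with he
  set ψ : ℝ → ℂ := fun ρ : ℝ => χ ρ * (ρ : ℂ)⁻¹ with hψ
  have hψt : IsTest ψ := hχ.div_id
  -- `D` collects the boundary terms of both integrations by parts; χ(ρ)/ρ stems from the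
  -- first-order term of Bessel's equation.
  set D : ℝ → ℂ := fun ρ => χ ρ * e ρ * (r * sphA n 1 (r * ρ)) -
    (deriv χ ρ * e ρ + χ ρ * (Complex.I * t * e ρ)) * sphA n 0 (r * ρ) +
    n * (ψ ρ * e ρ * sphA n 0 (r * ρ)) with hD
  have t0 : IsTest (fun ρ => deriv (deriv χ) ρ - n * deriv ψ ρ) :=
    hχ.deriv.deriv.sub (hψt.deriv.const_mul n)
  have t1 : IsTest (fun ρ => 2 * deriv χ ρ - n * ψ ρ) :=
    (hχ.deriv.const_mul 2).sub (hψt.const_mul n)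
  have hd : ∀ ρ ∈ Set.Icc (1 / 4 : ℝ) 4, HasDerivAt D
      (-((r : ℂ) ^ 2 * (χ ρ * e ρ * sphA n 0 (r * ρ)))
      - ((deriv (deriv χ) ρ - n * deriv ψ ρ) * e ρ * sphA n 0 (r * ρ))
      - Complex.I * t * ((2 * deriv χ ρ - n * ψ ρ) * e ρ * sphA n 0 (r * ρ))
      + t ^ 2 * (χ ρ * e ρ * sphA n 0 (r * ρ))) ρ := by
    intro ρ hρ
    have hρ0 : 0 < ρ := lt_of_lt_of_le (by norm_num) hρ.1
    have he' := hasDerivAt_exp_I t ρ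
    have hG := (hχ.hasDerivAt ρ).mul he'
    have hG1 := ((hχ.deriv.hasDerivAt ρ).mul he').add
      ((hχ.hasDerivAt ρ).mul (he'.const_mul (Complex.I * t)))
    have hP := (hψt.hasDerivAt ρ).mul he'
    have hY := hasDerivAt_sphA_scale n 0 r ρ
    have hY1 := (hasDerivAt_sphA_scale n 1 r ρ).const_mul (r : ℂ)
    refine (((hG.mul hY1).sub (hG1.mul hY)).add ((hP.mul hY).const_mul (n : ℂ))).congr_deriv ?_
    -- Multiplied by r², the equation also holds at r = 0, where `sphA_ode` does not apply.
    have hode : (r : ℂ) ^ 2 * sphA n 2 (r * ρ) + n * ((ρ : ℂ)⁻¹ * (r * sphA n 1 (r * ρ))) =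
        -((r : ℂ) ^ 2 * sphA n 0 (r * ρ)) := by
      rcases hr.eq_or_lt with h | h
      · simp [← h]
      · have h1 := sphA_ode n (mul_pos h hρ0)
        have h2 : r ^ 2 * sphA n 2 (r * ρ) + n * (ρ⁻¹ * (r * sphA n 1 (r * ρ))) =
            -(r ^ 2 * sphA n 0 (r * ρ)) := by
          have h3 : sphA n 2 (r * ρ) = -(n / (r * ρ) * sphA n 1 (r * ρ)) - sphA n 0 (r * ρ) := by
            linarith
          rw [h3]
          field_simp
          ring
        exact_mod_cast h2
    have hψρ : ψ ρ = χ ρ * (ρ : ℂ)⁻¹ := rfl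
    simp only [Pi.mul_apply, Pi.add_apply, zero_add, Nat.reduceAdd]
    linear_combination (χ ρ * e ρ) * hode + (n : ℂ) * e ρ * (r * sphA n 1 (r * ρ)) * hψρ
      - χ ρ * e ρ * sphA n 0 (r * ρ) * t ^ 2 * Complex.I_sq
  have j1 := (intervalIntegrable_pt n 0 hχ t r).const_mul ((r : ℂ) ^ 2)
  have j2 := intervalIntegrable_pt n 0 t0 t r
  have j3 := (intervalIntegrable_pt n 0 t1 t r).const_mul (Complex.I * t)
  have j4 := (intervalIntegrable_pt n 0 hχ t r).const_mul ((t : ℂ) ^ 2)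
  have hIcc : Set.uIcc (1 / 4 : ℝ) 4 = Set.Icc (1 / 4) 4 := Set.uIcc_of_le (by norm_num)
  have h := intervalIntegral.integral_eq_sub_of_hasDerivAt (f := D) (a := 1 / 4) (b := 4)
    (fun ρ hρ => hd ρ (hIcc ▸ hρ)) (((j1.neg.sub j2).sub j3).add j4)
  erw [intervalIntegral.integral_add ((j1.neg.sub j2).sub j3) j4,
    intervalIntegral.integral_sub (j1.neg.sub j2) j3, intervalIntegral.integral_sub j1.neg j2,
    intervalIntegral.integral_neg,
    intervalIntegral.integral_const_mul, intervalIntegral.integral_const_mul,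
    intervalIntegral.integral_const_mul] at h
  have z : ∀ x : ℝ, x ∉ Set.Ioo (1 / 4 : ℝ) 4 → D x = 0 := by
    intro x hx
    simp only [hD]
    rw [hχ.eq_zero hx, hχ.deriv.eq_zero hx, hψt.eq_zero hx]
    simp
  rw [z 4 (by norm_num), z (1 / 4) (by norm_num), sub_zero] at h
  simp only [ptKernel]
  linear_combination -h

/-- Decay of the kernel when the radius is much larger than the time. -/
theorem exists_ptKernel_radius_decay (n N : ℕ) : ∀ {χ : ℝ → ℂ}, IsTest χ →
    ∃ C : ℝ, 0 < C ∧ ∀ t r : ℝ, 0 ≤ r →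
      r ^ (2 * N) * ‖ptKernel n 0 χ t r‖ ≤ C * (1 + |t|) ^ (2 * N) := by
  induction N with
  | zero =>
    intro χ hχ
    obtain ⟨C, hC0, hC⟩ := norm_ptKernel_le n 0 hχ
    exact ⟨C, hC0, fun t r _ => by simpa using hC t r⟩
  | succ N ih =>
    intro χ hχ
    obtain ⟨C0, h00, h0⟩ := ih (hχ.deriv.deriv.sub (hχ.div_id.deriv.const_mul n))
    obtain ⟨C1, h10, h1⟩ := ih ((hχ.deriv.const_mul 2).sub (hχ.div_id.const_mul n))
    obtain ⟨C2, h20, h2⟩ := ih hχ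
    refine ⟨C0 + C1 + C2, by positivity, fun t r hr => ?_⟩
    have e := congrArg norm (sq_mul_ptKernel_eq n hχ t hr)
    rw [norm_mul, norm_pow, Complex.norm_real, Real.norm_eq_abs, abs_of_nonneg hr] at e
    rw [mul_add, pow_add, mul_one, mul_assoc, e]
    set k0 := ptKernel n 0 (fun ρ => deriv (deriv χ) ρ - n * deriv (fun ρ : ℝ => χ ρ * (ρ : ℂ)⁻¹) ρ) t r
    set k1 := ptKernel n 0 (fun ρ => 2 * deriv χ ρ - n * (χ ρ * (ρ : ℂ)⁻¹)) t r
    set k2 := ptKernel n 0 χ t r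
    have e2 : ‖-k0 - Complex.I * t * k1 + t ^ 2 * k2‖ ≤ ‖k0‖ + |t| * ‖k1‖ + |t| ^ 2 * ‖k2‖ := by
      refine (norm_add_le _ _).trans (add_le_add ((norm_sub_le _ _).trans ?_) ?_)
      · simp
      · simp
    set T := 1 + |t| with hT
    have hT1 : 1 ≤ T := by simp [hT]
    have htT : |t| ≤ T := by simp [hT]
    calc _ ≤ r ^ (2 * N) * (‖k0‖ + |t| * ‖k1‖ + |t| ^ 2 * ‖k2‖) := by gcongr
      _ = r ^ (2 * N) * ‖k0‖ + |t| * (r ^ (2 * N) * ‖k1‖) + |t| ^ 2 * (r ^ (2 * N) * ‖k2‖) := by ring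
      _ ≤ C0 * T ^ (2 * N) + T * (C1 * T ^ (2 * N)) + T ^ 2 * (C2 * T ^ (2 * N)) := by
        have hT0 : 0 ≤ T := by linarith
        refine add_le_add (add_le_add (h0 t r hr) ?_) ?_
        · exact mul_le_mul htT (h1 t r hr) (by positivity) hT0
        · exact mul_le_mul (pow_le_pow_left₀ (abs_nonneg _) htT 2) (h2 t r hr) (by positivity)
            (by positivity)
      _ ≤ T ^ 2 * (C0 * T ^ (2 * N)) + T ^ 2 * (C1 * T ^ (2 * N)) + T ^ 2 * (C2 * T ^ (2 * N)) := by
        have h3 : T ≤ T ^ 2 := by nlinarith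
        have h4 : (1 : ℝ) ≤ T ^ 2 := by nlinarith
        refine add_le_add (add_le_add (le_mul_of_one_le_left (by positivity) h4) ?_) le_rfl
        exact mul_le_mul_of_nonneg_right h3 (by positivity)
      _ = _ := by ring

/-! ### The wave kernel and its spherical means as one-dimensional integrals. -/

theorem integral_radial_mul_exp {n : ℕ} {g : ℝ → ℂ}
    (hg : Integrable (fun ξ : EV n => g ‖ξ‖)) (x : EV n) :
    ∫ ξ : EV n, g ‖ξ‖ * Complex.exp (Complex.I * (inner ℝ x ξ : ℝ)) =
      ∫ ρ in Set.Ioi (0 : ℝ), (ρ : ℂ) ^ n * (g ρ * sphA n 0 (‖x‖ * ρ)) := by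
  have hintg : Integrable (fun ξ : EV n => g ‖ξ‖ * Complex.exp (Complex.I * (inner ℝ x ξ : ℝ))) := by
    refine hg.mul_bdd (c := 1) (Continuous.aestronglyMeasurable (by fun_prop)) ?_
    exact Eventually.of_forall fun ξ => (Complex.norm_exp_I_mul_ofReal _).le
  rw [integral_polar hintg]
  refine setIntegral_congr_fun measurableSet_Ioi fun ρ hρ => ?_
  have hρ : 0 < ρ := hρ
  have hn : ∀ θ : Sph n, ‖ρ • (θ : EV n)‖ = ρ := fun θ => by
    rw [norm_smul, norm_eq_of_mem_sphere, Real.norm_eq_abs, abs_of_pos hρ, mul_one]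
  have hi : ∀ θ : Sph n, inner ℝ x (ρ • (θ : EV n)) = inner ℝ (θ : EV n) (ρ • x) := fun θ => by
    rw [real_inner_smul_right, real_inner_smul_right, real_inner_comm]
  simp only [hn, hi]
  rw [integral_const_mul, integral_sphere_exp, norm_smul, Real.norm_eq_abs, abs_of_pos hρ,
    mul_comm ρ]

theorem IsBump.isTest {φ : ℝ → ℝ} (hφ : IsBump φ) (n : ℕ) :
    IsTest (fun ρ => (φ ρ : ℂ) * (ρ : ℂ) ^ n) := by
  have h : IsTest (fun ρ => (φ ρ : ℂ)) := by
    refine ⟨Complex.ofRealCLM.contDiff.comp hφ.smooth, ?_⟩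
    refine (closure_mono ?_).trans hφ.support
    intro x hx hx'
    exact hx (by simp [hx'])
  exact h.mul_contDiffOn (Complex.ofRealCLM.contDiff.pow n).contDiffOn

theorem IsBump.eq_zero {φ : ℝ → ℝ} (hφ : IsBump φ) {x : ℝ} (hx : x ∉ Set.Ioo (1 / 4 : ℝ) 4) :
    φ x = 0 :=
  image_eq_zero_of_notMem_tsupport fun hmem => hx (hφ.support hmem)

/-- Rescaling of a radial frequency integral to unit frequency. -/
theorem integral_Ioi_rescale {φ : ℝ → ℝ} (hφ : IsBump φ) (n j : ℕ) (H : ℝ → ℂ) :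
    ∫ ρ in Set.Ioi (0 : ℝ), (ρ : ℂ) ^ n * ((φ (((2 : ℝ) ^ j)⁻¹ * ρ) : ℂ) * H ρ) =
      (((2 : ℝ) ^ j) ^ (n + 1) : ℝ) *
        ∫ ρ in (1 / 4 : ℝ)..4, (φ ρ : ℂ) * (ρ : ℂ) ^ n * H (2 ^ j * ρ) := by
  have h2 : (0 : ℝ) < 2 ^ j := by positivity
  have h := integral_comp_mul_left_Ioi
    (fun ρ : ℝ => (ρ : ℂ) ^ n * ((φ (((2 : ℝ) ^ j)⁻¹ * ρ) : ℂ) * H ρ)) 0 h2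
  rw [mul_zero] at h
  have h3 : ∫ ρ in Set.Ioi (0 : ℝ), (ρ : ℂ) ^ n * ((φ (((2 : ℝ) ^ j)⁻¹ * ρ) : ℂ) * H ρ) =
      ((2 : ℝ) ^ j) • ∫ ρ in Set.Ioi (0 : ℝ), ((2 ^ j * ρ : ℝ) : ℂ) ^ n *
        ((φ (((2 : ℝ) ^ j)⁻¹ * (2 ^ j * ρ)) : ℂ) * H (2 ^ j * ρ)) := by
    rw [h, smul_smul, mul_inv_cancel₀ h2.ne', one_smul]
  rw [h3, intervalIntegral.integral_of_le (by norm_num)]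
  have h4 : ∫ ρ in Set.Ioi (0 : ℝ), ((2 ^ j * ρ : ℝ) : ℂ) ^ n *
        ((φ (((2 : ℝ) ^ j)⁻¹ * (2 ^ j * ρ)) : ℂ) * H (2 ^ j * ρ)) =
      ∫ ρ in Set.Ioc (1 / 4 : ℝ) 4, ((2 ^ j * ρ : ℝ) : ℂ) ^ n *
        ((φ (((2 : ℝ) ^ j)⁻¹ * (2 ^ j * ρ)) : ℂ) * H (2 ^ j * ρ)) := by
    refine setIntegral_eq_of_subset_of_forall_sdiff_eq_zero measurableSet_Ioi ?_ ?_
    · intro x hx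
      exact lt_trans (by norm_num) hx.1
    · intro x hx
      rw [inv_mul_cancel_left₀ h2.ne', hφ.eq_zero fun h => hx.2 ⟨h.1, h.2.le⟩]
      simp
  rw [h4, ← integral_smul, ← integral_const_mul]
  congr 1
  ext ρ
  rw [inv_mul_cancel_left₀ h2.ne', Complex.real_smul]
  push_cast
  ring

theorem integrable_symbol_mul {φ : ℝ → ℝ} (hφ : IsBump φ) (n j : ℕ) {g : ℝ → ℂ}
    (hg : Continuous g) {M : ℝ} (hM : ∀ ρ, ‖g ρ‖ ≤ M) :
    Integrable (fun ξ : EV n => (φ (((2 : ℝ) ^ j)⁻¹ * ‖ξ‖) : ℂ) * g ‖ξ‖) :=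
  (integrable_symbol hφ (n + 1) j).mul_bdd (c := M)
    (Continuous.aestronglyMeasurable (by fun_prop)) (Eventually.of_forall fun ξ => hM _)

/-- The wave kernel as a one-dimensional oscillatory integral. -/
theorem waveKernel_eq {φ : ℝ → ℝ} (hφ : IsBump φ) (n j : ℕ) (t : ℝ) (x : EV n) :
    waveKernel (n + 1) φ j t x = ((2 * Real.pi : ℝ) ^ (n + 1) : ℂ)⁻¹ *
      ((((2 : ℝ) ^ j) ^ (n + 1) : ℝ) *
        ptKernel n 0 (fun ρ => (φ ρ : ℂ) * (ρ : ℂ) ^ n) (2 ^ j * t) (2 ^ j * ‖x‖)) := by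
  rw [waveKernel]
  congr 1
  have hi := integral_radial_mul_exp
    (g := fun ρ => (φ (((2 : ℝ) ^ j)⁻¹ * ρ) : ℂ) * Complex.exp (Complex.I * (t * ρ : ℝ)))
    (integrable_symbol_mul hφ n j
    (g := fun ρ => Complex.exp (Complex.I * (t * ρ : ℝ))) (by fun_prop) (M := 1)
    fun ρ => (Complex.norm_exp_I_mul_ofReal _).le) x
  simp only [mul_assoc] at hi
  rw [integral_Ioi_rescale hφ n j fun ρ => Complex.exp (Complex.I * (t * ρ : ℝ)) *
    sphA n 0 (‖x‖ * ρ)] at hi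
  calc _ = _ := by
        congr 1
        ext ξ
        rw [Complex.exp_add, mul_comm (Complex.exp (Complex.I * (inner ℝ x ξ : ℝ)))]
    _ = _ := hi
    _ = _ := by
      rw [ptKernel]
      congr 2
      ext ρ
      have e1 : t * (2 ^ j * ρ) = 2 ^ j * t * ρ := by ring
      have e2 : ‖x‖ * (2 ^ j * ρ) = 2 ^ j * ‖x‖ * ρ := by ring
      rw [e1, e2]
      ring

/-- Spherical means of the wave kernel. -/
theorem integral_sphere_waveKernel {φ : ℝ → ℝ} (hφ : IsBump φ) (n j : ℕ) (t : ℝ) (x : EV n)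
    {s : ℝ} (hs : 0 ≤ s) :
    ∫ θ : Sph n, waveKernel (n + 1) φ j t (x - s • (θ : EV n)) ∂surf n =
      ((2 * Real.pi : ℝ) ^ (n + 1) : ℂ)⁻¹ * ((((2 : ℝ) ^ j) ^ (n + 1) : ℝ) *
        radKernel n (fun ρ => (φ ρ : ℂ) * (ρ : ℂ) ^ n) (2 ^ j * t) (2 ^ j * ‖x‖) (2 ^ j * s)) := by
  simp only [waveKernel]
  rw [integral_const_mul]
  congr 1
  have hintg : Integrable (fun z : Sph n × EV n => (φ (((2 : ℝ) ^ j)⁻¹ * ‖z.2‖) : ℂ) *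
      Complex.exp (Complex.I * (inner ℝ (x - s • (z.1 : EV n)) z.2 : ℝ) +
        Complex.I * (t * ‖z.2‖ : ℝ))) ((surf n).prod volume) := by
    have h1 : Integrable (fun z : Sph n × EV n => (φ (((2 : ℝ) ^ j)⁻¹ * ‖z.2‖) : ℂ))
        ((surf n).prod volume) := by
      simpa using (integrable_const (μ := surf n) (1 : ℂ)).mul_prod (integrable_symbol hφ (n + 1) j)
    refine h1.mul_bdd (c := 1) (Continuous.aestronglyMeasurable (by fun_prop)) ?_
    refine Eventually.of_forall fun z => ?_
    rw [← mul_add, ← Complex.ofReal_add, Complex.norm_exp_I_mul_ofReal]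
  rw [integral_integral_swap hintg]
  have hinner : ∀ ξ : EV n, ∫ θ : Sph n, (φ (((2 : ℝ) ^ j)⁻¹ * ‖ξ‖) : ℂ) *
      Complex.exp (Complex.I * (inner ℝ (x - s • (θ : EV n)) ξ : ℝ) +
        Complex.I * (t * ‖ξ‖ : ℝ)) ∂surf n =
      (φ (((2 : ℝ) ^ j)⁻¹ * ‖ξ‖) : ℂ) * (Complex.exp (Complex.I * (t * ‖ξ‖ : ℝ)) *
        sphA n 0 (s * ‖ξ‖)) * Complex.exp (Complex.I * (inner ℝ x ξ : ℝ)) := by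
    intro ξ
    have h1 : ∀ θ : Sph n, Complex.exp (Complex.I * (inner ℝ (x - s • (θ : EV n)) ξ : ℝ) +
        Complex.I * (t * ‖ξ‖ : ℝ)) = Complex.exp (Complex.I * (t * ‖ξ‖ : ℝ)) *
        Complex.exp (Complex.I * (inner ℝ x ξ : ℝ)) *
        Complex.exp (Complex.I * (inner ℝ (θ : EV n) (-(s • ξ)) : ℝ)) := by
      intro θ
      rw [← Complex.exp_add, ← Complex.exp_add, inner_sub_left, inner_neg_right,
        real_inner_smul_left, real_inner_smul_right]
      congr 1
      push_cast
      ring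
    simp only [h1]
    rw [integral_const_mul, integral_const_mul, integral_sphere_exp, norm_neg, norm_smul,
      Real.norm_eq_abs, abs_of_nonneg hs]
    ring
  simp only [hinner]
  have hcA := continuous_sphA n 0
  have hi := integral_radial_mul_exp
    (g := fun ρ => (φ (((2 : ℝ) ^ j)⁻¹ * ρ) : ℂ) *
      (Complex.exp (Complex.I * (t * ρ : ℝ)) * sphA n 0 (s * ρ)))
    (integrable_symbol_mul hφ n j
    (g := fun ρ => Complex.exp (Complex.I * (t * ρ : ℝ)) * sphA n 0 (s * ρ)) (by fun_prop)
    (M := (surf n).real Set.univ)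
    fun ρ => by
      rw [norm_mul, Complex.norm_exp_I_mul_ofReal, one_mul, Complex.norm_real]
      exact abs_sphA_le n 0 _) x
  rw [hi]
  simp only [mul_assoc]
  rw [integral_Ioi_rescale hφ n j fun ρ => Complex.exp (Complex.I * (t * ρ : ℝ)) *
    (sphA n 0 (s * ρ) * sphA n 0 (‖x‖ * ρ)), radKernel]
  congr 2
  ext ρ
  have e1 : t * (2 ^ j * ρ) = 2 ^ j * (t * ρ) := by ring
  have e2 : ‖x‖ * (2 ^ j * ρ) = 2 ^ j * (‖x‖ * ρ) := by ring
  have e3 : s * (2 ^ j * ρ) = 2 ^ j * (s * ρ) := by ring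
  rw [e1, e2, e3]
  simp only [mul_assoc]
  ring

theorem continuous_ptKernel (n k : ℕ) {χ : ℝ → ℂ} (hχ : IsTest χ) (t : ℝ) :
    Continuous (ptKernel n k χ t) := by
  have := hχ.smooth.continuous
  have := continuous_sphA n k
  exact intervalIntegral.continuous_parametric_intervalIntegral_of_continuous'
    (f := fun r ρ : ℝ => χ ρ * Complex.exp (Complex.I * (t * ρ : ℝ)) * sphA n k (r * ρ))
    (by simp only [Function.uncurry_def]; fun_prop) _ _

theorem continuous_waveKernel {φ : ℝ → ℝ} (hφ : IsBump φ) (n j : ℕ) (t : ℝ) :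
    Continuous (waveKernel (n + 1) φ j t) := by
  have h := continuous_ptKernel n 0 (hφ.isTest n) (2 ^ j * t)
  have e : waveKernel (n + 1) φ j t = fun x : EV n => _ := funext (waveKernel_eq hφ n j t)
  rw [e]
  fun_prop

/-- Convolution of a radial function with the wave kernel is controlled by the spherical means
of the kernel. -/
theorem enorm_halfWave_radial_le {φ : ℝ → ℝ} {n : ℕ} (j : ℕ) (t : ℝ)
    {f : EV n → ℂ} (hf : IsRadial f) (hfm : AEStronglyMeasurable f) (x : EV n)
    {k : ℝ → ℝ≥0∞} (hk : Measurable k)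
    (hle : ∀ s : ℝ, 0 < s → ‖∫ θ : Sph n, waveKernel (n + 1) φ j t (x - s • (θ : EV n)) ∂surf n‖ₑ ≤
      k s * surf n Set.univ) :
    ‖halfWave φ j t f x‖ₑ ≤ ∫⁻ y, k ‖y‖ * ‖f y‖ₑ := by
  -- A non-integrable integrand has integral 0 by convention, and the bound is then trivial.
  by_cases hintg : Integrable (fun y => waveKernel (n + 1) φ j t (x - y) * f y)
  swap
  · rw [halfWave, integral_undef hintg]
    simp
  set e : EV n := EuclideanSpace.single 0 1 with he
  have hen : ‖e‖ = 1 := by simp [he]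
  have hfr : ∀ ρ : ℝ, ∀ θ : Sph n, f (ρ • (θ : EV n)) = f (ρ • e) := fun ρ θ =>
    hf _ _ (by rw [norm_smul, norm_smul, hen, norm_eq_of_mem_sphere])
  have hn : ∀ ρ : ℝ, 0 < ρ → ∀ θ : Sph n, ‖ρ • (θ : EV n)‖ = ρ := fun ρ hρ θ => by
    rw [norm_smul, norm_eq_of_mem_sphere, Real.norm_eq_abs, abs_of_pos hρ, mul_one]
  rw [halfWave, integral_polar hintg, lintegral_polar]
  swap
  · exact (hk.comp measurable_norm).aemeasurable.mul hfm.enorm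
  refine (enorm_integral_le_lintegral_enorm _).trans (setLIntegral_mono_ae' measurableSet_Ioi ?_)
  refine Eventually.of_forall fun ρ hρ => ?_
  have hρ : 0 < ρ := hρ
  simp only [hfr, hn ρ hρ]
  rw [integral_mul_const, enorm_mul, enorm_mul, lintegral_const]
  have h1 : ‖(ρ : ℂ) ^ n‖ₑ = ENNReal.ofReal (ρ ^ n) := by
    rw [← ofReal_norm, norm_pow, Complex.norm_real, Real.norm_eq_abs, abs_of_pos hρ]
  rw [h1]
  refine mul_le_mul_right ?_ _
  rw [mul_right_comm]
  exact mul_le_mul_left (hle ρ hρ) _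

/-! ### Covering numbers, discretizations and the Legendre–Assouad function. -/

theorem isCover_iff_abs {A C : Set ℝ} {δ : ℝ} (hδ : 0 < δ) :
    Metric.IsCover (δ / 2).toNNReal A C ↔ ∀ x ∈ A, ∃ y ∈ C, |x - y| ≤ δ / 2 := by
  rw [Metric.isCover_iff_subset_iUnion_closedBall]
  simp only [Set.subset_def, Set.mem_iUnion, Metric.mem_closedBall, Real.dist_eq,
    Real.coe_toNNReal _ (half_pos hδ).le, exists_prop]

theorem covNum_le_card {A : Set ℝ} {δ : ℝ} (hδ : 0 < δ) (C : Finset ℝ)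
    (hC : ∀ x ∈ A, ∃ y ∈ C, |x - y| ≤ δ / 2) : covNum A δ ≤ C.card := by
  have h := ((isCover_iff_abs (C := (C : Set ℝ)) hδ).2 hC).externalCoveringNumber_le_encard
  rw [Set.encard_coe_eq_coe_finsetCard] at h
  exact ENat.toNat_le_of_le_natCast h

/-- Compactness of [1, 2] makes the covering number finite, so the truncation `toNat` in `covNum`
loses nothing and an optimal cover exists. -/
theorem exists_finset_cover {A : Set ℝ} (hA : A ⊆ Set.Icc 1 2) {δ : ℝ} (hδ : 0 < δ) :
    ∃ C : Finset ℝ, C.card = covNum A δ ∧ ∀ x ∈ A, ∃ y ∈ C, |x - y| ≤ δ / 2 := by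
  have hne : (δ / 2).toNNReal ≠ 0 := by simpa using hδ
  obtain ⟨N, -, hNf, hN⟩ := Metric.exists_finite_isCover_of_isCompact hne
    (isCompact_Icc (a := (1 : ℝ)) (b := 2))
  have hN' := hN.anti hA
  have : Nonempty {s : Set ℝ // Metric.IsCover (δ / 2).toNNReal A s} := ⟨⟨N, hN'⟩⟩
  obtain ⟨⟨C, hC⟩, hCe⟩ := ENat.exists_eq_iInf
    (fun C : {s : Set ℝ // Metric.IsCover (δ / 2).toNNReal A s} => (C : Set ℝ).encard)
  have hCe' : C.encard = Metric.externalCoveringNumber (δ / 2).toNNReal A := by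
    rw [Metric.externalCoveringNumber, iInf_subtype']
    exact hCe
  have hCf : C.Finite := by
    rw [← Set.encard_lt_top_iff, hCe']
    exact hN'.externalCoveringNumber_le_encard.trans_lt (Set.encard_lt_top_iff.2 hNf)
  refine ⟨hCf.toFinset, ?_, fun x hx => ?_⟩
  · rw [covNum, ← hCe', hCf.encard_eq_coe_toFinset_card, ENat.toNat_natCast]
  · obtain ⟨y, hy, h⟩ := (isCover_iff_abs hδ).1 hC x hx
    exact ⟨y, by simpa using hy, h⟩

theorem covNum_le_of_le {A : Set ℝ} (hA : A ⊆ Set.Icc 1 2) {δ δ' : ℝ} (hδ : 0 < δ) (h : δ ≤ δ') :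
    covNum A δ' ≤ covNum A δ := by
  obtain ⟨C, hC, hcov⟩ := exists_finset_cover hA hδ
  rw [← hC]
  refine covNum_le_card (hδ.trans_le h) C fun x hx => ?_
  obtain ⟨y, hy, hxy⟩ := hcov x hx
  exact ⟨y, hy, by linarith⟩

/-- A crude grid bound. It keeps the set in `supCov` bounded above, so that `sSup` is a true
supremum, and it bounds the quotient under the limsup. -/
theorem covNum_le_div {A : Set ℝ} (hA : A ⊆ Set.Icc 1 2) {δ : ℝ} (hδ : 0 < δ) (hδ1 : δ ≤ 1) :
    (covNum A δ : ℝ) ≤ 3 / δ := by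
  have h := covNum_le_card (A := A) hδ
    ((Finset.range (⌈1 / δ⌉₊ + 1)).image fun i : ℕ => 1 + (i : ℝ) * δ) (fun x hx => by
      have hx' := hA hx
      -- The shift by 1/2 turns the floor into rounding to the nearest grid point.
      set y := (x - 1) / δ + 1 / 2 with hy
      have hy0 : 0 ≤ y := by
        have : 0 ≤ (x - 1) / δ := div_nonneg (by linarith [hx'.1]) hδ.le
        linarith
      refine ⟨1 + (⌊y⌋₊ : ℝ) * δ, ?_, ?_⟩
      · refine Finset.mem_image_of_mem _ (Finset.mem_range.2 (Nat.lt_succ_of_le ?_))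
        refine Nat.lt_succ_iff.1 ((Nat.floor_lt hy0).2 ?_)
        have h1 : (x - 1) / δ ≤ 1 / δ := by gcongr; linarith [hx'.2]
        have h2 := Nat.le_ceil (1 / δ)
        push_cast
        linarith
      · have h1 := Nat.floor_le hy0
        have h2 := Nat.lt_floor_add_one y
        have h3 : x - 1 = (y - 1 / 2) * δ := by rw [hy]; field_simp; ring
        rw [abs_le]
        constructor <;> nlinarith)
  have h2 := h.trans Finset.card_image_le
  rw [Finset.card_range] at h2
  have h3 : (covNum A δ : ℝ) ≤ ⌈1 / δ⌉₊ + 1 := by exact_mod_cast h2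
  have h4 := Nat.ceil_lt_add_one (a := 1 / δ) (by positivity)
  have h5 : 1 ≤ 1 / δ := by rwa [le_div_iff₀ hδ, one_mul]
  have h6 : 3 / δ = 3 * (1 / δ) := by ring
  rw [h6]
  linarith

/-- A closed interval of length δ may contain two δ-separated points, its endpoints, but never
three. -/
theorem card_le_two_mul_covNum {A : Set ℝ} (hA : A ⊆ Set.Icc 1 2) {δ : ℝ} (hδ : 0 < δ)
    {T : Finset ℝ} (hT : ∀ t ∈ T, t ∈ A) (hs : (T : Set ℝ).Pairwise fun s t => δ ≤ |s - t|) :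
    T.card ≤ 2 * covNum A δ := by
  obtain ⟨C, hC, hcov⟩ := exists_finset_cover hA hδ
  choose! g hg hgd using hcov
  rw [← hC]
  refine Finset.card_le_mul_card_image_of_maps_to (f := g) (fun t ht => hg t (hT t ht)) 2 fun c _ => ?_
  by_contra hcard
  push Not at hcard
  obtain ⟨x, hx, y, hy, z, hz, hxy, hxz, hyz⟩ := Finset.two_lt_card.1 hcard
  rw [Finset.mem_filter] at hx hy hz
  have e1 := hs hx.1 hy.1 hxy
  have e2 := hs hx.1 hz.1 hxz
  have e3 := hs hy.1 hz.1 hyz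
  have d1 := hgd x (hT x hx.1)
  have d2 := hgd y (hT y hy.1)
  have d3 := hgd z (hT z hz.1)
  rw [hx.2] at d1
  rw [hy.2] at d2
  rw [hz.2] at d3
  rw [abs_le] at d1 d2 d3
  rcases le_abs.1 e1 with h1 | h1 <;> rcases le_abs.1 e2 with h2 | h2 <;>
    rcases le_abs.1 e3 with h3 | h3 <;> linarith

theorem IsDiscretization.finite {E S : Set ℝ} (hE : E ⊆ Set.Icc 1 2) {δ : ℝ} (hδ : 0 < δ)
    (hS : IsDiscretization E δ S) : S.Finite := by
  by_contra hinf
  obtain ⟨T, hT, hc⟩ := Set.Infinite.exists_subset_card_eq hinf (2 * covNum E δ + 1)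
  have := card_le_two_mul_covNum hE hδ (T := T) (fun t ht => hS.prop.1 (hT ht)) (hS.prop.2.mono hT)
  omega

theorem IsDiscretization.exists_near {E S : Set ℝ} {δ : ℝ} (hδ : 0 < δ)
    (hS : IsDiscretization E δ S) {x : ℝ} (hx : x ∈ E) : ∃ t ∈ S, |x - t| ≤ δ := by
  by_contra! hcon
  have hxS : x ∉ S := fun h => by
    have := hcon x h
    simp at this
    linarith
  have h := hS.le_of_ge (y := insert x S) ⟨Set.insert_subset hx hS.prop.1, by
    refine hS.prop.2.insert fun t ht _ => ⟨(hcon t ht).le, ?_⟩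
    rw [abs_sub_comm]
    exact (hcon t ht).le⟩ (Set.subset_insert x S)
  exact hxS (h (Set.mem_insert x S))

/-- By maximality the intervals [t - δ, t + δ] cover E, and each splits into two intervals of length
δ. The window is widened by δ because the point t near x may lie outside [a, b]. -/
theorem covNum_le_two_mul_card {E : Set ℝ} {δ : ℝ} (hδ : 0 < δ) {T : Finset ℝ}
    (hT : IsDiscretization E δ (T : Set ℝ)) (a b : ℝ) :
    covNum (E ∩ Set.Icc a b) δ ≤ 2 * (T.filter fun t => a - δ ≤ t ∧ t ≤ b + δ).card := by
  classical
  set T' := T.filter fun t => a - δ ≤ t ∧ t ≤ b + δ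
  refine (covNum_le_card hδ (T'.image (fun t => t - δ / 2) ∪ T'.image (fun t => t + δ / 2))
    fun x hx => ?_).trans ?_
  · obtain ⟨t, ht, hxt⟩ := hT.exists_near hδ hx.1
    rw [abs_le] at hxt
    have ht' : t ∈ T' := Finset.mem_filter.2 ⟨ht, by linarith [hx.2.1], by linarith [hx.2.2]⟩
    rcases le_total x t with h | h
    · refine ⟨t - δ / 2, Finset.mem_union_left _ (Finset.mem_image_of_mem _ ht'), ?_⟩
      rw [abs_le]; constructor <;> linarith
    · refine ⟨t + δ / 2, Finset.mem_union_right _ (Finset.mem_image_of_mem _ ht'), ?_⟩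
      rw [abs_le]; constructor <;> linarith
  · refine (Finset.card_union_le _ _).trans ?_
    have h1 := Finset.card_image_le (s := T') (f := fun t => t - δ / 2)
    have h2 := Finset.card_image_le (s := T') (f := fun t => t + δ / 2)
    omega

theorem supCov_mem_le {E : Set ℝ} (hE : E ⊆ Set.Icc 1 2) {α δ : ℝ} (hα : 0 ≤ α) (hδ : 0 < δ)
    {a b : ℝ} (h1 : δ ≤ b - a) (h2 : b - a ≤ 1) :
    (b - a) ^ (-α) * (covNum (E ∩ Set.Icc a b) δ : ℝ) ≤ δ ^ (-α) * (3 / δ) := by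
  refine mul_le_mul ?_ ?_ (Nat.cast_nonneg _) (by positivity)
  · exact Real.rpow_le_rpow_of_nonpos hδ h1 (by linarith)
  · exact covNum_le_div (Set.inter_subset_left.trans hE) hδ (h1.trans h2)

theorem le_supCov {E : Set ℝ} (hE : E ⊆ Set.Icc 1 2) {α δ : ℝ} (hα : 0 ≤ α) (hδ : 0 < δ)
    {a b : ℝ} (h1 : δ ≤ b - a) (h2 : b - a ≤ 1) :
    (b - a) ^ (-α) * (covNum (E ∩ Set.Icc a b) δ : ℝ) ≤ supCov E α δ := by
  refine le_csSup ⟨δ ^ (-α) * (3 / δ), ?_⟩ ⟨a, b, h1, h2, rfl⟩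
  rintro _ ⟨a, b, h1, h2, rfl⟩
  exact supCov_mem_le hE hα hδ h1 h2

theorem supCov_le {E : Set ℝ} (hE : E ⊆ Set.Icc 1 2) {α δ : ℝ} (hα : 0 ≤ α) (hδ : 0 < δ)
    (hδ1 : δ ≤ 1) : supCov E α δ ≤ δ ^ (-α) * (3 / δ) := by
  refine csSup_le ⟨_, 0, 1, by simpa using hδ1, by norm_num, rfl⟩ ?_
  rintro _ ⟨a, b, h1, h2, rfl⟩
  exact supCov_mem_le hE hα hδ h1 h2

theorem one_le_supCov {E : Set ℝ} (hE : E ⊆ Set.Icc 1 2) (hne : E.Nonempty) {α δ : ℝ} (hα : 0 ≤ α)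
    (hδ : 0 < δ) (hδ1 : δ ≤ 1) : 1 ≤ supCov E α δ := by
  obtain ⟨x, hx⟩ := hne
  have h := le_supCov hE hα hδ (a := x) (b := x + 1) (by linarith) (by linarith)
  refine le_trans ?_ h
  have e : x + 1 - x = 1 := by ring
  rw [e, Real.one_rpow, one_mul]
  obtain ⟨C, hC, hcov⟩ := exists_finset_cover (A := E ∩ Set.Icc x (x + 1))
    (Set.inter_subset_left.trans hE) hδ
  obtain ⟨y, hy, -⟩ := hcov x ⟨hx, by simp⟩
  rw [← hC]
  exact_mod_cast Finset.card_pos.2 ⟨y, hy⟩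

theorem card_filter_le_supCov {E : Set ℝ} (hE : E ⊆ Set.Icc 1 2) {α δ : ℝ} (hα : 0 ≤ α)
    (hδ : 0 < δ) {T : Finset ℝ} (hT : ∀ t ∈ T, t ∈ E)
    (hs : (T : Set ℝ).Pairwise fun s t => δ ≤ |s - t|)
    {a b : ℝ} (h1 : δ ≤ b - a) (h2 : b - a ≤ 1) :
    (b - a) ^ (-α) * ((T.filter fun t => a ≤ t ∧ t ≤ b).card : ℝ) ≤ 2 * supCov E α δ := by
  have h := card_le_two_mul_covNum (A := E ∩ Set.Icc a b) (Set.inter_subset_left.trans hE) hδ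
    (T := T.filter fun t => a ≤ t ∧ t ≤ b)
    (fun t ht => ⟨hT t (Finset.mem_filter.1 ht).1, (Finset.mem_filter.1 ht).2⟩)
    (hs.mono (Finset.coe_subset.2 (Finset.filter_subset _ _)))
  have h' : ((T.filter fun t => a ≤ t ∧ t ≤ b).card : ℝ) ≤
      2 * (covNum (E ∩ Set.Icc a b) δ : ℝ) := by exact_mod_cast h
  have hb : 0 ≤ (b - a) ^ (-α) := Real.rpow_nonneg (by linarith) _
  have h3 := le_supCov hE hα hδ h1 h2
  calc _ ≤ (b - a) ^ (-α) * (2 * (covNum (E ∩ Set.Icc a b) δ : ℝ)) := by gcongr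
    _ = 2 * ((b - a) ^ (-α) * (covNum (E ∩ Set.Icc a b) δ : ℝ)) := by ring
    _ ≤ _ := by gcongr

theorem card_le_supCov {E : Set ℝ} (hE : E ⊆ Set.Icc 1 2) {α δ : ℝ} (hα : 0 ≤ α)
    (hδ : 0 < δ) (hδ1 : δ ≤ 1) {T : Finset ℝ} (hT : ∀ t ∈ T, t ∈ E)
    (hs : (T : Set ℝ).Pairwise fun s t => δ ≤ |s - t|) :
    (T.card : ℝ) ≤ 2 * supCov E α δ := by
  have h := card_filter_le_supCov hE hα hδ hT hs (a := 1) (b := 2) (by linarith) (by norm_num)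
  rw [Finset.filter_true_of_mem fun t ht => ⟨(hE (hT t ht)).1, (hE (hT t ht)).2⟩] at h
  norm_num at h
  exact h

/-- Only the finest scale 2^{-k}, k ≤ j, with |x| ≤ 2^{-k} is needed: there 2^{-j} + |x| is at least
half of 2^{-k}, which costs 2^α. The summand 1 takes care of |x| > 1. -/
theorem rpow_le_dyadic_sum {α : ℝ} (hα : 0 ≤ α) (j : ℕ) (x : ℝ) :
    (((2 : ℝ) ^ j)⁻¹ + |x|) ^ (-α) ≤ 1 + ∑ k ∈ Finset.range (j + 1),
      (2 : ℝ) ^ α * (if |x| ≤ ((2 : ℝ) ^ k)⁻¹ then (((2 : ℝ) ^ k)⁻¹) ^ (-α) else 0) := by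
  have hnn : ∀ k ∈ Finset.range (j + 1), 0 ≤ (2 : ℝ) ^ α *
      (if |x| ≤ ((2 : ℝ) ^ k)⁻¹ then (((2 : ℝ) ^ k)⁻¹) ^ (-α) else 0) := fun k _ => by
    split_ifs <;> positivity
  have hj : (0 : ℝ) < ((2 : ℝ) ^ j)⁻¹ := by positivity
  rcases lt_or_ge 1 |x| with h | h
  · have h1 : (((2 : ℝ) ^ j)⁻¹ + |x|) ^ (-α) ≤ 1 :=
      Real.rpow_le_one_of_one_le_of_nonpos (by linarith) (by linarith)
    have := Finset.sum_nonneg hnn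
    linarith
  · set P : ℕ → Prop := fun k => |x| ≤ ((2 : ℝ) ^ k)⁻¹ with hP
    classical
    set k := Nat.findGreatest P j with hk
    have hk1 : P k := Nat.findGreatest_spec (P := P) (m := 0) (Nat.zero_le _) (by simpa [hP] using h)
    have hkj : k ≤ j := Nat.findGreatest_le j
    have hlow : ((2 : ℝ) ^ k)⁻¹ / 2 ≤ ((2 : ℝ) ^ j)⁻¹ + |x| := by
      rcases hkj.eq_or_lt with e | e
      · rw [e]
        linarith [abs_nonneg x]
      · have h2 := Nat.findGreatest_is_greatest (P := P) (Nat.lt_succ_self k) e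
        simp only [hP, not_le] at h2
        rw [Nat.succ_eq_add_one, pow_succ, mul_inv] at h2
        linarith
    have h3 : (((2 : ℝ) ^ j)⁻¹ + |x|) ^ (-α) ≤ (2 : ℝ) ^ α * (((2 : ℝ) ^ k)⁻¹) ^ (-α) := by
      have h0 : (0 : ℝ) < ((2 : ℝ) ^ k)⁻¹ := by positivity
      calc (((2 : ℝ) ^ j)⁻¹ + |x|) ^ (-α) ≤ (((2 : ℝ) ^ k)⁻¹ / 2) ^ (-α) :=
            Real.rpow_le_rpow_of_nonpos (by positivity) hlow (by linarith)
        _ = _ := by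
          rw [Real.div_rpow h0.le two_pos.le, Real.rpow_neg two_pos.le, div_inv_eq_mul, mul_comm]
    have h4 := Finset.single_le_sum hnn (Finset.mem_range.2 (Nat.lt_succ_of_le hkj))
    have hk1' : |x| ≤ ((2 : ℝ) ^ k)⁻¹ := hk1
    rw [if_pos hk1'] at h4
    linarith

/-- The basic counting estimate behind the Legendre–Assouad function. -/
theorem sum_rpow_le_supCov {E : Set ℝ} (hE : E ⊆ Set.Icc 1 2) {α : ℝ} (hα : 0 ≤ α) (j : ℕ)
    {T : Finset ℝ} (hT : ∀ t ∈ T, t ∈ E)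
    (hs : (T : Set ℝ).Pairwise fun s t => ((2 : ℝ) ^ j)⁻¹ ≤ |s - t|) (v : ℝ) :
    ∑ t ∈ T, (((2 : ℝ) ^ j)⁻¹ + |t - v|) ^ (-α) ≤
      (2 + 4 * 2 ^ α * (j + 1)) * supCov E α ((2 : ℝ) ^ j)⁻¹ := by
  set δ : ℝ := ((2 : ℝ) ^ j)⁻¹ with hδd
  have hδ : 0 < δ := by positivity
  have hδ1 : δ ≤ 1 := inv_le_one_of_one_le₀ (one_le_pow₀ (by norm_num))
  set X := supCov E α δ
  have hk : ∀ k ∈ Finset.range (j + 1), ∑ t ∈ T, (2 : ℝ) ^ α *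
      (if |t - v| ≤ ((2 : ℝ) ^ k)⁻¹ then (((2 : ℝ) ^ k)⁻¹) ^ (-α) else 0) ≤
      (2 : ℝ) ^ α * (4 * X) := by
    intro k hk
    rw [← Finset.mul_sum]
    refine mul_le_mul_of_nonneg_left ?_ (by positivity)
    set l : ℝ := ((2 : ℝ) ^ k)⁻¹ with hl
    have hl0 : 0 < l := by positivity
    have hl1 : l ≤ 1 := inv_le_one_of_one_le₀ (one_le_pow₀ (by norm_num))
    have hlδ : δ ≤ l := by
      refine inv_anti₀ (by positivity) (pow_le_pow_right₀ (by norm_num) ?_)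
      exact Nat.lt_succ_iff.1 (Finset.mem_range.1 hk)
    -- The interval around v is cut at v, since its full length 2l could exceed the admissible
    -- length 1.
    have c1 := card_filter_le_supCov hE hα hδ hT hs (a := v - l) (b := v) (by linarith) (by linarith)
    have c2 := card_filter_le_supCov hE hα hδ hT hs (a := v) (b := v + l) (by linarith) (by linarith)
    rw [show v - (v - l) = l by ring] at c1
    rw [show v + l - v = l by ring] at c2
    rw [← Finset.sum_filter, Finset.sum_const, nsmul_eq_mul]
    have hc : (T.filter fun t => |t - v| ≤ l).card ≤
        (T.filter fun t => v - l ≤ t ∧ t ≤ v).card +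
        (T.filter fun t => v ≤ t ∧ t ≤ v + l).card := by
      refine (Finset.card_le_card ?_).trans (Finset.card_union_le _ _)
      intro t ht
      rw [Finset.mem_filter, abs_le] at ht
      rw [Finset.mem_union, Finset.mem_filter, Finset.mem_filter]
      rcases le_total t v with h | h
      · exact Or.inl ⟨ht.1, by linarith, h⟩
      · exact Or.inr ⟨ht.1, h, by linarith⟩
    have hc' : ((T.filter fun t => |t - v| ≤ l).card : ℝ) ≤
        (T.filter fun t => v - l ≤ t ∧ t ≤ v).card +
        (T.filter fun t => v ≤ t ∧ t ≤ v + l).card := by exact_mod_cast hc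
    have := mul_le_mul_of_nonneg_left hc' (Real.rpow_nonneg hl0.le (-α))
    rw [mul_comm]
    linarith
  calc ∑ t ∈ T, (δ + |t - v|) ^ (-α) ≤ ∑ t ∈ T, (1 + ∑ k ∈ Finset.range (j + 1),
      (2 : ℝ) ^ α * (if |t - v| ≤ ((2 : ℝ) ^ k)⁻¹ then (((2 : ℝ) ^ k)⁻¹) ^ (-α) else 0)) :=
        Finset.sum_le_sum fun t _ => rpow_le_dyadic_sum hα j (t - v)
    _ = T.card + ∑ k ∈ Finset.range (j + 1), ∑ t ∈ T, (2 : ℝ) ^ α *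
      (if |t - v| ≤ ((2 : ℝ) ^ k)⁻¹ then (((2 : ℝ) ^ k)⁻¹) ^ (-α) else 0) := by
        rw [Finset.sum_add_distrib, Finset.sum_comm]
        simp
    _ ≤ 2 * X + ∑ k ∈ Finset.range (j + 1), (2 : ℝ) ^ α * (4 * X) :=
        add_le_add (card_le_supCov hE hα hδ hδ1 hT hs) (Finset.sum_le_sum hk)
    _ = _ := by
        rw [Finset.sum_const, Finset.card_range, nsmul_eq_mul]
        push_cast
        ring

/-- Two-sided boundedness is what makes the real-valued `limsup` meaningful. The threshold 1/3 lets
log 3 be absorbed by log(1/δ). -/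
theorem log_supCov_bounds {E : Set ℝ} (hE : E ⊆ Set.Icc 1 2) (hne : E.Nonempty) {α : ℝ}
    (hα : 0 ≤ α) : ∀ᶠ δ : ℝ in 𝓝[>] 0, 0 ≤ Real.log (supCov E α δ) / Real.log (1 / δ) ∧
      Real.log (supCov E α δ) / Real.log (1 / δ) ≤ α + 2 := by
  filter_upwards [Ioo_mem_nhdsGT (show (0 : ℝ) < 1 / 3 by norm_num)] with δ hδ
  have h0 : 0 < δ := hδ.1
  have h1 : δ ≤ 1 := by linarith [hδ.2]
  have hl : 0 < Real.log (1 / δ) := Real.log_pos (by rw [lt_div_iff₀ h0]; linarith [hδ.2])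
  have hs := one_le_supCov hE hne hα h0 h1
  refine ⟨div_nonneg (Real.log_nonneg hs) hl.le, ?_⟩
  rw [div_le_iff₀ hl]
  calc Real.log (supCov E α δ) ≤ Real.log (δ ^ (-α) * (3 / δ)) :=
        Real.log_le_log (by linarith) (supCov_le hE hα h0 h1)
    _ = α * Real.log (1 / δ) + Real.log 3 + Real.log (1 / δ) := by
        rw [Real.log_mul (by positivity) (by positivity), Real.log_rpow h0,
          Real.log_div (by norm_num) h0.ne', one_div, Real.log_inv]
        ring
    _ ≤ α * Real.log (1 / δ) + Real.log (1 / δ) + Real.log (1 / δ) := by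
        gcongr
        rw [le_div_iff₀ h0]
        linarith [hδ.2]
    _ = _ := by ring

theorem exists_supCov_le {E : Set ℝ} (hE : E ⊆ Set.Icc 1 2) (hne : E.Nonempty) {α : ℝ}
    (hα : 0 ≤ α) {ε : ℝ} (hε : 0 < ε) : ∃ C : ℝ, 0 < C ∧ ∀ j : ℕ,
      supCov E α ((2 : ℝ) ^ j)⁻¹ ≤ C * (2 : ℝ) ^ ((j : ℝ) * (legendreAssouad E α + ε)) := by
  have hb := log_supCov_bounds hE hne hα
  set ν := legendreAssouad E α with hν
  have hlt : legendreAssouad E α < ν + ε := by linarith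
  have hev := eventually_lt_of_limsup_lt hlt ⟨α + 2, by
    rw [eventually_map]
    exact hb.mono fun δ h => h.2⟩
  obtain ⟨δ₀, hδ₀, hδ₀'⟩ := mem_nhdsGT_iff_exists_Ioo_subset.1 hev
  have hδ₀ : 0 < δ₀ := hδ₀
  obtain ⟨J, hJ⟩ := exists_pow_lt_of_lt_one hδ₀ (show (1 / 2 : ℝ) < 1 by norm_num)
  -- The 1 serves the scales j ≥ J + 1 controlled by the limsup; the other summand absorbs the
  -- finitely many remaining ones by the crude bound, with |ν + ε| covering either sign of the
  -- exponent.
  refine ⟨1 + 3 * (2 : ℝ) ^ ((J + 1 : ℝ) * (α + 1)) * (2 : ℝ) ^ ((J + 1 : ℝ) * |ν + ε|),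
    by positivity, fun j => ?_⟩
  set δ : ℝ := ((2 : ℝ) ^ j)⁻¹ with hδd
  have hδ : 0 < δ := by positivity
  have hδ1 : δ ≤ 1 := inv_le_one_of_one_le₀ (one_le_pow₀ (by norm_num))
  have hδr : δ = (2 : ℝ) ^ (-(j : ℝ)) := by
    rw [hδd, Real.rpow_neg two_pos.le, Real.rpow_natCast]
  have hpos : 0 < (2 : ℝ) ^ ((j : ℝ) * (ν + ε)) := by positivity
  rcases le_or_gt (J + 1) j with h | h
  · have hlt1 : δ < 1 := by
      rw [hδd]
      exact inv_lt_one_of_one_lt₀ (one_lt_pow₀ (by norm_num) (by omega))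
    have hmem : δ ∈ Set.Ioo 0 δ₀ := by
      refine ⟨hδ, lt_of_le_of_lt ?_ hJ⟩
      rw [hδd, one_div, inv_pow]
      exact inv_anti₀ (by positivity) (pow_le_pow_right₀ (by norm_num) (by omega))
    have h1 : Real.log (supCov E α δ) / Real.log (1 / δ) < ν + ε := hδ₀' hmem
    have hl : 0 < Real.log (1 / δ) := Real.log_pos (by rw [lt_div_iff₀ hδ]; linarith)
    rw [div_lt_iff₀ hl] at h1
    have hs := one_le_supCov hE hne hα hδ hδ1
    have h2 : supCov E α δ ≤ (2 : ℝ) ^ ((j : ℝ) * (ν + ε)) := by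
      rw [← Real.log_le_log_iff (by linarith) hpos, Real.log_rpow two_pos]
      refine h1.le.trans (le_of_eq ?_)
      rw [hδr, one_div, Real.log_inv, Real.log_rpow two_pos]
      ring
    refine h2.trans (le_mul_of_one_le_left hpos.le ?_)
    have : 0 ≤ 3 * (2 : ℝ) ^ ((J + 1 : ℝ) * (α + 1)) * (2 : ℝ) ^ ((J + 1 : ℝ) * |ν + ε|) := by
      positivity
    linarith
  · have hjJ : (j : ℝ) ≤ J + 1 := by exact_mod_cast h.le
    have h1 : supCov E α δ ≤ 3 * (2 : ℝ) ^ ((J + 1 : ℝ) * (α + 1)) := by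
      refine (supCov_le hE hα hδ hδ1).trans ?_
      have e : δ ^ (-α) * (3 / δ) = 3 * (2 : ℝ) ^ ((j : ℝ) * (α + 1)) := by
        rw [hδr, ← Real.rpow_mul two_pos.le, Real.rpow_neg two_pos.le, div_inv_eq_mul, mul_left_comm,
          ← Real.rpow_add two_pos]
        congr 2
        ring
      rw [e]
      gcongr
      norm_num
    have h2 : (1 : ℝ) ≤ (2 : ℝ) ^ ((J + 1 : ℝ) * |ν + ε|) * (2 : ℝ) ^ ((j : ℝ) * (ν + ε)) := by
      rw [← Real.rpow_add two_pos]
      refine Real.one_le_rpow (by norm_num) ?_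
      have a1 : -|ν + ε| ≤ ν + ε := neg_abs_le _
      have a2 := abs_nonneg (ν + ε)
      have a3 : (0 : ℝ) ≤ j := by positivity
      nlinarith
    calc supCov E α δ ≤ 3 * (2 : ℝ) ^ ((J + 1 : ℝ) * (α + 1)) * 1 := by rw [mul_one]; exact h1
      _ ≤ 3 * (2 : ℝ) ^ ((J + 1 : ℝ) * (α + 1)) *
        ((2 : ℝ) ^ ((J + 1 : ℝ) * |ν + ε|) * (2 : ℝ) ^ ((j : ℝ) * (ν + ε))) := by gcongr
      _ = 3 * (2 : ℝ) ^ ((J + 1 : ℝ) * (α + 1)) *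
        (2 : ℝ) ^ ((J + 1 : ℝ) * |ν + ε|) * (2 : ℝ) ^ ((j : ℝ) * (ν + ε)) := by ring
      _ ≤ _ := by
        rw [add_mul]
        linarith

/-- The quotient exceeds s for arbitrarily small δ. Rounding δ down to a dyadic scale only increases
covering numbers and enlarges the range of admissible lengths, while 2^{-|s|} pays for the change in
the power, whatever the sign of s. -/
theorem exists_interval_of_lt_legendreAssouad {E : Set ℝ} (hE : E ⊆ Set.Icc 1 2) (hne : E.Nonempty)
    {α : ℝ} (hα : 0 ≤ α) {s : ℝ} (hs : s < legendreAssouad E α) (J : ℕ) :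
    ∃ j : ℕ, J ≤ j ∧ ∃ a b : ℝ, ((2 : ℝ) ^ j)⁻¹ ≤ b - a ∧ b - a ≤ 1 ∧
      (2 : ℝ) ^ (-|s|) * (2 : ℝ) ^ ((j : ℝ) * s) <
        (b - a) ^ (-α) * (covNum (E ∩ Set.Icc a b) ((2 : ℝ) ^ j)⁻¹ : ℝ) := by
  have hb := log_supCov_bounds hE hne hα
  have hfr := frequently_lt_of_lt_limsup (IsBoundedUnder.isCoboundedUnder_le ⟨0, by
    rw [eventually_map]
    exact hb.mono fun δ h => h.1⟩) hs
  obtain ⟨δ, hlt, hδ⟩ := (hfr.and_eventually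
    (Ioo_mem_nhdsGT (show (0 : ℝ) < (1 / 2) ^ (J + 1) by positivity))).exists
  have h0 : 0 < δ := hδ.1
  have hhalf : ((1 : ℝ) / 2) ^ (J + 1) < 1 := pow_lt_one₀ (by norm_num) (by norm_num) (by omega)
  have h1 : δ < 1 := hδ.2.trans hhalf
  obtain ⟨m, hm1, hm2⟩ := exists_nat_pow_near_of_lt_one h0 h1.le
    (show (0 : ℝ) < 1 / 2 by norm_num) (by norm_num)
  have hl : 0 < Real.log (1 / δ) := Real.log_pos (by rw [lt_div_iff₀ h0]; linarith)
  rw [lt_div_iff₀ hl] at hlt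
  have hsup := one_le_supCov hE hne hα h0 h1.le
  have h2 : δ ^ (-s) < supCov E α δ := by
    rw [← Real.log_lt_log_iff (by positivity) (by linarith), Real.log_rpow h0]
    refine lt_of_eq_of_lt ?_ hlt
    rw [one_div, Real.log_inv]
    ring
  obtain ⟨_, ⟨a, b, ha, hb', rfl⟩, hy⟩ := exists_lt_of_lt_csSup
    (show {y : ℝ | ∃ a b : ℝ, δ ≤ b - a ∧ b - a ≤ 1 ∧
      y = (b - a) ^ (-α) * (covNum (E ∩ Set.Icc a b) δ : ℝ)}.Nonempty from
      ⟨_, 0, 1, by simpa using h1.le, by norm_num, rfl⟩) h2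
  have hmJ : J ≤ m := by
    by_contra hcon
    push Not at hcon
    have : ((1 : ℝ) / 2) ^ (J + 1) ≤ (1 / 2) ^ (m + 1) :=
      pow_le_pow_of_le_one (by norm_num) (by norm_num) (by omega)
    linarith [hδ.2]
  have hj : ((2 : ℝ) ^ (m + 1))⁻¹ ≤ δ := by
    rw [← inv_pow, ← one_div]
    exact hm1.le
  refine ⟨m + 1, by omega, a, b, hj.trans ha, hb', ?_⟩
  have h3 : (covNum (E ∩ Set.Icc a b) δ : ℝ) ≤
      (covNum (E ∩ Set.Icc a b) ((2 : ℝ) ^ (m + 1))⁻¹ : ℝ) := by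
    exact_mod_cast covNum_le_of_le (Set.inter_subset_left.trans hE) (by positivity) hj
  have hba : 0 ≤ (b - a) ^ (-α) := Real.rpow_nonneg (by linarith) _
  refine lt_of_le_of_lt ?_ (hy.trans_le (mul_le_mul_of_nonneg_left h3 hba))
  have hδr : ((2 : ℝ) ^ (m + 1))⁻¹ = (2 : ℝ) ^ (-((m + 1 : ℕ) : ℝ)) := by
    rw [Real.rpow_neg two_pos.le, Real.rpow_natCast]
  have hup : δ ≤ (2 : ℝ) ^ (1 - ((m + 1 : ℕ) : ℝ)) := by
    refine hm2.trans (le_of_eq ?_)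
    rw [one_div, inv_pow, ← Real.rpow_natCast, ← Real.rpow_neg two_pos.le]
    congr 1
    push_cast
    ring
  rw [← Real.rpow_add two_pos]
  rcases le_total 0 s with h | h
  · calc _ = ((2 : ℝ) ^ (1 - ((m + 1 : ℕ) : ℝ))) ^ (-s) := by
          rw [← Real.rpow_mul two_pos.le, abs_of_nonneg h]
          congr 1
          ring
      _ ≤ δ ^ (-s) := Real.rpow_le_rpow_of_nonpos h0 hup (by linarith)
  · calc _ ≤ ((2 : ℝ) ^ (-((m + 1 : ℕ) : ℝ))) ^ (-s) := by
          rw [← Real.rpow_mul two_pos.le]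
          refine Real.rpow_le_rpow_of_exponent_le (by norm_num) ?_
          have := abs_nonneg s
          linarith
      _ ≤ δ ^ (-s) := by
          rw [← hδr]
          exact Real.rpow_le_rpow (by positivity) hj (by linarith)

/-! ### Integrals over the wave fronts. -/

theorem lintegral_fun_norm {n : ℕ} {F : ℝ → ℝ≥0∞} (hF : Measurable F) :
    ∫⁻ x : EV n, F ‖x‖ = surf n Set.univ * ∫⁻ r in Set.Ioi (0 : ℝ), ENNReal.ofReal (r ^ n) * F r := by
  rw [lintegral_polar (F := fun x : EV n => F ‖x‖) (hF.comp measurable_norm).aemeasurable, ← lintegral_const_mul]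
  swap
  · fun_prop
  refine setLIntegral_congr_fun measurableSet_Ioi fun r hr => ?_
  have hr : 0 < r := hr
  have hn : ∀ θ : Sph n, ‖r • (θ : EV n)‖ = r := fun θ => by
    rw [norm_smul, norm_eq_of_mem_sphere, Real.norm_eq_abs, abs_of_pos hr, mul_one]
  simp only [hn, lintegral_const]
  ring

/-- Jensen's inequality for the integral against a kernel. -/
theorem lintegral_mul_rpow_le {X : Type*} [MeasurableSpace X] {μ : Measure X} {p : ℝ} (hp : 1 < p)
    {k h : X → ℝ≥0∞} (hk : AEMeasurable k μ) (hh : AEMeasurable h μ) :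
    (∫⁻ x, k x * h x ∂μ) ^ p ≤ (∫⁻ x, k x ∂μ) ^ (p - 1) * ∫⁻ x, k x * h x ^ p ∂μ := by
  set q := p.conjExponent with hq
  have hpq : p.HolderConjugate q := Real.HolderConjugate.conjExponent hp
  have hp0 : 0 < p := by linarith
  have hq0 : 0 < q := hpq.symm.pos
  have h1 := ENNReal.lintegral_mul_le_Lp_mul_Lq μ hpq
    (f := fun x => k x ^ (1 / p) * h x) (g := fun x => k x ^ (1 / q))
    ((hk.pow_const _).mul hh) (hk.pow_const _)
  have e1 : ∀ x, ((fun x => k x ^ (1 / p) * h x) * fun x => k x ^ (1 / q)) x = k x * h x := by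
    intro x
    simp only [Pi.mul_apply]
    rw [mul_right_comm, ← ENNReal.rpow_add_of_nonneg _ _ (by positivity) (by positivity)]
    have : 1 / p + 1 / q = 1 := by simpa using hpq.inv_add_inv_eq_one
    rw [this, ENNReal.rpow_one]
  have e2 : ∀ x, (k x ^ (1 / p) * h x) ^ p = k x * h x ^ p := by
    intro x
    rw [ENNReal.mul_rpow_of_nonneg _ _ hp0.le, ← ENNReal.rpow_mul, one_div_mul_cancel hp0.ne',
      ENNReal.rpow_one]
  have e3 : ∀ x, (k x ^ (1 / q)) ^ q = k x := by
    intro x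
    rw [← ENNReal.rpow_mul, one_div_mul_cancel hq0.ne', ENNReal.rpow_one]
  simp only [e1, e2, e3] at h1
  calc _ ≤ ((∫⁻ x, k x * h x ^ p ∂μ) ^ (1 / p) * (∫⁻ x, k x ∂μ) ^ (1 / q)) ^ p := by gcongr
    _ = _ := by
      rw [ENNReal.mul_rpow_of_nonneg _ _ hp0.le, ← ENNReal.rpow_mul, ← ENNReal.rpow_mul,
        one_div_mul_cancel hp0.ne', ENNReal.rpow_one, mul_comm]
      congr 2
      rw [one_div_mul_eq_div]
      exact hpq.div_conj_eq_sub_one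

/-- `Q (1 + Q|u|)^{-2}`. -/
def psi (Q u : ℝ) : ℝ := Q / (1 + Q * |u|) ^ 2

theorem psi_nonneg {Q : ℝ} (hQ : 0 < Q) (u : ℝ) : 0 ≤ psi Q u := by
  unfold psi
  positivity

theorem measurable_psi (Q : ℝ) : Measurable (psi Q) := by
  unfold psi
  fun_prop

/-- All `psi Q` are dilates of `psi 1` normalised in L¹, so one constant serves every frequency. -/
theorem exists_lintegral_psi_le :
    ∃ I : ℝ, 0 < I ∧ ∀ Q : ℝ, 0 < Q → ∫⁻ u, ENNReal.ofReal (psi Q u) ≤ ENNReal.ofReal I := by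
  have hintg : Integrable (psi 1) := by
    have h := integrable_one_add_norm (E := ℝ) (μ := volume) (r := 2) (by simp)
    refine h.congr (Eventually.of_forall fun u => ?_)
    simp only [psi, one_mul, Real.norm_eq_abs]
    rw [Real.rpow_neg (by positivity), one_div]
    norm_num
  have hnn : 0 ≤ ∫ u, psi 1 u := integral_nonneg fun u => psi_nonneg one_pos u
  refine ⟨(∫ u, psi 1 u) + 1, by positivity, fun Q hQ => ?_⟩
  have h1 : ∫⁻ u, ENNReal.ofReal (psi Q u) = ∫⁻ u, ENNReal.ofReal (psi 1 u) := by
    have hv := Real.smul_map_volume_mul_left hQ.ne'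
    conv_rhs => rw [← hv]
    rw [lintegral_smul_measure, lintegral_map (measurable_psi 1).ennreal_ofReal
      (measurable_const_mul Q), smul_eq_mul, ← lintegral_const_mul]
    swap
    · exact ((measurable_psi 1).comp (measurable_const_mul Q)).ennreal_ofReal
    refine lintegral_congr fun u => ?_
    rw [← ENNReal.ofReal_mul (abs_nonneg _), psi, psi, abs_mul, abs_of_pos hQ]
    congr 1
    ring
  rw [h1, ← ofReal_integral_eq_lintegral_ofReal hintg
    (Eventually.of_forall fun u => psi_nonneg one_pos u)]
  exact ENNReal.ofReal_le_ofReal (by linarith)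

/-- The sum of `psi Q` over the four wave fronts. -/
def front (Q t r s : ℝ) : ℝ :=
  psi Q (t + r + s) + psi Q (t + r - s) + psi Q (t - r + s) + psi Q (t - r - s)

theorem front_nonneg {Q : ℝ} (hQ : 0 < Q) (t r s : ℝ) : 0 ≤ front Q t r s := by
  have := psi_nonneg hQ
  unfold front
  linarith [this (t + r + s), this (t + r - s), this (t - r + s), this (t - r - s)]

theorem mul_frontSum {Q : ℝ} (hQ : 0 < Q) (t r s : ℝ) :
    Q * frontSum (Q * t) (Q * r) (Q * s) = front Q t r s := by
  have h : ∀ x : ℝ, Q * (1 / (1 + |Q * x|) ^ 2) = psi Q x := fun x => by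
    rw [psi, abs_mul, abs_of_pos hQ]
    ring
  simp only [frontSum, front, ← h]
  ring_nf

theorem measurable_front {X : Type*} [MeasurableSpace X] {Q : ℝ} {t r s : X → ℝ} (ht : Measurable t)
    (hr : Measurable r) (hs : Measurable s) : Measurable fun x => front Q (t x) (r x) (s x) := by
  have := measurable_psi Q
  unfold front
  fun_prop

theorem front_comm (Q t r s : ℝ) : front Q t r s = front Q t s r := by
  unfold front
  ring_nf

/-- Each front is an approximate delta function in r. Substituting its argument u for r turns G(r)
into G(|t - v|) with v = u ∓ s independent of t, so the sum over t can be taken inside the integral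
before `psi Q` is integrated. -/
theorem lintegral_front_le {I : ℝ} (hI0 : 0 < I)
    (hI : ∀ Q : ℝ, 0 < Q → ∫⁻ u, ENNReal.ofReal (psi Q u) ≤ ENNReal.ofReal I) {G : ℝ → ℝ}
    (hG : Measurable G) (hG0 : ∀ r, 0 ≤ G r) {Q : ℝ} (hQ : 0 < Q) (T : Finset ℝ) {X : ℝ}
    (hX : ∀ v, ∑ t ∈ T, G |t - v| ≤ X) (s : ℝ) :
    ∑ t ∈ T, ∫⁻ r in Set.Ioi (0 : ℝ), ENNReal.ofReal (G r * front Q t r s) ≤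
      ENNReal.ofReal (4 * X * I) := by
  have hpm := measurable_psi Q
  have hX0 : 0 ≤ X := (Finset.sum_nonneg fun t _ => hG0 _).trans (hX 0)
  have key : ∀ c : ℝ, ∑ t ∈ T, ∫⁻ r, ENNReal.ofReal (G |r| * psi Q (t + r + c)) ≤
      ENNReal.ofReal (X * I) := by
    intro c
    have h1 : ∀ t ∈ T, ∫⁻ r, ENNReal.ofReal (G |r| * psi Q (t + r + c)) =
        ∫⁻ u, ENNReal.ofReal (G |t - (u - c)|) * ENNReal.ofReal (psi Q u) := by
      intro t _
      rw [← lintegral_sub_right_eq_self (fun r => ENNReal.ofReal (G |r| * psi Q (t + r + c))) (t + c)]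
      refine lintegral_congr fun u => ?_
      rw [← ENNReal.ofReal_mul (hG0 _)]
      have e1 : u - (t + c) = -(t - (u - c)) := by ring
      have e2 : t + (u - (t + c)) + c = u := by ring
      rw [e2, e1, abs_neg]
    rw [Finset.sum_congr rfl h1, ← lintegral_finsetSum' _ fun t _ => by fun_prop]
    simp_rw [← Finset.sum_mul, ← ENNReal.ofReal_sum_of_nonneg (fun t (_ : t ∈ T) => hG0 _)]
    calc _ ≤ ∫⁻ u, ENNReal.ofReal X * ENNReal.ofReal (psi Q u) := by
          refine lintegral_mono fun u => ?_
          exact mul_le_mul_left (ENNReal.ofReal_le_ofReal (hX _)) _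
      _ ≤ _ := by
        rw [lintegral_const_mul _ hpm.ennreal_ofReal, ENNReal.ofReal_mul hX0]
        exact mul_le_mul_right (hI Q hQ) _
  -- The reflection r ↦ -r reduces these two fronts to the previous ones; for this reason the weight
  -- was extended as G |r| to the whole line.
  have key' : ∀ c : ℝ, ∑ t ∈ T, ∫⁻ r, ENNReal.ofReal (G |r| * psi Q (t - r + c)) ≤
      ENNReal.ofReal (X * I) := by
    intro c
    refine le_trans (le_of_eq (Finset.sum_congr rfl fun t _ => ?_)) (key c)
    rw [← lintegral_neg_eq_self]
    refine lintegral_congr fun r => ?_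
    rw [abs_neg, sub_neg_eq_add]
  calc _ ≤ ∑ t ∈ T, ((∫⁻ r, ENNReal.ofReal (G |r| * psi Q (t + r + s))) +
        (∫⁻ r, ENNReal.ofReal (G |r| * psi Q (t + r + -s))) +
        (∫⁻ r, ENNReal.ofReal (G |r| * psi Q (t - r + s))) +
        ∫⁻ r, ENNReal.ofReal (G |r| * psi Q (t - r + -s))) := by
        refine Finset.sum_le_sum fun t _ => ?_
        rw [← lintegral_add_left (by fun_prop), ← lintegral_add_left (by fun_prop),
          ← lintegral_add_left (by fun_prop)]
        refine le_trans ?_ (setLIntegral_le_lintegral (Set.Ioi 0) _)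
        refine le_of_eq (setLIntegral_congr_fun measurableSet_Ioi fun r hr => ?_)
        have p0 := fun u => mul_nonneg (hG0 |r|) (psi_nonneg hQ u)
        rw [← ENNReal.ofReal_add (p0 _) (p0 _), ← ENNReal.ofReal_add (add_nonneg (p0 _) (p0 _)) (p0 _),
          ← ENNReal.ofReal_add (add_nonneg (add_nonneg (p0 _) (p0 _)) (p0 _)) (p0 _), front]
        rw [abs_of_pos (show 0 < r from hr)]
        congr 1
        simp only [← sub_eq_add_neg]
        ring
    _ ≤ ENNReal.ofReal (X * I) + ENNReal.ofReal (X * I) + ENNReal.ofReal (X * I) +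
        ENNReal.ofReal (X * I) := by
        simp only [Finset.sum_add_distrib]
        gcongr
        · exact key s
        · exact key (-s)
        · exact key' s
        · exact key' (-s)
    _ = _ := by
        have h0 : 0 ≤ X * I := by positivity
        rw [← ENNReal.ofReal_add h0 h0, ← ENNReal.ofReal_add (by positivity) h0,
          ← ENNReal.ofReal_add (by positivity) h0]
        congr 1
        ring

/-- The spherical means of the wave kernel are concentrated near the wave fronts. -/
theorem exists_sphere_mean_bound {φ : ℝ → ℝ} (hφ : IsBump φ) (n : ℕ) :
    ∃ C : ℝ, 0 < C ∧ ∀ (j : ℕ) (t : ℝ) (x : EV n) (s : ℝ), 0 < s →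
      ‖∫ θ : Sph n, waveKernel (n + 1) φ j t (x - s • (θ : EV n)) ∂surf n‖ ≤
        C * ((((2 : ℝ) ^ j)⁻¹ + ‖x‖) ^ (-((n : ℝ) / 2)) * s ^ (-((n : ℝ) / 2)) *
          front (2 ^ j) t ‖x‖ s) := by
  obtain ⟨C, hC0, hC⟩ := exists_radKernel_bound n (hφ.isTest n)
  set c : ℝ := ‖((2 * Real.pi : ℝ) ^ (n + 1) : ℂ)⁻¹‖
  refine ⟨c * C + 1, by positivity, fun j t x s hs => ?_⟩
  set Q : ℝ := 2 ^ j with hQd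
  have hQ : 0 < Q := by positivity
  set m : ℝ := (n : ℝ) / 2 with hm
  have hm0 : 0 ≤ m := by positivity
  have hr := norm_nonneg x
  rw [integral_sphere_waveKernel hφ n j t x hs.le, norm_mul, norm_mul, Complex.norm_real,
    Real.norm_eq_abs, abs_of_pos (by positivity)]
  have h1 := hC (Q * t) (Q * ‖x‖) (Q * s) (by positivity) (by positivity)
  have hF := front_nonneg hQ t ‖x‖ s
  have hFS : frontSum (Q * t) (Q * ‖x‖) (Q * s) = front Q t ‖x‖ s / Q := by
    rw [← mul_frontSum hQ]
    field_simp
  rw [hFS] at h1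
  have e1 : (1 + Q * ‖x‖) ^ (-m) = Q ^ (-m) * (Q⁻¹ + ‖x‖) ^ (-m) := by
    rw [← Real.mul_rpow hQ.le (by positivity)]
    congr 1
    field_simp
  have e2 : (1 + Q * s) ^ (-m) ≤ Q ^ (-m) * s ^ (-m) := by
    rw [← Real.mul_rpow hQ.le hs.le]
    exact Real.rpow_le_rpow_of_nonpos (by positivity) (by linarith) (by linarith)
  -- The scaling factor Q^{n+1} meets two decay factors Q^{-n/2}; the Q that is left normalises
  -- `frontSum` to `front`.
  have e3 : Q ^ (n + 1) * (Q ^ (-m) * Q ^ (-m)) = Q := by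
    rw [← Real.rpow_add hQ, ← Real.rpow_natCast, ← Real.rpow_add hQ]
    have : ((n + 1 : ℕ) : ℝ) + (-m + -m) = 1 := by rw [hm]; push_cast; ring
    rw [this, Real.rpow_one]
  have hY : 0 ≤ (Q⁻¹ + ‖x‖) ^ (-m) * s ^ (-m) * front Q t ‖x‖ s := by positivity
  have h0 : 0 ≤ front Q t ‖x‖ s / Q := by positivity
  calc _ ≤ c * (Q ^ (n + 1) * (C * (Q ^ (-m) * (Q⁻¹ + ‖x‖) ^ (-m)) * (Q ^ (-m) * s ^ (-m)) *
        (front Q t ‖x‖ s / Q))) := by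
        rw [e1] at h1
        refine mul_le_mul_of_nonneg_left ?_ (norm_nonneg _)
        refine mul_le_mul_of_nonneg_left (h1.trans ?_) (by positivity)
        refine mul_le_mul_of_nonneg_right ?_ h0
        exact mul_le_mul_of_nonneg_left e2 (by positivity)
    _ = c * C * (((Q⁻¹ + ‖x‖) ^ (-m) * s ^ (-m)) * (Q ^ (n + 1) * (Q ^ (-m) * Q ^ (-m)) *
        (front Q t ‖x‖ s / Q))) := by ring
    _ = c * C * ((Q⁻¹ + ‖x‖) ^ (-m) * s ^ (-m) * front Q t ‖x‖ s) := by
        rw [e3, mul_div_cancel₀ _ hQ.ne']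
    _ ≤ _ := by nlinarith

/-! ### The upper bound: near part, far part and summation in time. -/

open Classical in
/-- The part of `f` on which the wave kernel at `x` is not negligible. -/
def nearCut {n : ℕ} (B : ℝ) (f : EV n → ℂ) (x y : EV n) : ℂ :=
  if ‖y‖ ≤ B ∨ ‖y‖ ≤ 2 * ‖x‖ then f y else 0

/-- Since np/2 = n + α, the weight is w^{-n} (s/w)^α. It is harmless when s ≤ 2r ≤ 2w; when only s ≤
B is known, the focusing factor w^{-α} remains. This is the origin of the exponent α = p s_p. -/
theorem near_weight_le {n : ℕ} {p : ℝ} (hp : 2 ≤ p) {B w r s : ℝ} (hB : 0 ≤ B) (hw : 0 < w)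
    (hrw : r ≤ w) (hs : 0 < s) (hnear : s ≤ B ∨ s ≤ 2 * r) :
    w ^ (-((n : ℝ) / 2 * p)) * (s ^ (-(n : ℝ)) * s ^ ((n : ℝ) / 2 * p)) ≤
      w ^ (-(n : ℝ)) * (2 ^ ((n : ℝ) * (p / 2 - 1)) +
        B ^ ((n : ℝ) * (p / 2 - 1)) * w ^ (-((n : ℝ) * (p / 2 - 1)))) := by
  set α : ℝ := (n : ℝ) * (p / 2 - 1) with hα
  have hα0 : 0 ≤ α := mul_nonneg (Nat.cast_nonneg n) (by linarith)
  have e1 : w ^ (-((n : ℝ) / 2 * p)) = w ^ (-(n : ℝ)) * w ^ (-α) := by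
    rw [← Real.rpow_add hw]
    congr 1
    rw [hα]; ring
  have e2 : s ^ (-(n : ℝ)) * s ^ ((n : ℝ) / 2 * p) = s ^ α := by
    rw [← Real.rpow_add hs]
    congr 1
    rw [hα]; ring
  rw [e1, e2, mul_assoc]
  refine mul_le_mul_of_nonneg_left ?_ (by positivity)
  rcases hnear with h | h
  · have h1 : s ^ α ≤ B ^ α := Real.rpow_le_rpow hs.le h hα0
    have h2 : w ^ (-α) * s ^ α ≤ B ^ α * w ^ (-α) := by
      rw [mul_comm]
      gcongr
    have : (0 : ℝ) ≤ 2 ^ α := by positivity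
    linarith
  · have h1 : s ^ α ≤ (2 * w) ^ α := Real.rpow_le_rpow hs.le (by linarith) hα0
    have h2 : w ^ (-α) * s ^ α ≤ 2 ^ α := by
      calc _ ≤ w ^ (-α) * (2 * w) ^ α := by gcongr
        _ = _ := by
          rw [Real.mul_rpow two_pos.le hw.le, mul_left_comm, ← Real.rpow_add hw, neg_add_cancel,
            Real.rpow_zero, mul_one]
    have : (0 : ℝ) ≤ B ^ α * w ^ (-α) := by positivity
    linarith

/-- The factor ‖y‖^{-n} cancels the polar density, so this is `lintegral_front_le` for a single time
and G = 1, with r and s exchanged. -/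
theorem lintegral_front_norm_le {n : ℕ} {I : ℝ} (hI0 : 0 < I)
    (hI : ∀ Q : ℝ, 0 < Q → ∫⁻ u, ENNReal.ofReal (psi Q u) ≤ ENNReal.ofReal I) {Q : ℝ} (hQ : 0 < Q)
    (t r : ℝ) : ∫⁻ y : EV n, ENNReal.ofReal (‖y‖ ^ (-(n : ℝ)) * front Q t r ‖y‖) ≤
      surf n Set.univ * ENNReal.ofReal (4 * I) := by
  have hm : Measurable fun s : ℝ => ENNReal.ofReal (s ^ (-(n : ℝ)) * front Q t r s) := by
    have : Measurable fun s : ℝ => front Q t r s :=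
      measurable_front measurable_const measurable_const measurable_id
    fun_prop
  rw [lintegral_fun_norm hm]
  gcongr
  have h := lintegral_front_le hI0 hI (G := fun _ => 1) measurable_const (fun _ => zero_le_one) hQ {t}
    (X := 1) (by simp) r
  rw [Finset.sum_singleton, mul_one] at h
  refine le_trans (le_of_eq (setLIntegral_congr_fun measurableSet_Ioi fun s hs => ?_)) h
  have hs : 0 < s := hs
  rw [← ENNReal.ofReal_mul (by positivity), ← mul_assoc, ← Real.rpow_natCast, ← Real.rpow_add hs,
    add_neg_cancel, Real.rpow_zero, front_comm]

/-- Write s^{-n/2} = s^{-n} s^{n/2}. The kernel s^{-n} `front` has bounded mass in y, so Jensen's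
inequality applies to it with the function s^{n/2} |f|, and the resulting weight is that of
`near_weight_le`. -/
theorem exists_near_bound {φ : ℝ → ℝ} (hφ : IsBump φ) (n : ℕ) {p : ℝ} (hp : 2 ≤ p) :
    ∃ C : ℝ, 0 < C ∧ ∀ (j : ℕ) (B : ℝ), 0 ≤ B → ∀ (t : ℝ) (f : EV n → ℂ), IsRadial f →
      AEStronglyMeasurable f → ∀ x : EV n,
      ‖halfWave φ j t (nearCut B f x) x‖ₑ ^ p ≤ ENNReal.ofReal C *
        ∫⁻ y, ENNReal.ofReal ((((2 : ℝ) ^ j)⁻¹ + ‖x‖) ^ (-(n : ℝ)) *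
          (2 ^ ((n : ℝ) * (p / 2 - 1)) + B ^ ((n : ℝ) * (p / 2 - 1)) *
            (((2 : ℝ) ^ j)⁻¹ + ‖x‖) ^ (-((n : ℝ) * (p / 2 - 1)))) *
          front (2 ^ j) t ‖x‖ ‖y‖) * ‖f y‖ₑ ^ p := by
  obtain ⟨C₁, hC₁0, hC₁⟩ := exists_sphere_mean_bound hφ n
  obtain ⟨I, hI0, hI⟩ := exists_lintegral_psi_le
  have hS := surf_univ_pos n
  set S := (surf n).real Set.univ with hSd
  have hSe : surf n Set.univ = ENNReal.ofReal S := by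
    rw [hSd, ofReal_measureReal]
  have hp0 : 0 < p := by linarith
  refine ⟨(C₁ / S) ^ p * (S * (4 * I)) ^ (p - 1), by positivity, fun j B hB t f hf hfm x => ?_⟩
  set Q : ℝ := 2 ^ j with hQd
  have hQ : 0 < Q := by positivity
  set m : ℝ := (n : ℝ) / 2 with hm
  set r := ‖x‖ with hr
  set w := Q⁻¹ + r with hw
  have hw0 : 0 < w := by positivity
  have hmf : Measurable fun s : ℝ => front Q t r s :=
    measurable_front measurable_const measurable_const measurable_id
  have hmf' : Measurable fun y : EV n => front Q t r ‖y‖ :=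
    measurable_front measurable_const measurable_const measurable_norm
  have hF0 : ∀ s, 0 ≤ front Q t r s := fun s => front_nonneg hQ t r s
  have hms : MeasurableSet {y : EV n | ‖y‖ ≤ B ∨ ‖y‖ ≤ 2 * r} :=
    (measurableSet_le measurable_norm measurable_const).union
      (measurableSet_le measurable_norm measurable_const)
  have hcut : nearCut B f x = {y : EV n | ‖y‖ ≤ B ∨ ‖y‖ ≤ 2 * r}.indicator f := by
    ext y
    by_cases h : ‖y‖ ≤ B ∨ ‖y‖ ≤ 2 * ‖x‖ <;> simp [nearCut, Set.indicator, h, hr]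
  have hcm : AEStronglyMeasurable (nearCut B f x) := by
    rw [hcut]
    exact hfm.indicator hms
  have hcr : IsRadial (nearCut B f x) := fun y z hyz => by
    simp only [nearCut, hyz, hf y z hyz]
  have h1 := enorm_halfWave_radial_le (φ := φ) j t hcr hcm x
    (k := fun s => ENNReal.ofReal (C₁ / S * (w ^ (-m) * s ^ (-m) * front Q t r s)))
    (by fun_prop) (fun s hs => by
      rw [hSe, ← ENNReal.ofReal_mul (by have := hF0 s; positivity), ← ofReal_norm]
      refine ENNReal.ofReal_le_ofReal ((hC₁ j t x s hs).trans (le_of_eq ?_))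
      rw [div_mul_eq_mul_div, div_mul_cancel₀ _ hS.ne'])
  set k : EV n → ℝ≥0∞ := fun y => ENNReal.ofReal (‖y‖ ^ (-(n : ℝ)) * front Q t r ‖y‖) with hk
  set g : EV n → ℝ≥0∞ := fun y => ENNReal.ofReal (‖y‖ ^ m) * ‖nearCut B f x y‖ₑ with hg
  have hkm : Measurable k := by fun_prop
  have hgm : AEMeasurable g := AEMeasurable.mul (by fun_prop) hcm.enorm
  have hne : ∀ᵐ y : EV n, y ≠ 0 := compl_mem_ae_iff.2 (measure_singleton 0)
  have h2 : ∫⁻ y, ENNReal.ofReal (C₁ / S * (w ^ (-m) * ‖y‖ ^ (-m) * front Q t r ‖y‖)) *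
      ‖nearCut B f x y‖ₑ = ENNReal.ofReal (C₁ / S * w ^ (-m)) * ∫⁻ y, k y * g y := by
    have hkg : AEMeasurable (fun y => k y * g y) := hkm.aemeasurable.mul hgm
    rw [← lintegral_const_mul'' _ hkg]
    refine lintegral_congr_ae (hne.mono fun y hy => ?_)
    have hy0 : 0 < ‖y‖ := norm_pos_iff.2 hy
    have := hF0 ‖y‖
    simp only [hk, hg]
    rw [← mul_assoc (ENNReal.ofReal (‖y‖ ^ (-(n : ℝ)) * _)), ← mul_assoc (ENNReal.ofReal _),
      ← ENNReal.ofReal_mul (by positivity), ← ENNReal.ofReal_mul (by positivity)]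
    congr 2
    have e : ‖y‖ ^ (-m) = ‖y‖ ^ (-(n : ℝ)) * ‖y‖ ^ m := by
      rw [← Real.rpow_add hy0]
      congr 1
      rw [hm]; ring
    rw [e]
    ring
  rw [h2] at h1
  have h3 := lintegral_mul_rpow_le (by linarith : 1 < p) hkm.aemeasurable hgm (μ := volume)
  have h4 : ∫⁻ y, k y ≤ ENNReal.ofReal (S * (4 * I)) := by
    rw [ENNReal.ofReal_mul hS.le, ← hSe]
    exact lintegral_front_norm_le hI0 hI hQ t r
  calc ‖halfWave φ j t (nearCut B f x) x‖ₑ ^ p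
      ≤ (ENNReal.ofReal (C₁ / S * w ^ (-m)) * ∫⁻ y, k y * g y) ^ p := by gcongr
    _ = ENNReal.ofReal ((C₁ / S * w ^ (-m)) ^ p) * (∫⁻ y, k y * g y) ^ p := by
      rw [ENNReal.mul_rpow_of_nonneg _ _ hp0.le,
        ENNReal.ofReal_rpow_of_nonneg (by positivity) hp0.le]
    _ ≤ ENNReal.ofReal ((C₁ / S * w ^ (-m)) ^ p) * (ENNReal.ofReal ((S * (4 * I)) ^ (p - 1)) *
        ∫⁻ y, k y * g y ^ p) := by
      refine mul_le_mul_right (h3.trans (mul_le_mul_left ?_ _)) _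
      rw [← ENNReal.ofReal_rpow_of_nonneg (by positivity) (by linarith)]
      exact ENNReal.rpow_le_rpow h4 (by linarith)
    _ = ENNReal.ofReal ((C₁ / S) ^ p * (S * (4 * I)) ^ (p - 1)) *
        ∫⁻ y, ENNReal.ofReal (w ^ (-(m * p))) * (k y * g y ^ p) := by
      have hkg : AEMeasurable (fun y => k y * g y ^ p) := hkm.aemeasurable.mul (hgm.pow_const _)
      rw [lintegral_const_mul'' _ hkg, ← mul_assoc (ENNReal.ofReal _), ← mul_assoc (ENNReal.ofReal _),
        ← ENNReal.ofReal_mul (by positivity), ← ENNReal.ofReal_mul (by positivity)]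
      congr 2
      rw [Real.mul_rpow (by positivity) (by positivity), ← Real.rpow_mul hw0.le, neg_mul]
      ring
    _ ≤ _ := by
      refine mul_le_mul_right (lintegral_mono_ae (hne.mono fun y hy => ?_)) _
      have hy0 : 0 < ‖y‖ := norm_pos_iff.2 hy
      have hFy := hF0 ‖y‖
      simp only [hk, hg, nearCut]
      split_ifs with hnear
      swap
      · simp [ENNReal.zero_rpow_of_pos hp0]
      rw [ENNReal.mul_rpow_of_nonneg _ _ hp0.le, ENNReal.ofReal_rpow_of_nonneg (by positivity) hp0.le,
        ← mul_assoc, ← mul_assoc, ← ENNReal.ofReal_mul (by positivity),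
        ← ENNReal.ofReal_mul (by positivity), ← Real.rpow_mul hy0.le]
      refine mul_le_mul_left (ENNReal.ofReal_le_ofReal ?_) _
      have := near_weight_le (n := n) hp hB hw0 (r := r) (by rw [hw]; linarith [inv_pos.2 hQ]) hy0 hnear
      calc _ = w ^ (-(m * p)) * (‖y‖ ^ (-(n : ℝ)) * ‖y‖ ^ (m * p)) * front Q t r ‖y‖ := by ring
        _ ≤ _ := mul_le_mul_of_nonneg_right this hFy

/-- By Tonelli the x-integral is taken first. In polar coordinates r^n (Q⁻¹ + r)^{-n} ≤ 1, which
leaves exactly the one-dimensional sum of `lintegral_front_le`, uniformly in y. -/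
theorem sum_lintegral_front_le {n : ℕ} {I : ℝ} (hI0 : 0 < I)
    (hI : ∀ Q : ℝ, 0 < Q → ∫⁻ u, ENNReal.ofReal (psi Q u) ≤ ENNReal.ofReal I) {G : ℝ → ℝ}
    (hG : Measurable G) (hG0 : ∀ r, 0 ≤ G r) {Q : ℝ} (hQ : 0 < Q) (T : Finset ℝ) {X : ℝ}
    (hX : ∀ v, ∑ t ∈ T, G |t - v| ≤ X) {F : EV n → ℝ≥0∞} (hF : AEMeasurable F) :
    ∑ t ∈ T, ∫⁻ x : EV n, ∫⁻ y : EV n, ENNReal.ofReal ((Q⁻¹ + ‖x‖) ^ (-(n : ℝ)) * G ‖x‖ *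
      front Q t ‖x‖ ‖y‖) * F y ≤
      surf n Set.univ * ENNReal.ofReal (4 * X * I) * ∫⁻ y, F y := by
  have hmeas : ∀ t : ℝ, Measurable fun z : EV n × EV n => ENNReal.ofReal
      ((Q⁻¹ + ‖z.1‖) ^ (-(n : ℝ)) * G ‖z.1‖ * front Q t ‖z.1‖ ‖z.2‖) := fun t => by
    have : Measurable fun z : EV n × EV n => front Q t ‖z.1‖ ‖z.2‖ :=
      measurable_front measurable_const (by fun_prop) (by fun_prop)
    fun_prop
  have hmeas1 : ∀ (t : ℝ) (y : EV n), Measurable fun x : EV n => ENNReal.ofReal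
      ((Q⁻¹ + ‖x‖) ^ (-(n : ℝ)) * G ‖x‖ * front Q t ‖x‖ ‖y‖) := fun t y => by
    have : Measurable fun x : EV n => front Q t ‖x‖ ‖y‖ :=
      measurable_front measurable_const (by fun_prop) (by fun_prop)
    fun_prop
  have h1 : ∀ t ∈ T, ∫⁻ x : EV n, ∫⁻ y : EV n, ENNReal.ofReal ((Q⁻¹ + ‖x‖) ^ (-(n : ℝ)) * G ‖x‖ *
      front Q t ‖x‖ ‖y‖) * F y = ∫⁻ y : EV n, (∫⁻ x : EV n, ENNReal.ofReal
      ((Q⁻¹ + ‖x‖) ^ (-(n : ℝ)) * G ‖x‖ * front Q t ‖x‖ ‖y‖)) * F y := by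
    intro t _
    have hm : AEMeasurable (Function.uncurry fun x y : EV n => ENNReal.ofReal
        ((Q⁻¹ + ‖x‖) ^ (-(n : ℝ)) * G ‖x‖ * front Q t ‖x‖ ‖y‖) * F y) (volume.prod volume) :=
      (hmeas t).aemeasurable.mul hF.comp_snd
    rw [lintegral_lintegral_swap hm]
    exact lintegral_congr fun y => lintegral_mul_const _ (hmeas1 t y)
  have h0 : ∀ t ∈ T, AEMeasurable fun y : EV n => (∫⁻ x : EV n, ENNReal.ofReal
      ((Q⁻¹ + ‖x‖) ^ (-(n : ℝ)) * G ‖x‖ * front Q t ‖x‖ ‖y‖)) * F y := fun t _ =>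
    ((hmeas t).lintegral_prod_left').aemeasurable.mul hF
  rw [Finset.sum_congr rfl h1, ← lintegral_finsetSum' _ h0]
  simp_rw [← Finset.sum_mul]
  rw [← lintegral_const_mul'' _ hF]
  refine lintegral_mono fun y => mul_le_mul_left ?_ _
  refine le_trans ?_ (mul_le_mul_right (lintegral_front_le hI0 hI hG hG0 hQ T hX ‖y‖) _)
  rw [Finset.mul_sum]
  refine Finset.sum_le_sum fun t _ => ?_
  have hm : Measurable fun r : ℝ => ENNReal.ofReal ((Q⁻¹ + r) ^ (-(n : ℝ)) * G r *
      front Q t r ‖y‖) := by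
    have : Measurable fun r : ℝ => front Q t r ‖y‖ :=
      measurable_front measurable_const measurable_id measurable_const
    fun_prop
  rw [lintegral_fun_norm hm]
  refine mul_le_mul_right (setLIntegral_mono' measurableSet_Ioi fun r hr => ?_) _
  have hr : 0 < r := hr
  have hw : 0 < Q⁻¹ + r := by positivity
  rw [← ENNReal.ofReal_mul (by positivity)]
  refine ENNReal.ofReal_le_ofReal ?_
  have h2 : r ^ n * (Q⁻¹ + r) ^ (-(n : ℝ)) ≤ 1 := by
    rw [Real.rpow_neg hw.le, Real.rpow_natCast, ← div_eq_mul_inv, div_le_one (by positivity)]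
    exact pow_le_pow_left₀ hr.le (by linarith [inv_pos.2 hQ]) n
  have h3 : 0 ≤ G r * front Q t r ‖y‖ := mul_nonneg (hG0 r) (front_nonneg hQ _ _ _)
  calc _ = r ^ n * (Q⁻¹ + r) ^ (-(n : ℝ)) * (G r * front Q t r ‖y‖) := by ring
    _ ≤ 1 * (G r * front Q t r ‖y‖) := mul_le_mul_of_nonneg_right h2 h3
    _ = _ := one_mul _

/-- Young's inequality. -/
theorem lintegral_conv_rpow_le {n : ℕ} {p : ℝ} (hp : 1 < p) {G F : EV n → ℝ≥0∞} (hG : Measurable G)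
    (hF : AEMeasurable F) :
    ∫⁻ x : EV n, (∫⁻ y : EV n, G (x - y) * F y) ^ p ≤ (∫⁻ z, G z) ^ p * ∫⁻ y, F y ^ p := by
  have hGm : Measurable fun z : EV n × EV n => G (z.1 - z.2) :=
    hG.comp (measurable_fst.sub measurable_snd)
  calc _ ≤ ∫⁻ x : EV n, (∫⁻ z, G z) ^ (p - 1) * ∫⁻ y, G (x - y) * F y ^ p := by
        refine lintegral_mono fun x => ?_
        have h := lintegral_mul_rpow_le (μ := volume) hp (k := fun y : EV n => G (x - y))
          (hG.comp (measurable_const.sub measurable_id)).aemeasurable hF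
        rwa [lintegral_sub_left_eq_self G x] at h
    _ = (∫⁻ z, G z) ^ (p - 1) * ∫⁻ y, (∫⁻ z, G z) * F y ^ p := by
        rw [lintegral_const_mul'']
        · rw [lintegral_lintegral_swap
            (hGm.aemeasurable.mul ((hF.pow_const p).comp_snd))]
          congr 1
          refine lintegral_congr fun y => ?_
          have hGy : Measurable fun x : EV n => G (x - y) :=
            hG.comp (measurable_id.sub measurable_const)
          rw [lintegral_mul_const _ hGy, lintegral_sub_right_eq_self G y]
        · exact (hGm.aemeasurable.mul ((hF.pow_const p).comp_snd)).lintegral_prod_right'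
    _ = _ := by
        rw [lintegral_const_mul'' _ (hF.pow_const p), ← mul_assoc]
        congr 1
        nth_rw 2 [← ENNReal.rpow_one (∫⁻ z, G z)]
        rw [← ENNReal.rpow_add_of_nonneg _ _ (by linarith) (by norm_num), sub_add_cancel]

/-- For t in [1, 2] the decay in the radius becomes, after the powers of Q cancel, arbitrary decay
in |z| alone. Since |z| ≥ 2^{jη}/2, sufficiently many powers of |z| beat the prefactor Q^{n+1}, and
n + 2 further powers give integrability. -/
theorem exists_far_bound {φ : ℝ → ℝ} (hφ : IsBump φ) (n : ℕ) {η : ℝ} (hη : 0 < η) :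
    ∃ C : ℝ, 0 < C ∧ ∀ (j : ℕ) (t : ℝ), t ∈ Set.Icc (1 : ℝ) 2 →
      ∫⁻ z : EV n, (Set.indicator {z : EV n | (2 : ℝ) ^ ((j : ℝ) * η) / 2 ≤ ‖z‖}
        (fun z => ‖waveKernel (n + 1) φ j t z‖ₑ) z) ≤ ENNReal.ofReal C := by
  obtain ⟨L', hL'⟩ := exists_nat_ge ((n + 1 : ℝ) / η)
  -- `L` powers of |z| beat the prefactor. This form makes L + n + 2 = 2(L' + n + 1) even, as
  -- `exists_ptKernel_radius_decay` requires.
  set L := 2 * L' + n with hLd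
  have hL : (n + 1 : ℝ) ≤ η * L := by
    rw [div_le_iff₀ hη] at hL'
    have : (L : ℝ) = 2 * L' + n := by rw [hLd]; push_cast; ring
    rw [this]
    have h1 : (0 : ℝ) ≤ L' := Nat.cast_nonneg _
    have h2 : (0 : ℝ) ≤ n := Nat.cast_nonneg _
    nlinarith [mul_nonneg h1 hη.le, mul_nonneg h2 hη.le]
  obtain ⟨C, hC0, hC⟩ := exists_ptKernel_radius_decay n (L' + n + 1) (hφ.isTest n)
  set c : ℝ := ‖((2 * Real.pi : ℝ) ^ (n + 1) : ℂ)⁻¹‖ with hc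
  set D : ℝ := c * (C * 3 ^ (2 * (L' + n + 1)) * 2 ^ L * 3 ^ (n + 2)) with hD
  have hD0 : 0 ≤ D := by positivity
  have hfin := finite_integral_one_add_norm (E := EV n) (μ := volume) (r := (n + 2 : ℕ))
    (by simp)
  set J := ∫⁻ z : EV n, ENNReal.ofReal ((1 + ‖z‖) ^ (-((n + 2 : ℕ) : ℝ))) with hJ
  refine ⟨D * J.toReal + 1, by positivity, fun j t ht => ?_⟩
  set Q : ℝ := 2 ^ j with hQd
  have hQ : 0 < Q := by positivity
  have hQ1 : 1 ≤ Q := one_le_pow₀ (by norm_num)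
  set B : ℝ := (2 : ℝ) ^ ((j : ℝ) * η) with hB
  have hB1 : 1 ≤ B := Real.one_le_rpow (by norm_num) (by positivity)
  have hQB : Q ^ (n + 1) ≤ B ^ L := by
    rw [hQd, hB, ← Real.rpow_natCast ((2 : ℝ) ^ ((j : ℝ) * η)), ← Real.rpow_mul two_pos.le,
      ← pow_mul, ← Real.rpow_natCast]
    refine Real.rpow_le_rpow_of_exponent_le (by norm_num) ?_
    push_cast
    have : (0 : ℝ) ≤ j := Nat.cast_nonneg _
    nlinarith
  have hpt : ∀ z : EV n, B / 2 ≤ ‖z‖ → ‖waveKernel (n + 1) φ j t z‖ ≤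
      D * (1 + ‖z‖) ^ (-((n + 2 : ℕ) : ℝ)) := by
    intro z hz
    set r := ‖z‖
    have hr : 0 < r := by linarith
    have h1 := hC (Q * t) (Q * r) (by positivity)
    rw [waveKernel_eq hφ, norm_mul, norm_mul, Complex.norm_real, Real.norm_eq_abs,
      abs_of_pos (by positivity), Real.rpow_neg (by positivity), Real.rpow_natCast]
    set P := ‖ptKernel n 0 (fun ρ => (φ ρ : ℂ) * (ρ : ℂ) ^ n) (Q * t) (Q * r)‖
    have h2 : 1 + |Q * t| ≤ 3 * Q := by
      rw [abs_of_pos (mul_pos hQ (by linarith [ht.1]))]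
      nlinarith [ht.2]
    have h3 : r ^ (2 * (L' + n + 1)) * P ≤ C * 3 ^ (2 * (L' + n + 1)) := by
      have h4 : (Q * r) ^ (2 * (L' + n + 1)) * P ≤ C * (3 * Q) ^ (2 * (L' + n + 1)) :=
        h1.trans (by gcongr)
      rw [mul_pow, mul_pow] at h4
      refine le_of_mul_le_mul_left ?_ (pow_pos hQ (2 * (L' + n + 1)))
      linarith
    have h5 : r ^ (2 * (L' + n + 1)) = r ^ L * r ^ (n + 2) := by
      rw [← pow_add]
      congr 1
      omega
    have h6 : Q ^ (n + 1) ≤ 2 ^ L * r ^ L := by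
      rw [← mul_pow]
      exact hQB.trans (pow_le_pow_left₀ (by linarith) (by linarith) L)
    have h7 : (1 + r) ^ (n + 2) ≤ 3 ^ (n + 2) * r ^ (n + 2) := by
      rw [← mul_pow]
      exact pow_le_pow_left₀ (by positivity) (by linarith) _
    have hP0 : 0 ≤ P := norm_nonneg _
    rw [← div_eq_mul_inv, le_div_iff₀ (by positivity)]
    calc c * (Q ^ (n + 1) * P) * (1 + r) ^ (n + 2)
        ≤ c * ((2 ^ L * r ^ L) * P) * (3 ^ (n + 2) * r ^ (n + 2)) := by gcongr
      _ = c * (2 ^ L * 3 ^ (n + 2) * (r ^ (2 * (L' + n + 1)) * P)) := by rw [h5]; ring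
      _ ≤ c * (2 ^ L * 3 ^ (n + 2) * (C * 3 ^ (2 * (L' + n + 1)))) := by gcongr
      _ = D := by rw [hD]; ring
  calc _ ≤ ∫⁻ z : EV n, ENNReal.ofReal D * ENNReal.ofReal ((1 + ‖z‖) ^ (-((n + 2 : ℕ) : ℝ))) := by
        refine lintegral_mono fun z => ?_
        by_cases hz : B / 2 ≤ ‖z‖
        swap
        · simp [Set.indicator, hz]
        rw [Set.indicator_of_mem (show z ∈ {z : EV n | B / 2 ≤ ‖z‖} from hz)]
        rw [← ENNReal.ofReal_mul hD0, ← ofReal_norm]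
        exact ENNReal.ofReal_le_ofReal (hpt z hz)
    _ = ENNReal.ofReal D * J := by
        rw [lintegral_const_mul]
        fun_prop
    _ = ENNReal.ofReal (D * J.toReal) := by
        rw [ENNReal.ofReal_mul hD0, ENNReal.ofReal_toReal hfin.ne]
    _ ≤ _ := ENNReal.ofReal_le_ofReal (by linarith)

/-- If |y| > B and |y| > 2|x|, then |x - y| ≥ |y|/2 > B/2, so the discarded part of f meets only the
tail of the kernel. -/
theorem enorm_halfWave_le_near_add_far {φ : ℝ → ℝ} {n : ℕ} (B : ℝ) (j : ℕ) (t : ℝ) (f : EV n → ℂ)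
    (x : EV n) :
    ‖halfWave φ j t f x‖ₑ ≤ ‖halfWave φ j t (nearCut B f x) x‖ₑ +
      ∫⁻ y, {z : EV n | B / 2 ≤ ‖z‖}.indicator (fun z => ‖waveKernel (n + 1) φ j t z‖ₑ) (x - y) *
        ‖f y‖ₑ := by
  set A : Set (EV n) := {y | ‖y‖ ≤ B ∨ ‖y‖ ≤ 2 * ‖x‖} with hA
  have hms : MeasurableSet A :=
    (measurableSet_le measurable_norm measurable_const).union
      (measurableSet_le measurable_norm measurable_const)
  by_cases hintg : Integrable fun y => waveKernel (n + 1) φ j t (x - y) * f y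
  swap
  · rw [halfWave, integral_undef hintg]
    simp
  have h1 : halfWave φ j t (nearCut B f x) x =
      ∫ y in A, waveKernel (n + 1) φ j t (x - y) * f y := by
    rw [halfWave, ← integral_indicator hms]
    refine integral_congr_ae (Eventually.of_forall fun y => ?_)
    by_cases h : ‖y‖ ≤ B ∨ ‖y‖ ≤ 2 * ‖x‖ <;> simp [nearCut, Set.indicator, hA, h]
  rw [h1, halfWave, ← integral_add_compl hms hintg]
  refine (enorm_add_le _ _).trans (add_le_add_right ((enorm_integral_le_lintegral_enorm _).trans ?_) _)
  rw [← lintegral_indicator hms.compl]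
  refine lintegral_mono fun y => ?_
  by_cases hy : y ∈ A
  · simp [hy]
  have hxy : x - y ∈ {z : EV n | B / 2 ≤ ‖z‖} := by
    simp only [hA, Set.mem_ofPred_eq, not_or, not_le] at hy
    have := norm_sub_norm_le y x
    rw [norm_sub_rev] at this
    simp only [Set.mem_ofPred_eq]
    linarith [hy.1, hy.2]
  rw [Set.indicator_of_mem (show y ∈ Aᶜ from hy), Set.indicator_of_mem hxy, enorm_mul]

/-- A single X bounds both the number of times, which governs the far part, and the weighted count,
which governs the near part. The cut at B = 2^{jη} costs only B^α. -/
theorem exists_sum_lintegral_halfWave_le {φ : ℝ → ℝ} (hφ : IsBump φ) (n : ℕ) {p η : ℝ} (hp : 2 ≤ p)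
    (hη : 0 < η) : ∃ C : ℝ, 0 < C ∧ ∀ (j : ℕ) (T : Finset ℝ) (X : ℝ),
      (∀ t ∈ T, t ∈ Set.Icc (1 : ℝ) 2) → T.card ≤ X →
      (∀ v, ∑ t ∈ T, (((2 : ℝ) ^ j)⁻¹ + |t - v|) ^ (-((n : ℝ) * (p / 2 - 1))) ≤ X) →
      ∀ f : EV n → ℂ, IsRadial f → AEStronglyMeasurable f →
      ∑ t ∈ T, ∫⁻ x, ‖halfWave φ j t f x‖ₑ ^ p ≤
        ENNReal.ofReal (C * (2 ^ ((j : ℝ) * η)) ^ ((n : ℝ) * (p / 2 - 1)) * X) *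
          ∫⁻ x, ‖f x‖ₑ ^ p := by
  obtain ⟨C₁, hC₁0, hC₁⟩ := exists_near_bound hφ n hp
  obtain ⟨C₂, hC₂0, hC₂⟩ := exists_far_bound hφ n hη
  obtain ⟨I, hI0, hI⟩ := exists_lintegral_psi_le
  have hS := surf_univ_pos n
  set S := (surf n).real Set.univ with hSd
  have hSe : surf n Set.univ = ENNReal.ofReal S := by
    rw [hSd, ofReal_measureReal]
  have hp0 : 0 < p := by linarith
  set α : ℝ := (n : ℝ) * (p / 2 - 1) with hα
  have hα0 : 0 ≤ α := mul_nonneg (Nat.cast_nonneg n) (by linarith)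
  refine ⟨2 ^ (p - 1) * (C₁ * (S * (4 * (2 ^ α + 1) * I)) + C₂ ^ p), by positivity,
    fun j T X hT hcard hX f hf hfm => ?_⟩
  set Q : ℝ := 2 ^ j with hQd
  have hQ : 0 < Q := by positivity
  set B : ℝ := (2 : ℝ) ^ ((j : ℝ) * η) with hBd
  have hB1 : 1 ≤ B := Real.one_le_rpow (by norm_num) (by positivity)
  have hBα : 1 ≤ B ^ α := Real.one_le_rpow hB1 hα0
  have hX0 : 0 ≤ X := (Nat.cast_nonneg _).trans hcard
  set G : ℝ → ℝ := fun r => 2 ^ α + B ^ α * (Q⁻¹ + |r|) ^ (-α) with hG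
  have hGm : Measurable G := by fun_prop
  have hG0 : ∀ r, 0 ≤ G r := fun r => by positivity
  have hGX : ∀ v, ∑ t ∈ T, G |t - v| ≤ (2 ^ α + 1) * (B ^ α * X) := fun v => by
    simp only [hG, abs_abs, Finset.sum_add_distrib, Finset.sum_const, nsmul_eq_mul, ← Finset.mul_sum]
    have h1 : (T.card : ℝ) * 2 ^ α ≤ B ^ α * X * 2 ^ α := by
      gcongr
      nlinarith
    have h2 := mul_le_mul_of_nonneg_left (hX v) (by positivity : 0 ≤ B ^ α)
    linarith
  have hF : AEMeasurable fun y : EV n => ‖f y‖ₑ ^ p := hfm.enorm.pow_const p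
  set N : ℝ → EV n → ℝ≥0∞ := fun t x => ∫⁻ y, ENNReal.ofReal ((Q⁻¹ + ‖x‖) ^ (-(n : ℝ)) * G ‖x‖ *
    front Q t ‖x‖ ‖y‖) * ‖f y‖ₑ ^ p with hN
  have hNm : ∀ t, AEMeasurable (N t) := fun t => by
    have hm : Measurable fun z : EV n × EV n => ENNReal.ofReal
        ((Q⁻¹ + ‖z.1‖) ^ (-(n : ℝ)) * G ‖z.1‖ * front Q t ‖z.1‖ ‖z.2‖) := by
      have : Measurable fun z : EV n × EV n => front Q t ‖z.1‖ ‖z.2‖ :=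
        measurable_front measurable_const (by fun_prop) (by fun_prop)
      fun_prop
    exact (hm.aemeasurable.mul hF.comp_snd).lintegral_prod_right'
  set K : ℝ → EV n → ℝ≥0∞ := fun t => {z : EV n | B / 2 ≤ ‖z‖}.indicator
    (fun z => ‖waveKernel (n + 1) φ j t z‖ₑ) with hK
  have hKm : ∀ t, Measurable (K t) := fun t =>
    ((continuous_waveKernel hφ n j t).measurable.enorm).indicator
      (measurableSet_le measurable_const measurable_norm)
  have hone : ∀ t ∈ T, ∫⁻ x, ‖halfWave φ j t f x‖ₑ ^ p ≤ 2 ^ (p - 1) *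
      (ENNReal.ofReal C₁ * ∫⁻ x, N t x) +
        2 ^ (p - 1) * (ENNReal.ofReal (C₂ ^ p) * ∫⁻ x, ‖f x‖ₑ ^ p) := by
    intro t ht
    have hfar := lintegral_conv_rpow_le (n := n) (by linarith : 1 < p) (hKm t) hfm.enorm
    calc _ ≤ ∫⁻ x, 2 ^ (p - 1) * (ENNReal.ofReal C₁ * N t x + (∫⁻ y, K t (x - y) * ‖f y‖ₑ) ^ p) := by
          refine lintegral_mono fun x => ?_
          refine (ENNReal.rpow_le_rpow (enorm_halfWave_le_near_add_far B j t f x) hp0.le).trans ?_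
          refine (ENNReal.rpow_add_le_mul_rpow_add_rpow _ _ (by linarith)).trans ?_
          gcongr
          have := hC₁ j B (by linarith) t f hf hfm x
          simpa only [hN, hG, abs_norm] using this
      _ = 2 ^ (p - 1) * (ENNReal.ofReal C₁ * ∫⁻ x, N t x) +
          2 ^ (p - 1) * ∫⁻ x, (∫⁻ y, K t (x - y) * ‖f y‖ₑ) ^ p := by
          rw [lintegral_const_mul' _ _ (by finiteness), lintegral_add_left' ((hNm t).const_mul _),
            lintegral_const_mul'' _ (hNm t), mul_add]
      _ ≤ _ := by
          gcongr
          refine hfar.trans ?_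
          gcongr
          rw [← ENNReal.ofReal_rpow_of_nonneg hC₂0.le hp0.le]
          exact ENNReal.rpow_le_rpow (hC₂ j t (hT t ht)) hp0.le
  calc _ ≤ ∑ t ∈ T, (2 ^ (p - 1) * (ENNReal.ofReal C₁ * ∫⁻ x, N t x) +
        2 ^ (p - 1) * (ENNReal.ofReal (C₂ ^ p) * ∫⁻ x, ‖f x‖ₑ ^ p)) := Finset.sum_le_sum hone
    _ = 2 ^ (p - 1) * (ENNReal.ofReal C₁ * ∑ t ∈ T, ∫⁻ x, N t x) +
        T.card * (2 ^ (p - 1) * (ENNReal.ofReal (C₂ ^ p) * ∫⁻ x, ‖f x‖ₑ ^ p)) := by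
        rw [Finset.sum_add_distrib, Finset.sum_const, nsmul_eq_mul, Finset.mul_sum, Finset.mul_sum]
    _ ≤ 2 ^ (p - 1) * (ENNReal.ofReal C₁ * (ENNReal.ofReal S *
        ENNReal.ofReal (4 * ((2 ^ α + 1) * (B ^ α * X)) * I) * ∫⁻ x, ‖f x‖ₑ ^ p)) +
        ENNReal.ofReal (B ^ α * X) * (2 ^ (p - 1) * (ENNReal.ofReal (C₂ ^ p) *
          ∫⁻ x, ‖f x‖ₑ ^ p)) := by
        gcongr
        · rw [← hSe]
          exact sum_lintegral_front_le hI0 hI hGm hG0 hQ T hGX hF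
        · rw [← ENNReal.ofReal_natCast]
          refine ENNReal.ofReal_le_ofReal ?_
          nlinarith
    _ = _ := by
        have h2 : (2 : ℝ≥0∞) ^ (p - 1) = ENNReal.ofReal (2 ^ (p - 1)) := by
          rw [← ENNReal.ofReal_rpow_of_nonneg two_pos.le (by linarith), ENNReal.ofReal_ofNat]
        rw [h2]
        simp only [← mul_assoc]
        rw [← ENNReal.ofReal_mul (by positivity), ← ENNReal.ofReal_mul (by positivity),
          ← ENNReal.ofReal_mul (by positivity), ← ENNReal.ofReal_mul (by positivity),
          ← ENNReal.ofReal_mul (by positivity), ← add_mul,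
          ← ENNReal.ofReal_add (by positivity) (by positivity)]
        congr 2
        ring

/-- Absorbs the number of dyadic scales in `sum_rpow_le_supCov` into the ε-loss. -/
theorem exists_add_one_le_two_rpow {γ : ℝ} (hγ : 0 < γ) :
    ∃ C : ℝ, 0 < C ∧ ∀ j : ℕ, (j : ℝ) + 1 ≤ C * 2 ^ ((j : ℝ) * γ) := by
  have hl : 0 < Real.log 2 := Real.log_pos (by norm_num)
  have hc : 0 < γ * Real.log 2 := by positivity
  refine ⟨1 + 1 / (γ * Real.log 2), by positivity, fun j => ?_⟩
  have h := Real.add_one_le_exp (j * (γ * Real.log 2))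
  rw [Real.rpow_def_of_pos two_pos, show Real.log 2 * (j * γ) = j * (γ * Real.log 2) by ring]
  calc (j : ℝ) + 1 ≤ (1 + 1 / (γ * Real.log 2)) * (j * (γ * Real.log 2) + 1) := by
        have : 1 / (γ * Real.log 2) * (j * (γ * Real.log 2)) = j := by field_simp
        have h0 : (0 : ℝ) ≤ j * (γ * Real.log 2) := by positivity
        have h1 : 0 < 1 / (γ * Real.log 2) := by positivity
        nlinarith
    _ ≤ _ := by gcongr

theorem eLpNorm_ofReal_rpow {n : ℕ} {p : ℝ} (hp : 0 < p) (f : EV n → ℂ) :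
    eLpNorm f (ENNReal.ofReal p) volume ^ p = ∫⁻ x, ‖f x‖ₑ ^ p := by
  rw [eLpNorm_eq_lintegral_rpow_enorm_toReal (by simpa using hp) (by finiteness),
    ENNReal.toReal_ofReal hp.le, ← ENNReal.rpow_mul, one_div_mul_cancel hp.ne', ENNReal.rpow_one]

theorem mul_sExp {n : ℕ} {p : ℝ} (hp : p ≠ 0) : p * sExp (n + 1) p = n * (p / 2 - 1) := by
  rw [sExp]
  push_cast
  field_simp
  ring

theorem waveSum_eq {n : ℕ} (φ : ℝ → ℝ) {p : ℝ} (hp : 0 < p) (j : ℕ) (T : Finset ℝ) (f : EV n → ℂ) :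
    waveSum φ p j (T : Set ℝ) f = (∑ t ∈ T, ∫⁻ x, ‖halfWave φ j t f x‖ₑ ^ p) ^ (1 / p) := by
  rw [waveSum, Finset.tsum_subtype' T fun t => eLpNorm (halfWave φ j t f) (ENNReal.ofReal p) volume ^ p]
  simp_rw [eLpNorm_ofReal_rpow hp]

theorem exists_waveSum_le {φ : ℝ → ℝ} (hφ : IsBump φ) (n : ℕ) {E : Set ℝ} (hE : E ⊆ Set.Icc 1 2)
    {p : ℝ} (hp : 2 ≤ p) {ε : ℝ} (hε : 0 < ε) : ∃ C : ℝ, 0 < C ∧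
      ∀ j : ℕ, ∀ S : Set ℝ, IsDiscretization E ((2 : ℝ) ^ j)⁻¹ S →
      ∀ f : EV n → ℂ, IsRadial f → AEStronglyMeasurable f →
        waveSum φ p j S f ≤ ENNReal.ofReal (C * (2 : ℝ) ^ ((j : ℝ) *
            (1 / p * legendreAssouad E (p * sExp (n + 1) p) + ε))) *
          eLpNorm f (ENNReal.ofReal p) volume := by
  have hp0 : 0 < p := by linarith
  rw [mul_sExp hp0.ne']
  set α : ℝ := (n : ℝ) * (p / 2 - 1) with hα
  have hα0 : 0 ≤ α := mul_nonneg (Nat.cast_nonneg n) (by linarith)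
  -- For empty E the discretization is empty and the sum is 0, whatever value `legendreAssouad`
  -- takes.
  rcases E.eq_empty_or_nonempty with rfl | hne
  · refine ⟨1, one_pos, fun j S hS f _ _ => ?_⟩
    have hS0 : S = ((∅ : Finset ℝ) : Set ℝ) := by
      rw [Finset.coe_empty]
      exact Set.subset_empty_iff.1 hS.prop.1
    rw [hS0, waveSum_eq φ hp0, Finset.sum_empty, ENNReal.zero_rpow_of_pos (by positivity)]
    exact zero_le
  set ν := legendreAssouad E α
  -- Three losses of 2^{jγ} occur: the cut at B, the factor j + 1, and the limsup. The p-th root of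
  -- their product is 2^{jε}.
  set γ : ℝ := p * ε / 3 with hγ
  have hγ0 : 0 < γ := by positivity
  -- Dividing by α + 1 ensures ηα ≤ γ even when α = 0.
  set η : ℝ := γ / (α + 1) with hη
  have hη0 : 0 < η := by positivity
  have hηα : η * α ≤ γ := by
    rw [hη, div_mul_eq_mul_div, div_le_iff₀ (by positivity)]
    nlinarith
  obtain ⟨C₁, hC₁0, hC₁⟩ := exists_sum_lintegral_halfWave_le hφ n hp hη0
  obtain ⟨C₂, hC₂0, hC₂⟩ := exists_supCov_le hE hne hα0 hγ0
  obtain ⟨C₃, hC₃0, hC₃⟩ := exists_add_one_le_two_rpow hγ0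
  set D : ℝ := C₁ * ((2 + 4 * 2 ^ α) * C₃ * C₂) with hD
  have hD0 : 0 < D := by positivity
  refine ⟨D ^ (1 / p), by positivity, fun j S hS f hf hfm => ?_⟩
  have hfin := hS.finite hE (by positivity)
  obtain ⟨T, rfl⟩ := hfin.exists_finset_coe
  have hTE : ∀ t ∈ T, t ∈ E := fun t ht => hS.prop.1 ht
  set X := supCov E α ((2 : ℝ) ^ j)⁻¹ with hX
  have hX1 : 1 ≤ X := one_le_supCov hE hne hα0 (by positivity)
    (inv_le_one_of_one_le₀ (one_le_pow₀ (by norm_num)))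
  have hj : (0 : ℝ) ≤ j := Nat.cast_nonneg j
  have h2α : (1 : ℝ) ≤ 2 ^ α := Real.one_le_rpow (by norm_num) hα0
  have h1 := hC₁ j T ((2 + 4 * 2 ^ α) * (j + 1) * X) (fun t ht => hE (hTE t ht))
    ((card_le_supCov hE hα0 (by positivity)
      (inv_le_one_of_one_le₀ (one_le_pow₀ (by norm_num))) hTE hS.prop.2).trans (by
        refine mul_le_mul_of_nonneg_right ?_ (by positivity)
        nlinarith))
    (fun v => (sum_rpow_le_supCov hE hα0 j hTE hS.prop.2 v).trans (by
        refine mul_le_mul_of_nonneg_right ?_ (by positivity)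
        nlinarith)) f hf hfm
  have h2 : C₁ * (2 ^ ((j : ℝ) * η)) ^ α * ((2 + 4 * 2 ^ α) * (j + 1) * X) ≤
      (D ^ (1 / p) * (2 : ℝ) ^ ((j : ℝ) * (1 / p * ν + ε))) ^ p := by
    calc _ ≤ C₁ * 2 ^ ((j : ℝ) * γ) * ((2 + 4 * 2 ^ α) * (C₃ * 2 ^ ((j : ℝ) * γ)) *
          (C₂ * 2 ^ ((j : ℝ) * (ν + γ)))) := by
          have h3 : ((2 : ℝ) ^ ((j : ℝ) * η)) ^ α ≤ 2 ^ ((j : ℝ) * γ) := by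
            rw [← Real.rpow_mul two_pos.le]
            refine Real.rpow_le_rpow_of_exponent_le (by norm_num) ?_
            rw [mul_assoc]
            gcongr
          gcongr
          · exact hC₃ j
          · exact hC₂ j
      _ = D * (2 ^ ((j : ℝ) * γ) * 2 ^ ((j : ℝ) * γ) * 2 ^ ((j : ℝ) * (ν + γ))) := by rw [hD]; ring
      _ = _ := by
          rw [Real.mul_rpow (by positivity) (by positivity), ← Real.rpow_mul hD0.le,
            one_div_mul_cancel hp0.ne', Real.rpow_one, ← Real.rpow_mul two_pos.le,
            ← Real.rpow_add two_pos, ← Real.rpow_add two_pos]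
          congr 2
          rw [hγ]
          field_simp
          ring
  rw [waveSum_eq φ hp0, one_div, ENNReal.rpow_inv_le_iff hp0, ← one_div, ENNReal.mul_rpow_of_nonneg _ _ hp0.le,
    eLpNorm_ofReal_rpow hp0, ENNReal.ofReal_rpow_of_nonneg (by positivity) hp0.le]
  exact h1.trans (mul_le_mul_left (ENNReal.ofReal_le_ofReal h2) _)

/-! ### Sharpness: wave kernels as test functions. -/

theorem isRadial_waveKernel {φ : ℝ → ℝ} (hφ : IsBump φ) (n j : ℕ) (t : ℝ) :
    IsRadial (waveKernel (n + 1) φ j t) := fun x y h => by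
  rw [waveKernel_eq hφ, waveKernel_eq hφ, h]

/-- The constant depends on j and t; the bound serves only to give boundedness and integrability of
a fixed kernel. -/
theorem exists_norm_waveKernel_le {φ : ℝ → ℝ} (hφ : IsBump φ) (n j : ℕ) (t : ℝ) :
    ∃ C : ℝ, 0 ≤ C ∧ ∀ x : EV n,
      ‖waveKernel (n + 1) φ j t x‖ ≤ C * (1 + ‖x‖) ^ (-((2 * (n + 1) : ℕ) : ℝ)) := by
  obtain ⟨C₀, hC₀0, hC₀⟩ := exists_ptKernel_radius_decay n 0 (hφ.isTest n)
  obtain ⟨C₁, hC₁0, hC₁⟩ := exists_ptKernel_radius_decay n (n + 1) (hφ.isTest n)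
  set Q : ℝ := 2 ^ j with hQ
  have hQ1 : 1 ≤ Q := one_le_pow₀ (by norm_num)
  set c : ℝ := ‖((2 * Real.pi : ℝ) ^ (n + 1) : ℂ)⁻¹‖ with hc
  set D := C₀ * 2 ^ (2 * (n + 1)) + C₁ * (1 + |Q * t|) ^ (2 * (n + 1)) * 2 ^ (2 * (n + 1)) with hD
  refine ⟨c * (Q ^ (n + 1) * D), by positivity, fun x => ?_⟩
  set r := ‖x‖ with hr
  have hr0 : 0 ≤ r := norm_nonneg x
  have h0 := hC₀ (Q * t) (Q * r) (by positivity)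
  have h1 := hC₁ (Q * t) (Q * r) (by positivity)
  rw [waveKernel_eq hφ, norm_mul, norm_mul, Complex.norm_real, Real.norm_eq_abs,
    abs_of_pos (by positivity), Real.rpow_neg (by positivity), Real.rpow_natCast, mul_assoc, mul_assoc]
  set P := ‖ptKernel n 0 (fun ρ => (φ ρ : ℂ) * (ρ : ℂ) ^ n) (Q * t) (Q * r)‖
  have hP0 : 0 ≤ P := norm_nonneg _
  refine mul_le_mul_of_nonneg_left (mul_le_mul_of_nonneg_left ?_ (by positivity)) (norm_nonneg _)
  rw [← div_eq_mul_inv, le_div_iff₀ (by positivity), hD]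
  simp only [mul_zero, pow_zero, one_mul, mul_one] at h0
  have hb : 0 ≤ C₁ * (1 + |Q * t|) ^ (2 * (n + 1)) * 2 ^ (2 * (n + 1)) := by positivity
  have ha : 0 ≤ C₀ * 2 ^ (2 * (n + 1)) := by positivity
  rcases le_total r 1 with h | h
  · calc P * (1 + r) ^ (2 * (n + 1)) ≤ C₀ * 2 ^ (2 * (n + 1)) := by
          gcongr
          linarith
      _ ≤ _ := by linarith
  · have h2 : (1 + r) ^ (2 * (n + 1)) ≤ (Q * r) ^ (2 * (n + 1)) * 2 ^ (2 * (n + 1)) := by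
      rw [← mul_pow]
      refine pow_le_pow_left₀ (by positivity) ?_ _
      nlinarith
    calc P * (1 + r) ^ (2 * (n + 1)) ≤ P * ((Q * r) ^ (2 * (n + 1)) * 2 ^ (2 * (n + 1))) := by gcongr
      _ = (Q * r) ^ (2 * (n + 1)) * P * 2 ^ (2 * (n + 1)) := by ring
      _ ≤ C₁ * (1 + |Q * t|) ^ (2 * (n + 1)) * 2 ^ (2 * (n + 1)) := by gcongr
      _ ≤ _ := by linarith

theorem integrable_waveKernel {φ : ℝ → ℝ} (hφ : IsBump φ) (n j : ℕ) (t : ℝ) :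
    Integrable (waveKernel (n + 1) φ j t) := by
  obtain ⟨C, hC0, hC⟩ := exists_norm_waveKernel_le hφ n j t
  have h := integrable_one_add_norm (E := EV n) (μ := volume) (r := ((2 * (n + 1) : ℕ) : ℝ)) (by
    simp
    linarith [(Nat.cast_nonneg n : (0 : ℝ) ≤ n)])
  exact (h.const_mul C).mono' (continuous_waveKernel hφ n j t).aestronglyMeasurable
    (Eventually.of_forall hC)

/-- The symbol of the half-wave propagator. -/
def waveSymbol (n : ℕ) (φ : ℝ → ℝ) (j : ℕ) (t : ℝ) (ξ : EV n) : ℂ :=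
  (φ (((2 : ℝ) ^ j)⁻¹ * ‖ξ‖) : ℂ) * Complex.exp (Complex.I * (t * ‖ξ‖ : ℝ))

theorem fourierInv_waveSymbol (n : ℕ) (φ : ℝ → ℝ) (j : ℕ) (t : ℝ) (x : EV n) :
    FourierTransformInv.fourierInv (waveSymbol n φ j t) x =
      ((2 * Real.pi : ℝ) ^ (n + 1) : ℂ) * waveKernel (n + 1) φ j t ((2 * Real.pi) • x) := by
  rw [Real.fourierInv_eq', waveKernel, mul_inv_cancel_left₀ (by
    simp [Real.pi_ne_zero])]
  refine integral_congr_ae (Eventually.of_forall fun ξ => ?_)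
  simp only [waveSymbol, smul_eq_mul]
  rw [Complex.exp_add, inner_smul_left, real_inner_comm]
  rw [mul_left_comm]
  congr 3
  push_cast
  simp
  ring

theorem integrable_waveSymbol {φ : ℝ → ℝ} (hφ : IsBump φ) (n j : ℕ) (t : ℝ) :
    Integrable (waveSymbol n φ j t) := by
  refine (integrable_symbol hφ (n + 1) j).mul_bdd (c := 1) (by fun_prop) ?_
  refine Eventually.of_forall fun ξ => ?_
  rw [Complex.norm_exp_I_mul_ofReal]

/-- Fourier inversion, after a dilation by 2π between the two normalisations. The integrability that
inversion needs comes from the decay of the kernel. -/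
theorem fourierHat_waveKernel {φ : ℝ → ℝ} (hφ : IsBump φ) (n j : ℕ) (t : ℝ) (ξ : EV n) :
    fourierHat (waveKernel (n + 1) φ j t) ξ = waveSymbol n φ j t ξ := by
  have hc : Continuous (waveSymbol n φ j t) := by
    have := hφ.smooth.continuous
    unfold waveSymbol
    fun_prop
  have hI := integrable_waveKernel hφ n j t
  have hF : FourierTransformInv.fourierInv (waveSymbol n φ j t) = fun x : EV n =>
      ((2 * Real.pi : ℝ) ^ (n + 1) : ℂ) * waveKernel (n + 1) φ j t ((2 * Real.pi) • x) :=
    funext (fourierInv_waveSymbol n φ j t)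
  have hFi : Integrable (FourierTransform.fourier (waveSymbol n φ j t)) := by
    have h1 : FourierTransform.fourier (waveSymbol n φ j t) = fun x : EV n =>
        FourierTransformInv.fourierInv (waveSymbol n φ j t) (-x) := by
      funext x
      rw [Real.fourierInv_eq_fourier_neg, neg_neg]
    rw [h1, hF]
    exact ((hI.comp_smul (by positivity : (2 * Real.pi) ≠ 0)).const_mul _).comp_neg
  have hinv := congrFun (hc.fourier_fourierInv_eq (integrable_waveSymbol hφ n j t) hFi) ξ
  rw [← hinv, Real.fourier_eq', hF, fourierHat]
  have hs := Measure.integral_comp_smul (μ := (volume : Measure (EV n)))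
    (fun y => waveKernel (n + 1) φ j t y * Complex.exp (-(Complex.I * (inner ℝ y ξ : ℝ))))
    (2 * Real.pi)
  rw [← Complex.ofReal_pow]
  have hpos : (0 : ℝ) < (2 * Real.pi) ^ (n + 1) := by positivity
  have hfr : Module.finrank ℝ (EV n) = n + 1 := by simp
  rw [hfr, abs_of_pos (by positivity)] at hs
  calc _ = ((2 * Real.pi) ^ (n + 1)) • (((2 * Real.pi) ^ (n + 1))⁻¹ • ∫ y : EV n,
        waveKernel (n + 1) φ j t y * Complex.exp (-(Complex.I * (inner ℝ y ξ : ℝ)))) := by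
        rw [smul_inv_smul₀ hpos.ne']
    _ = _ := by
        rw [← hs, ← integral_smul]
        refine integral_congr_ae (Eventually.of_forall fun y => ?_)
        simp only [smul_eq_mul, Complex.real_smul]
        have e : Complex.exp (-(Complex.I * (inner ℝ ((2 * Real.pi) • y) ξ : ℝ))) =
            Complex.exp ((-2 * Real.pi * inner ℝ y ξ : ℝ) * Complex.I) := by
          rw [real_inner_smul_left]
          congr 1
          push_cast
          ring
        rw [e]
        push_cast
        ring

theorem IsBump.sq {φ : ℝ → ℝ} (hφ : IsBump φ) : IsBump fun r => φ r ^ 2 where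
  smooth := hφ.smooth.pow 2
  support := by
    refine (closure_mono ?_).trans hφ.support
    intro x hx
    simpa using hx
  ne_zero h := hφ.ne_zero (funext fun x => by simpa using congrFun h x)

/-- Symbols multiply: the cut-offs combine to φ² and the times add. Propagating a kernel thus only
shifts its distance in time from the focus. -/
theorem halfWave_waveKernel {φ : ℝ → ℝ} (hφ : IsBump φ) (n j : ℕ) (t u : ℝ) (x : EV n) :
    halfWave φ j t (waveKernel (n + 1) φ j u) x =
      waveKernel (n + 1) (fun r => φ r ^ 2) j (t + u) x := by
  rw [halfWave_eq hφ j t (integrable_waveKernel hφ n j u), waveKernel]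
  congr 1
  refine integral_congr_ae (Eventually.of_forall fun ξ => ?_)
  simp only [fourierHat_waveKernel hφ, waveSymbol]
  have : Complex.exp (Complex.I * (inner ℝ x ξ : ℝ) + Complex.I * ((t + u) * ‖ξ‖ : ℝ)) =
      Complex.exp (Complex.I * (u * ‖ξ‖ : ℝ)) *
        Complex.exp (Complex.I * (inner ℝ x ξ : ℝ) + Complex.I * (t * ‖ξ‖ : ℝ)) := by
    rw [← Complex.exp_add]
    congr 1
    push_cast
    ring
  rw [this]
  push_cast
  ring

theorem waveKernel_neg {n : ℕ} (φ : ℝ → ℝ) (j : ℕ) (t : ℝ) (x : EV n) :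
    waveKernel (n + 1) φ j (-t) x = starRingEnd ℂ (waveKernel (n + 1) φ j t (-x)) := by
  rw [waveKernel, waveKernel, map_mul, ← integral_conj]
  congr 1
  · rw [map_inv₀, map_pow, Complex.conj_ofReal]
  refine integral_congr_ae (Eventually.of_forall fun ξ => ?_)
  simp only [map_mul, Complex.conj_ofReal, ← Complex.exp_conj, map_add, Complex.conj_I,
    inner_neg_left]
  congr 2
  push_cast
  ring

theorem waveKernel_zero_zero {φ : ℝ → ℝ} (hφ : IsBump φ) (n j : ℕ) :
    waveKernel (n + 1) φ j 0 0 = ((((2 : ℝ) ^ j) ^ (n + 1) : ℝ) : ℂ) * waveKernel (n + 1) φ 0 0 0 := by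
  rw [waveKernel_eq hφ, waveKernel_eq hφ]
  simp only [norm_zero, mul_zero]
  push_cast
  simp
  ring

/-! ### Sharpness: energy and L^p norms of wave kernels. -/

/-- The energy `∫ |K_{0,t}|²`, which does not depend on `t`. -/
def energy (n : ℕ) (φ : ℝ → ℝ) : ℝ :=
  ((2 * Real.pi) ^ (n + 1))⁻¹ * ∫ ξ : EV n, φ ‖ξ‖ ^ 2

theorem energy_pos {φ : ℝ → ℝ} (hφ : IsBump φ) (n : ℕ) : 0 < energy n φ := by
  have hc : Continuous fun ξ : EV n => φ ‖ξ‖ ^ 2 := by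
    have := hφ.smooth.continuous
    fun_prop
  obtain ⟨r, hr⟩ := Function.ne_iff.1 hφ.ne_zero
  have hr4 : 0 < r := by
    by_contra h
    exact hr (hφ.eq_zero fun h' => h (by linarith [h'.1]))
  obtain ⟨v, hv⟩ := exists_norm_eq (EV n) hr4.le
  refine mul_pos (by positivity) (hc.integral_pos_of_hasCompactSupport_nonneg_nonzero ?_
    (fun ξ => sq_nonneg _) (x := v) ?_)
  · refine HasCompactSupport.intro (isCompact_closedBall 0 4) fun ξ hξ => ?_
    rw [mem_closedBall_zero_iff, not_le] at hξ
    rw [hφ.eq_zero fun h => by linarith [h.2]]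
    simp
  · rw [hv]
    exact pow_ne_zero 2 hr

/-- Propagate K_{-t} by time t and evaluate at the origin. Because K_{-t}(y) is the conjugate of
K_t(-y), the convolution there is ∫ |K_t|², while the group law gives the value at 0 of the kernel
for φ² at time 0. -/
theorem lintegral_waveKernel_sq {φ : ℝ → ℝ} (hφ : IsBump φ) (n j : ℕ) (t : ℝ) :
    ∫⁻ x : EV n, ‖waveKernel (n + 1) φ j t x‖ₑ ^ (2 : ℝ) =
      ENNReal.ofReal (((2 : ℝ) ^ j) ^ (n + 1) * energy n φ) := by
  have h1 := halfWave_waveKernel hφ n j t (-t) 0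
  rw [add_neg_cancel, waveKernel_zero_zero hφ.sq] at h1
  have he : waveKernel (n + 1) (fun r => φ r ^ 2) 0 0 0 = ((energy n φ : ℝ) : ℂ) := by
    rw [waveKernel, energy]
    push_cast
    congr 1
    rw [← integral_complex_ofReal]
    refine integral_congr_ae (Eventually.of_forall fun ξ => ?_)
    simp
  have hK : ∀ y : EV n, waveKernel (n + 1) φ j t (0 - y) * waveKernel (n + 1) φ j (-t) y =
      ((‖waveKernel (n + 1) φ j t y‖ ^ 2 : ℝ) : ℂ) := fun y => by
    rw [waveKernel_neg, zero_sub, Complex.mul_conj, Complex.normSq_eq_norm_sq,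
      isRadial_waveKernel hφ n j t (-y) y (norm_neg y)]
  have h2 : ∫ y : EV n, ‖waveKernel (n + 1) φ j t y‖ ^ 2 = ((2 : ℝ) ^ j) ^ (n + 1) * energy n φ := by
    rw [halfWave, he] at h1
    simp_rw [hK] at h1
    rw [integral_complex_ofReal] at h1
    exact_mod_cast h1
  obtain ⟨C, hC0, hC⟩ := exists_norm_waveKernel_le hφ n j t
  have hi : Integrable fun y : EV n => ‖waveKernel (n + 1) φ j t y‖ ^ 2 := by
    have := (integrable_waveKernel hφ n j t).norm.bdd_mul (c := C)
      (continuous_waveKernel hφ n j t).norm.aestronglyMeasurable (Eventually.of_forall fun x => by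
        rw [norm_norm]
        refine (hC x).trans (mul_le_of_le_one_right hC0 ?_)
        exact Real.rpow_le_one_of_one_le_of_nonpos (by linarith [norm_nonneg x]) (by simp; positivity))
    simpa only [sq] using this
  rw [← h2, ofReal_integral_eq_lintegral_ofReal hi (Eventually.of_forall fun y => by positivity)]
  refine lintegral_congr fun y => ?_
  rw [ENNReal.ofReal_pow (norm_nonneg _), ofReal_norm, ← ENNReal.rpow_natCast]
  norm_num

/-- If 1 + Q|x| ≥ Q^{1-θ}, the amplitude (1 + Q|x|)^{-n/2} suffices up to Q^{θn/2}. Otherwise the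
time Q|u| ≥ Q dominates the radius, and N steps of time decay gain Q^{-θN}, where N is chosen with
θN ≥ n/2. -/
theorem exists_waveKernel_sup_le {φ : ℝ → ℝ} (hφ : IsBump φ) (n : ℕ) {η : ℝ} (hη : 0 < η) :
    ∃ C : ℝ, 0 < C ∧ ∀ (j : ℕ) (u : ℝ), 1 ≤ |u| → ∀ x : EV n,
      ‖waveKernel (n + 1) φ j u x‖ ≤ C * ((2 : ℝ) ^ j) ^ ((n : ℝ) / 2 + 1 + η) := by
  set m : ℝ := (n : ℝ) / 2 with hm
  have hm0 : 0 ≤ m := by positivity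
  set θ : ℝ := η / (m + 1) with hθ
  have hθ0 : 0 < θ := by positivity
  have hθm : θ * m ≤ η := by
    rw [hθ, div_mul_eq_mul_div, div_le_iff₀ (by positivity)]
    nlinarith
  obtain ⟨N, hN⟩ := exists_nat_ge (m / θ)
  rw [div_le_iff₀ hθ0] at hN
  obtain ⟨C₁, hC₁0, hC₁⟩ := exists_ptKernel_bound n (hφ.isTest n)
  obtain ⟨C₂, hC₂0, hC₂⟩ := exists_ptKernel_time_decay n N 0 (hφ.isTest n)
  set c : ℝ := ‖((2 * Real.pi : ℝ) ^ (n + 1) : ℂ)⁻¹‖ with hc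
  have hc0 : 0 < c := by
    rw [hc, norm_pos_iff]
    simp [Real.pi_ne_zero]
  refine ⟨c * (2 * C₁ + C₂), by positivity, fun j u hu x => ?_⟩
  set Q : ℝ := 2 ^ j with hQd
  have hQ1 : 1 ≤ Q := one_le_pow₀ (by norm_num)
  have hQ : 0 < Q := by positivity
  rw [waveKernel_eq hφ, norm_mul, norm_mul, Complex.norm_real, Real.norm_eq_abs,
    abs_of_pos (by positivity)]
  set r := Q * ‖x‖ with hr
  have hr0 : 0 ≤ r := by positivity
  have h1 := hC₁ (Q * u) r hr0
  have h2 := hC₂ (Q * u) r hr0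
  set P := ‖ptKernel n 0 (fun ρ => (φ ρ : ℂ) * (ρ : ℂ) ^ n) (Q * u) r‖
  have hP : P ≤ (2 * C₁ + C₂) * Q ^ (-m + η) := by
    have hQe : 0 < Q ^ (-m + η) := by positivity
    rcases le_total (Q ^ (1 - θ)) (1 + r) with h | h
    · have h3 : (1 + r) ^ (-m) ≤ Q ^ (-m + η) := by
        calc (1 + r) ^ (-m) ≤ (Q ^ (1 - θ)) ^ (-m) :=
              Real.rpow_le_rpow_of_nonpos (by positivity) h (by linarith)
          _ = Q ^ ((1 - θ) * -m) := by rw [Real.rpow_mul hQ.le]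
          _ ≤ _ := Real.rpow_le_rpow_of_exponent_le hQ1 (by linarith)
      have h4 : ∀ v : ℝ, 1 / (1 + |v|) ^ 2 ≤ 1 := fun v =>
        div_le_one_of_le₀ (one_le_pow₀ (by linarith [abs_nonneg v])) (by positivity)
      calc P ≤ C₁ * (1 + r) ^ (-m) * (1 / (1 + |Q * u + r|) ^ 2 + 1 / (1 + |Q * u - r|) ^ 2) := h1
        _ ≤ C₁ * Q ^ (-m + η) * (1 + 1) := by
          gcongr
          · exact h4 _
          · exact h4 _
        _ ≤ _ := by nlinarith
    · have h3 : Q ^ N * P ≤ C₂ * Q ^ ((1 - θ) * N) := by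
        calc Q ^ N * P ≤ |Q * u| ^ N * P := by
              gcongr
              rw [abs_mul, abs_of_pos hQ]
              nlinarith
          _ ≤ C₂ * (1 + r) ^ N := h2
          _ ≤ C₂ * (Q ^ (1 - θ)) ^ N := by gcongr
          _ = _ := by rw [Real.rpow_mul hQ.le, Real.rpow_natCast]
      have h4 : C₂ * Q ^ ((1 - θ) * N) ≤ Q ^ N * (C₂ * Q ^ (-m + η)) := by
        rw [mul_left_comm, ← Real.rpow_natCast Q N, ← Real.rpow_add hQ]
        gcongr
        linarith
      have h5 := le_of_mul_le_mul_left (h3.trans h4) (by positivity)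
      nlinarith
  have e : Q ^ (m + 1 + η) = Q ^ (n + 1) * Q ^ (-m + η) := by
    rw [← Real.rpow_natCast, ← Real.rpow_add hQ]
    congr 1
    rw [hm]
    push_cast
    ring
  rw [e]
  calc c * (Q ^ (n + 1) * P) ≤ c * (Q ^ (n + 1) * ((2 * C₁ + C₂) * Q ^ (-m + η))) := by gcongr
    _ = _ := by ring

/-- Interpolation between the sup bound and the exact energy: |K|^p ≤ (sup |K|)^{p-2} |K|². -/
theorem exists_lintegral_waveKernel_rpow_le {φ : ℝ → ℝ} (hφ : IsBump φ) (n : ℕ) {p η : ℝ}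
    (hp : 2 ≤ p) (hη : 0 < η) : ∃ C : ℝ, 0 < C ∧ ∀ (j : ℕ) (u : ℝ), 1 ≤ |u| →
      ∫⁻ x : EV n, ‖waveKernel (n + 1) φ j u x‖ₑ ^ p ≤
        ENNReal.ofReal (C * ((2 : ℝ) ^ j) ^ (p * ((n : ℝ) / 2 + 1) - 1 + η * (p - 2))) := by
  obtain ⟨C, hC0, hC⟩ := exists_waveKernel_sup_le hφ n hη
  have he := energy_pos hφ n
  refine ⟨C ^ (p - 2) * energy n φ, by positivity, fun j u hu => ?_⟩
  set Q : ℝ := 2 ^ j with hQd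
  have hQ : 0 < Q := by positivity
  calc _ ≤ ∫⁻ x : EV n, ENNReal.ofReal ((C * Q ^ ((n : ℝ) / 2 + 1 + η)) ^ (p - 2)) *
        ‖waveKernel (n + 1) φ j u x‖ₑ ^ (2 : ℝ) := by
        refine lintegral_mono fun x => ?_
        have hs : p = (p - 2) + 2 := by ring
        conv_lhs => rw [hs, ENNReal.rpow_add_of_nonneg _ _ (by linarith) (by norm_num)]
        rw [← ENNReal.ofReal_rpow_of_nonneg (by positivity) (by linarith)]
        refine mul_le_mul_left (ENNReal.rpow_le_rpow ?_ (by linarith)) _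
        rw [← ofReal_norm]
        exact ENNReal.ofReal_le_ofReal (hC j u hu x)
    _ = _ := by
        rw [lintegral_const_mul' _ _ (by finiteness), lintegral_waveKernel_sq hφ,
          ← ENNReal.ofReal_mul (by positivity)]
        congr 1
        rw [Real.mul_rpow hC0.le (by positivity), ← Real.rpow_mul hQ.le, ← hQd,
          ← Real.rpow_natCast Q (n + 1)]
        have e : Q ^ (p * ((n : ℝ) / 2 + 1) - 1 + η * (p - 2)) =
            Q ^ (((n : ℝ) / 2 + 1 + η) * (p - 2)) * Q ^ ((n + 1 : ℕ) : ℝ) := by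
          rw [← Real.rpow_add hQ]
          congr 1
          push_cast
          ring
        rw [e]
        ring

/-- Squaring the kernel bound gives four powers of (1 + Q | |x| - |τ| |)⁻¹. Two of them yield (1 +
M)^{-2} and the other two form `psi Q`, whose integral is bounded; the polar density r^n is absorbed
by the squared amplitude. -/
theorem exists_tail_le {φ : ℝ → ℝ} (hφ : IsBump φ) (n : ℕ) :
    ∃ C : ℝ, 0 < C ∧ ∀ (j : ℕ) (τ M : ℝ), 0 ≤ M →
      ∫⁻ x in {x : EV n | M / 2 ^ j ≤ |‖x‖ - (|τ|)|}, ‖waveKernel (n + 1) φ j τ x‖ₑ ^ (2 : ℝ) ≤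
        ENNReal.ofReal (((2 : ℝ) ^ j) ^ (n + 1) * (C / (1 + M) ^ 2)) := by
  obtain ⟨C₁, hC₁0, hC₁⟩ := exists_ptKernel_bound n (hφ.isTest n)
  obtain ⟨I, hI0, hI⟩ := exists_lintegral_psi_le
  have hS := surf_univ_pos n
  set S := (surf n).real Set.univ with hSd
  have hSe : surf n Set.univ = ENNReal.ofReal S := by
    rw [hSd, ofReal_measureReal]
  set c : ℝ := ‖((2 * Real.pi : ℝ) ^ (n + 1) : ℂ)⁻¹‖ with hc
  have hc0 : 0 < c := by
    rw [hc, norm_pos_iff]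
    simp [Real.pi_ne_zero]
  refine ⟨S * ((2 * c * C₁) ^ 2 * I), by positivity, fun j τ M hM => ?_⟩
  set Q : ℝ := 2 ^ j with hQd
  have hQ : 0 < Q := by positivity
  set H : ℝ → ℝ := fun r => (2 * c * C₁) ^ 2 / (1 + M) ^ 2 * (Q ^ (n + 1) * (Q ^ n *
    ((1 + Q * |r|) ^ n)⁻¹ * psi Q (r - |τ|))) with hH
  have hpt : ∀ x : EV n, M / Q ≤ |‖x‖ - (|τ|)| →
      ‖waveKernel (n + 1) φ j τ x‖ₑ ^ (2 : ℝ) ≤ ENNReal.ofReal (H ‖x‖) := fun x hx => by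
    rw [← ofReal_norm, ENNReal.ofReal_rpow_of_nonneg (norm_nonneg _) (by norm_num), Real.rpow_two]
    refine ENNReal.ofReal_le_ofReal ?_
    rw [waveKernel_eq hφ, norm_mul, norm_mul, Complex.norm_real, Real.norm_eq_abs,
      abs_of_pos (by positivity)]
    set r := ‖x‖ with hr
    have hr0 : 0 ≤ r := norm_nonneg x
    have h1 := hC₁ (Q * τ) (Q * r) (by positivity)
    set P := ‖ptKernel n 0 (fun ρ => (φ ρ : ℂ) * (ρ : ℂ) ^ n) (Q * τ) (Q * r)‖
    set v := |r - (|τ|)| with hv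
    have hv0 : 0 ≤ v := abs_nonneg _
    have hv1 : v ≤ |τ + r| := by
      have := abs_abs_sub_abs_le τ (-r)
      rwa [abs_neg, abs_of_nonneg hr0, abs_sub_comm, sub_neg_eq_add] at this
    have hv2 : v ≤ |τ - r| := by
      have := abs_abs_sub_abs_le τ r
      rwa [abs_of_nonneg hr0, abs_sub_comm] at this
    have h2 : P ≤ C₁ * (1 + Q * r) ^ (-((n : ℝ) / 2)) * (2 / (1 + Q * v) ^ 2) := by
      refine h1.trans (mul_le_mul_of_nonneg_left ?_ (by positivity))
      rw [← mul_add, ← mul_sub, abs_mul, abs_mul, abs_of_pos hQ]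
      calc _ ≤ 1 / (1 + Q * v) ^ 2 + 1 / (1 + Q * v) ^ 2 := by gcongr
        _ = _ := by ring
    have h3 : ((1 + Q * r) ^ (-((n : ℝ) / 2))) ^ 2 = ((1 + Q * r) ^ n)⁻¹ := by
      rw [← Real.rpow_natCast, ← Real.rpow_mul (by positivity), ← Real.rpow_natCast,
        ← Real.rpow_neg (by positivity)]
      congr 1
      push_cast
      ring
    have h4 : 1 + M ≤ 1 + Q * v := by
      rw [div_le_iff₀ hQ] at hx
      linarith
    calc (c * (Q ^ (n + 1) * P)) ^ 2
        ≤ (c * (Q ^ (n + 1) * (C₁ * (1 + Q * r) ^ (-((n : ℝ) / 2)) * (2 / (1 + Q * v) ^ 2)))) ^ 2 := by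
          gcongr
      _ = (2 * c * C₁) ^ 2 / (1 + Q * v) ^ 2 * (Q ^ (n + 1) * (Q ^ n *
          ((1 + Q * r) ^ (-((n : ℝ) / 2))) ^ 2 * (Q / (1 + Q * v) ^ 2))) := by
          field_simp
          ring
      _ ≤ (2 * c * C₁) ^ 2 / (1 + M) ^ 2 * (Q ^ (n + 1) * (Q ^ n *
          ((1 + Q * r) ^ n)⁻¹ * (Q / (1 + Q * v) ^ 2))) := by
          rw [h3]
          gcongr
      _ = H r := by rw [hH]; simp only [psi, abs_of_nonneg hr0, hv]
  have hψ := measurable_psi Q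
  have hHm : Measurable H := by fun_prop
  have hset : MeasurableSet {x : EV n | M / Q ≤ |‖x‖ - (|τ|)|} :=
    measurableSet_le measurable_const (by fun_prop)
  calc _ ≤ ∫⁻ x in {x : EV n | M / Q ≤ |‖x‖ - (|τ|)|}, ENNReal.ofReal (H ‖x‖) :=
        setLIntegral_mono' hset hpt
    _ ≤ ∫⁻ x : EV n, ENNReal.ofReal (H ‖x‖) := setLIntegral_le_lintegral _ _
    _ = surf n Set.univ * ∫⁻ r in Set.Ioi (0 : ℝ), ENNReal.ofReal (r ^ n) * ENNReal.ofReal (H r) :=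
        lintegral_fun_norm hHm.ennreal_ofReal
    _ ≤ surf n Set.univ * ∫⁻ r in Set.Ioi (0 : ℝ),
        ENNReal.ofReal ((2 * c * C₁) ^ 2 / (1 + M) ^ 2 * Q ^ (n + 1)) *
          ENNReal.ofReal (psi Q (r - |τ|)) := by
        refine mul_le_mul_right (setLIntegral_mono' measurableSet_Ioi fun r hr => ?_) _
        have hr : 0 < r := hr
        rw [← ENNReal.ofReal_mul (by positivity), ← ENNReal.ofReal_mul (by positivity)]
        refine ENNReal.ofReal_le_ofReal ?_
        have h5 : r ^ n * (Q ^ n * ((1 + Q * r) ^ n)⁻¹) ≤ 1 := by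
          rw [← mul_assoc, ← mul_pow, ← div_eq_mul_inv, div_le_one (by positivity)]
          exact pow_le_pow_left₀ (by positivity) (by linarith) n
        have hψ0 := psi_nonneg hQ (r - |τ|)
        calc _ = (2 * c * C₁) ^ 2 / (1 + M) ^ 2 * Q ^ (n + 1) * psi Q (r - |τ|) *
              (r ^ n * (Q ^ n * ((1 + Q * r) ^ n)⁻¹)) := by
              rw [hH]; simp only [abs_of_pos hr]; ring
          _ ≤ _ := mul_le_of_le_one_right (by positivity) h5
    _ ≤ surf n Set.univ * (ENNReal.ofReal ((2 * c * C₁) ^ 2 / (1 + M) ^ 2 * Q ^ (n + 1)) *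
          ENNReal.ofReal I) := by
        rw [lintegral_const_mul' _ _ (by finiteness)]
        gcongr
        refine (setLIntegral_le_lintegral _ _).trans ?_
        rw [lintegral_sub_right_eq_self (fun r => ENNReal.ofReal (psi Q r))]
        exact hI Q hQ
    _ = _ := by
        rw [hSe, ← ENNReal.ofReal_mul (by positivity), ← ENNReal.ofReal_mul (by positivity)]
        congr 1
        ring

/-- The hypothesis 1 ≤ Qτ gives M/Q ≤ Mτ, so all radii in the shell are at most (1 + M)τ. -/
theorem volume_annulus_le (n : ℕ) {M Q τ : ℝ} (hM : 0 ≤ M) (hQ : 0 < Q) (hτ : 1 ≤ Q * τ) :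
    volume {x : EV n | |‖x‖ - τ| ≤ M / Q} ≤
      ENNReal.ofReal ((surf n).real Set.univ * (1 + M) ^ n * (2 * M) * (τ ^ n * Q⁻¹)) := by
  have hτ0 : 0 < τ := by
    by_contra h
    nlinarith [not_lt.1 h]
  have hset : MeasurableSet {x : EV n | |‖x‖ - τ| ≤ M / Q} :=
    measurableSet_le (by fun_prop) measurable_const
  have hset' : MeasurableSet {r : ℝ | |r - τ| ≤ M / Q} :=
    measurableSet_le (by fun_prop) measurable_const
  have hF : Measurable ({r : ℝ | |r - τ| ≤ M / Q}.indicator (1 : ℝ → ℝ≥0∞)) :=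
    measurable_one.indicator hset'
  calc _ = ∫⁻ x : EV n, {r : ℝ | |r - τ| ≤ M / Q}.indicator (1 : ℝ → ℝ≥0∞) ‖x‖ := by
        rw [← lintegral_indicator_one hset]
        rfl
    _ = surf n Set.univ * ∫⁻ r in Set.Ioi (0 : ℝ), ENNReal.ofReal (r ^ n) *
        {r : ℝ | |r - τ| ≤ M / Q}.indicator (1 : ℝ → ℝ≥0∞) r := lintegral_fun_norm hF
    _ ≤ surf n Set.univ * ∫⁻ r in Set.Ioi (0 : ℝ), ENNReal.ofReal (((1 + M) * τ) ^ n) *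
        {r : ℝ | |r - τ| ≤ M / Q}.indicator (1 : ℝ → ℝ≥0∞) r := by
        refine mul_le_mul_right (setLIntegral_mono' measurableSet_Ioi fun r hr => ?_) _
        have hr : 0 < r := hr
        by_cases h : |r - τ| ≤ M / Q
        · refine mul_le_mul_left (ENNReal.ofReal_le_ofReal (pow_le_pow_left₀ hr.le ?_ n)) _
          have h1 : M / Q ≤ M * τ := by
            rw [div_le_iff₀ hQ]
            nlinarith
          linarith [(abs_le.1 h).2]
        · simp [h]
    _ ≤ surf n Set.univ * (ENNReal.ofReal (((1 + M) * τ) ^ n) * ENNReal.ofReal (2 * (M / Q))) := by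
        rw [lintegral_const_mul _ hF]
        gcongr
        refine (setLIntegral_le_lintegral _ _).trans ?_
        rw [lintegral_indicator_one hset']
        have : {r : ℝ | |r - τ| ≤ M / Q} = Metric.closedBall τ (M / Q) := by
          ext r
          simp [Real.dist_eq]
        rw [this, Real.volume_closedBall]
    _ = _ := by
        rw [← ofReal_measureReal (μ := surf n) (s := Set.univ), ← ENNReal.ofReal_mul (by positivity),
          ← ENNReal.ofReal_mul (by positivity)]
        congr 1
        rw [mul_pow]
        ring

/-- At least half of the energy lies in the shell of radius |τ| and width about 1/Q, whose volume is
at most a constant times |τ|^n / Q. Hölder's inequality on this set bounds the L^p norm below and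
produces |τ|^{-α}. -/
theorem exists_le_lintegral_waveKernel_rpow {φ : ℝ → ℝ} (hφ : IsBump φ) (n : ℕ) {p : ℝ}
    (hp : 2 ≤ p) : ∃ c : ℝ, 0 < c ∧ ∀ (j : ℕ) (τ : ℝ), 1 ≤ 2 ^ j * |τ| →
      ENNReal.ofReal (c * ((2 : ℝ) ^ j) ^ (p * ((n : ℝ) / 2 + 1) - 1) *
        |τ| ^ (-((n : ℝ) * (p / 2 - 1)))) ≤ ∫⁻ x : EV n, ‖waveKernel (n + 1) φ j τ x‖ₑ ^ p := by
  obtain ⟨C, hC0, hC⟩ := exists_tail_le hφ n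
  have he := energy_pos hφ n
  set e := energy n φ with hed
  -- Then e(1 + M)² ≥ eM = 2C, so the tail outside the shell carries at most half of the energy e.
  set M : ℝ := 2 * C / e with hM
  have hM0 : 0 < M := by positivity
  have hCM : C / (1 + M) ^ 2 ≤ e / 2 := by
    rw [div_le_iff₀ (by positivity)]
    have : e * M = 2 * C := by rw [hM]; field_simp
    nlinarith [mul_pos he hM0, mul_pos (mul_pos he hM0) hM0]
  have hS := surf_univ_pos n
  set S := (surf n).real Set.univ with hSd
  set V : ℝ := S * (1 + M) ^ n * (2 * M) with hV
  have hV0 : 0 < V := by positivity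
  refine ⟨(e / 2) ^ (p / 2) / V ^ (p / 2 - 1), by positivity, fun j τ hτ => ?_⟩
  set Q : ℝ := 2 ^ j with hQd
  have hQ : 0 < Q := by positivity
  have hτ0 : 0 < |τ| := by
    by_contra h
    nlinarith [not_lt.1 h]
  have hKm := (continuous_waveKernel hφ n j τ).measurable.enorm
  set A : Set (EV n) := {x | M / Q ≤ |‖x‖ - (|τ|)|} with hA
  have hAm : MeasurableSet A := measurableSet_le measurable_const (by fun_prop)
  have h1 : ENNReal.ofReal (Q ^ (n + 1) * (e / 2)) ≤
      ∫⁻ x in Aᶜ, ‖waveKernel (n + 1) φ j τ x‖ₑ ^ (2 : ℝ) := by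
    have h2 := lintegral_add_compl (μ := volume)
      (fun x : EV n => ‖waveKernel (n + 1) φ j τ x‖ₑ ^ (2 : ℝ)) hAm
    rw [lintegral_waveKernel_sq hφ] at h2
    have h3 := (hC j τ M hM0.le).trans (ENNReal.ofReal_le_ofReal
      (mul_le_mul_of_nonneg_left hCM (by positivity : 0 ≤ Q ^ (n + 1))))
    refine ENNReal.le_of_add_le_add_left (a := ENNReal.ofReal (Q ^ (n + 1) * (e / 2)))
      ENNReal.ofReal_ne_top ?_
    rw [← ENNReal.ofReal_add (by positivity) (by positivity)]
    calc _ = ENNReal.ofReal (Q ^ (n + 1) * e) := by congr 1; ring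
      _ ≤ _ := by
        rw [← h2]
        gcongr
  have hsub : Aᶜ ⊆ {x : EV n | |‖x‖ - (|τ|)| ≤ M / Q} := fun x hx =>
    (not_le.1 (show ¬ M / Q ≤ |‖x‖ - (|τ|)| from hx)).le
  have hvol : volume Aᶜ ≤ ENNReal.ofReal (V * (|τ| ^ n * Q⁻¹)) :=
    (measure_mono hsub).trans (volume_annulus_le n hM0.le hQ hτ)
  have hjen : (∫⁻ x in Aᶜ, ‖waveKernel (n + 1) φ j τ x‖ₑ ^ (2 : ℝ)) ^ (p / 2) ≤
      volume Aᶜ ^ (p / 2 - 1) * ∫⁻ x in Aᶜ, ‖waveKernel (n + 1) φ j τ x‖ₑ ^ p := by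
    -- At p = 2 the exponent p/2 is 1, outside the range of `lintegral_mul_rpow_le`, but both sides
    -- coincide.
    rcases hp.eq_or_lt with rfl | hp2
    · simp
    have h := lintegral_mul_rpow_le (μ := volume.restrict Aᶜ) (by linarith : 1 < p / 2)
      (k := fun _ => 1) aemeasurable_const (hKm.pow_const (2 : ℝ)).aemeasurable
    simp only [one_mul, lintegral_const, Measure.restrict_apply MeasurableSet.univ, Set.univ_inter,
      ← ENNReal.rpow_mul] at h
    rwa [mul_div_cancel₀ p two_ne_zero] at h
  have hmain : ENNReal.ofReal ((Q ^ (n + 1) * (e / 2)) ^ (p / 2)) ≤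
      ENNReal.ofReal ((V * (|τ| ^ n * Q⁻¹)) ^ (p / 2 - 1)) *
        ∫⁻ x : EV n, ‖waveKernel (n + 1) φ j τ x‖ₑ ^ p := by
    rw [← ENNReal.ofReal_rpow_of_nonneg (by positivity) (by linarith),
      ← ENNReal.ofReal_rpow_of_nonneg (by positivity) (by linarith)]
    refine (ENNReal.rpow_le_rpow h1 (by linarith)).trans (hjen.trans ?_)
    gcongr
    · linarith
    · exact Measure.restrict_le_self
  have hfin := ENNReal.div_le_of_le_mul' hmain
  rw [← ENNReal.ofReal_div_of_pos (by positivity)] at hfin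
  refine le_trans (le_of_eq ?_) hfin
  congr 1
  clear_value V
  rw [Real.mul_rpow (by positivity) (by positivity), Real.mul_rpow hV0.le (by positivity),
    Real.mul_rpow (by positivity) (by positivity), Real.inv_rpow hQ.le,
    ← Real.rpow_natCast Q, ← Real.rpow_natCast |τ|, ← Real.rpow_mul hQ.le, ← Real.rpow_mul hτ0.le,
    Real.rpow_neg hτ0.le]
  have e1 : Q ^ (p * ((n : ℝ) / 2 + 1) - 1) = Q ^ (((n + 1 : ℕ) : ℝ) * (p / 2)) * Q ^ (p / 2 - 1) := by
    rw [← Real.rpow_add hQ]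
    congr 1
    push_cast
    ring
  rw [e1]
  field_simp

/-- The datum is the kernel at time -u, with u to the right of a nearly extremal interval [a, b].
For every discretization time near the interval the distance u - t to the focus is comparable to b -
a, so each time contributes about (b - a)^{-α}, and there are at least half as many of them as the
covering number. -/
theorem exists_lt_waveSum {φ : ℝ → ℝ} (hφ : IsBump φ) (n : ℕ) {E : Set ℝ} (hE : E ⊆ Set.Icc 1 2)
    (hne : E.Nonempty) {p : ℝ} (hp : 2 ≤ p) {s : ℝ}
    (hs : s < 1 / p * legendreAssouad E (p * sExp (n + 1) p)) {S : ℕ → Set ℝ}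
    (hS : ∀ j : ℕ, 1 ≤ j → IsDiscretization E ((2 : ℝ) ^ j)⁻¹ (S j)) (C : ℝ) :
    ∃ j : ℕ, 1 ≤ j ∧ ∃ f : EV n → ℂ, IsRadial f ∧ MemLp f (ENNReal.ofReal p) volume ∧
      ENNReal.ofReal (C * (2 : ℝ) ^ ((j : ℝ) * s)) * eLpNorm f (ENNReal.ofReal p) volume <
        waveSum φ p j (S j) f := by
  have hp0 : 0 < p := by linarith
  rw [mul_sExp hp0.ne', one_div, inv_mul_eq_div, lt_div_iff₀ hp0] at hs
  set α : ℝ := (n : ℝ) * (p / 2 - 1) with hα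
  have hα0 : 0 ≤ α := mul_nonneg (Nat.cast_nonneg n) (by linarith)
  obtain ⟨σ, hsσ, hσ⟩ := exists_between hs
  -- One half of the gap absorbs the loss in the norm of f, where η = γ/p gives η(p - 2) ≤ γ; the
  -- other half beats all constants once j is large.
  set γ : ℝ := (σ - s * p) / 2 with hγ
  have hγ0 : 0 < γ := by linarith [half_pos (sub_pos.2 hsσ)]
  set κ : ℝ := p * ((n : ℝ) / 2 + 1) - 1 with hκ
  obtain ⟨C₁, hC₁0, hC₁⟩ := exists_lintegral_waveKernel_rpow_le hφ n hp (div_pos hγ0 hp0)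
  obtain ⟨c, hc0, hc⟩ := exists_le_lintegral_waveKernel_rpow hφ.sq n hp
  set c' : ℝ := c * 4 ^ (-α) / 2 * 2 ^ (-|σ|) with hc'
  have hc'0 : 0 < c' := by positivity
  -- `C` may be zero or negative; a positive majorant permits taking p-th powers.
  set C' : ℝ := max C 1 with hC'
  have hC'0 : 0 < C' := lt_max_of_lt_right one_pos
  obtain ⟨J, hJ⟩ := pow_unbounded_of_one_lt (C' ^ p * C₁ / c')
    (Real.one_lt_rpow (by norm_num : (1 : ℝ) < 2) hγ0)
  obtain ⟨j, hj, a, b, hδl, hl1, hcov⟩ :=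
    exists_interval_of_lt_legendreAssouad hE hne hα0 hσ (max J 1)
  have hj1 : 1 ≤ j := (le_max_right _ _).trans hj
  set Q : ℝ := 2 ^ j with hQd
  have hQ : 0 < Q := by positivity
  have hQ1 : 1 ≤ Q := one_le_pow₀ (by norm_num)
  have hδ : 0 < Q⁻¹ := inv_pos.2 hQ
  have hl : 0 < b - a := hδ.trans_le hδl
  have hdisc := hS j hj1
  obtain ⟨T, hT⟩ := (hdisc.finite hE hδ).exists_finset_coe
  rw [← hT] at hdisc
  set T' := T.filter fun t => a - Q⁻¹ ≤ t ∧ t ≤ b + Q⁻¹ with hT'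
  have hcard : (covNum (E ∩ Set.Icc a b) Q⁻¹ : ℝ) ≤ 2 * T'.card := by
    exact_mod_cast covNum_le_two_mul_card hδ hdisc a b
  have hlow : 2 ^ (-|σ|) * (2 : ℝ) ^ ((j : ℝ) * σ) < (b - a) ^ (-α) * (2 * T'.card) :=
    hcov.trans_le (by gcongr)
  obtain ⟨t₀, ht₀⟩ : T'.Nonempty := by
    rw [Finset.nonempty_iff_ne_empty]
    intro h
    rw [h] at hlow
    simp only [Finset.card_empty, Nat.cast_zero, mul_zero] at hlow
    exact absurd hlow (not_lt.2 (by positivity))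
  -- The times of `T'` may leave [a, b] by Q⁻¹ ≤ b - a on either side, so this choice places u - t
  -- between b - a and 4(b - a).
  set u : ℝ := b + 2 * (b - a) with hu
  have hdist : ∀ t ∈ T', b - a ≤ u - t ∧ u - t ≤ 4 * (b - a) := fun t ht => by
    obtain ⟨h1, h2⟩ := (Finset.mem_filter.1 ht).2
    constructor <;> linarith
  have hu1 : 1 ≤ |-u| := by
    have h1 := (hE (hdisc.prop.1 (Finset.mem_filter.1 ht₀).1)).1
    rw [abs_neg]
    exact le_trans (by linarith [(hdist t₀ ht₀).1]) (le_abs_self u)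
  set f : EV n → ℂ := waveKernel (n + 1) φ j (-u) with hf
  have hup := hC₁ j (-u) hu1
  have hmem : MemLp f (ENNReal.ofReal p) volume := by
    refine ⟨(continuous_waveKernel hφ n j (-u)).aestronglyMeasurable, ?_⟩
    rw [← ENNReal.rpow_lt_top_iff_of_pos hp0, eLpNorm_ofReal_rpow hp0]
    exact hup.trans_lt ENNReal.ofReal_lt_top
  refine ⟨j, hj1, f, isRadial_waveKernel hφ n j (-u), hmem, ?_⟩
  have hsum : ENNReal.ofReal (c' * Q ^ (κ + σ)) ≤
      ∑ t ∈ T, ∫⁻ x, ‖halfWave φ j t f x‖ₑ ^ p := by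
    calc _ ≤ ENNReal.ofReal (T'.card * (c * Q ^ κ * (4 * (b - a)) ^ (-α))) := by
          refine ENNReal.ofReal_le_ofReal ?_
          rw [Real.mul_rpow (by norm_num) hl.le, Real.rpow_add hQ]
          have e : Q ^ σ = (2 : ℝ) ^ ((j : ℝ) * σ) := by
            rw [hQd, ← Real.rpow_natCast, ← Real.rpow_mul two_pos.le]
          rw [e]
          calc _ = c * 4 ^ (-α) / 2 * Q ^ κ * (2 ^ (-|σ|) * (2 : ℝ) ^ ((j : ℝ) * σ)) := by
                rw [hc']; ring
            _ ≤ c * 4 ^ (-α) / 2 * Q ^ κ * ((b - a) ^ (-α) * (2 * T'.card)) := by gcongr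
            _ = _ := by ring
      _ = ∑ t ∈ T', ENNReal.ofReal (c * Q ^ κ * (4 * (b - a)) ^ (-α)) := by
          rw [Finset.sum_const, nsmul_eq_mul, ENNReal.ofReal_mul (by positivity),
            ENNReal.ofReal_natCast]
      _ ≤ ∑ t ∈ T', ∫⁻ x, ‖halfWave φ j t f x‖ₑ ^ p := by
          refine Finset.sum_le_sum fun t ht => ?_
          obtain ⟨h1, h2⟩ := hdist t ht
          have habs : |t + -u| = u - t := by
            rw [← sub_eq_add_neg, abs_sub_comm, abs_of_pos (by linarith)]
          have h3 := hc j (t + -u) (by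
            rw [habs]
            calc (1 : ℝ) = Q * Q⁻¹ := (mul_inv_cancel₀ hQ.ne').symm
              _ ≤ Q * (u - t) := by gcongr; linarith)
          simp_rw [hf, halfWave_waveKernel hφ]
          refine le_trans (ENNReal.ofReal_le_ofReal ?_) h3
          rw [habs]
          refine mul_le_mul_of_nonneg_left ?_ (by positivity)
          exact Real.rpow_le_rpow_of_nonpos (by linarith) h2 (by linarith)
      _ ≤ _ := Finset.sum_le_sum_of_subset (Finset.filter_subset _ _)
  rw [← hT, waveSum_eq φ hp0, one_div, ENNReal.lt_rpow_inv_iff hp0,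
    ENNReal.mul_rpow_of_nonneg _ _ hp0.le, eLpNorm_ofReal_rpow hp0]
  refine lt_of_lt_of_le ?_ hsum
  calc _ ≤ ENNReal.ofReal ((C' * (2 : ℝ) ^ ((j : ℝ) * s)) ^ p) *
        ENNReal.ofReal (C₁ * Q ^ (κ + γ / p * (p - 2))) := by
        rw [← ENNReal.ofReal_rpow_of_nonneg (by positivity) hp0.le]
        refine mul_le_mul' (ENNReal.rpow_le_rpow (ENNReal.ofReal_le_ofReal ?_) hp0.le) hup
        exact mul_le_mul_of_nonneg_right (le_max_left _ _) (by positivity)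
    _ < _ := by
        rw [← ENNReal.ofReal_mul (by positivity)]
        refine (ENNReal.ofReal_lt_ofReal_iff (by positivity)).2 ?_
        have e1 : ((2 : ℝ) ^ ((j : ℝ) * s)) ^ p = Q ^ (s * p) := by
          rw [hQd, ← Real.rpow_natCast, ← Real.rpow_mul two_pos.le, ← Real.rpow_mul two_pos.le,
            mul_assoc]
        have e2 : Q ^ (κ + σ) = Q ^ γ * Q ^ (s * p + (κ + γ)) := by
          rw [← Real.rpow_add hQ]
          congr 1
          rw [hγ]
          ring
        have h1 : C' ^ p * C₁ < c' * Q ^ γ := by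
          rw [div_lt_iff₀ hc'0] at hJ
          refine hJ.trans_le ?_
          rw [mul_comm c']
          gcongr
          calc ((2 : ℝ) ^ γ) ^ J ≤ (2 ^ γ) ^ j :=
                pow_le_pow_right₀ (Real.one_le_rpow (by norm_num) hγ0.le) ((le_max_left _ _).trans hj)
            _ = Q ^ γ := by
                rw [hQd, ← Real.rpow_natCast, ← Real.rpow_natCast, ← Real.rpow_mul two_pos.le,
                  ← Real.rpow_mul two_pos.le, mul_comm]
        have h2 : Q ^ (s * p + (κ + γ / p * (p - 2))) ≤ Q ^ (s * p + (κ + γ)) := by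
          refine Real.rpow_le_rpow_of_exponent_le hQ1 ?_
          have : γ / p * (p - 2) ≤ γ := by
            rw [div_mul_eq_mul_div, div_le_iff₀ hp0]
            nlinarith
          linarith
        rw [Real.mul_rpow hC'0.le (by positivity), e1, e2]
        calc _ = C' ^ p * C₁ * Q ^ (s * p + (κ + γ / p * (p - 2))) := by
              rw [Real.rpow_add hQ (s * p)]
              ring
          _ ≤ C' ^ p * C₁ * Q ^ (s * p + (κ + γ)) := by gcongr
          _ < c' * Q ^ γ * Q ^ (s * p + (κ + γ)) := by gcongr
          _ = _ := by ring

end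

end FractalSmoothing

theorem theorem1p1 (d : ℕ) (hd : 1 ≤ d) (φ : ℝ → ℝ) (hφ : FractalSmoothing.IsBump φ)
    (E : Set ℝ) (hE : E ⊆ Set.Icc 1 2) (p : ℝ) (hp : 2 ≤ p) :
    (∀ ε : ℝ, 0 < ε → ∃ C : ℝ, 0 < C ∧
      ∀ j : ℕ, 1 ≤ j → ∀ S : Set ℝ, FractalSmoothing.IsDiscretization E ((2 : ℝ) ^ j)⁻¹ S →
      ∀ f : EuclideanSpace ℝ (Fin d) → ℂ, FractalSmoothing.IsRadial f →
        MemLp f (ENNReal.ofReal p) volume →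
        FractalSmoothing.waveSum φ p j S f ≤
          ENNReal.ofReal (C * (2 : ℝ) ^ ((j : ℝ) *
            (1 / p * FractalSmoothing.legendreAssouad E (p * FractalSmoothing.sExp d p) + ε))) *
          eLpNorm f (ENNReal.ofReal p) volume) ∧
    (E.Nonempty →
      ∀ s : ℝ, s < 1 / p * FractalSmoothing.legendreAssouad E (p * FractalSmoothing.sExp d p) →
      ∀ S : ℕ → Set ℝ,
        (∀ j : ℕ, 1 ≤ j → FractalSmoothing.IsDiscretization E ((2 : ℝ) ^ j)⁻¹ (S j)) →
      ∀ C : ℝ, ∃ j : ℕ, 1 ≤ j ∧ ∃ f : EuclideanSpace ℝ (Fin d) → ℂ,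
        FractalSmoothing.IsRadial f ∧ MemLp f (ENNReal.ofReal p) volume ∧
        ENNReal.ofReal (C * (2 : ℝ) ^ ((j : ℝ) * s)) * eLpNorm f (ENNReal.ofReal p) volume <
          FractalSmoothing.waveSum φ p j (S j) f) := by
  obtain ⟨n, rfl⟩ : ∃ n, d = n + 1 := ⟨d - 1, by omega⟩
  refine ⟨fun ε hε => ?_, fun hne s hs S hS C => ?_⟩
  · obtain ⟨C, hC0, hC⟩ := FractalSmoothing.exists_waveSum_le hφ n hE hp hε
    exact ⟨C, hC0, fun j _ S hS f hf hfm => hC j S hS f hf hfm.1⟩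
  · exact FractalSmoothing.exists_lt_waveSum hφ n hE hne hp hs hS C
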